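/- **Setting.** Let $\mathcal C$ be a small $\mathbb C$-linear category. *The operad $\underline{\mathrm{PaB}}$.* For $r\ge 0$ let $\mathcal T_r$ be the set of parenthesized words in which each of the letters $1,\dots,r$ occurs exactly once ($\mathcal T_0=\{\emptyset\}$, $\mathcal T_1=\{1\}$). Each $A\in\mathcal T_r$ determines a permutation $g_A\in S_r$, the order of its letters. $\underline{\mathrm{PaB}}(r)$ is the ($\mathbb C$-linear) category with object set $\mathcal T_r$ whose morphisms $A\to B$ are (formal combinations of) the braids in the braid group $B_r$ whose underlying permutation is $g_A^{-1}g_B$; composition is multiplication of braids. $S_r$ acts by renaming letters. The operadic composition $A\circ(B_1,\dots,B_n)$ grafts $B_i$ at the letter $i$ of $A$, where grafting $\emptyset$ erases the letter; on morphisms it is cabling of braids. Let $\sigma:12\to 21$ be the elementary crossing, $\alpha:(12)3\to 1(23)$ the trivial braid, and $\mathrm{std}_r=1(2(\cdots(r-1\ r)\cdots))$, with $\mathrm{std}_1=1$. *The operads $\mathcal{PE}\mathrm{nd}_{\mathcal C}$ and $\mathcal{E}\mathrm{nd}_{\mathcal C}$.* $\mathcal{PE}\mathrm{nd}_{\mathcal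 C}(r)$ is the category of functors $\mathcal C\times(\mathcal C^{\mathrm{op}})^r\to\mathrm{Vect}_{\mathbb C}$ that are $\mathbb C$-linear in each variable, with composition $$F\circ(F_1,\dots,F_n)=\int^{N_1,\dots,N_n\in\mathcal C}F(\bullet,N_1,\dots,N_n)\otimes F_1(N_1,\bullet)\otimes\cdots\otimes F_n(N_n,\bullet)$$ and unit $\mathrm{Hom}_{\mathcal C}(\bullet_1,\bullet_0)$. $\mathcal{E}\mathrm{nd}_{\mathcal C}(r)$ is the category of functors $\mathcal C^r\to\mathcal C$ that are $\mathbb C$-linear in each variable, with composition of functors and unit $\mathrm{id}_{\mathcal C}$. *Lax 2-morphisms.* A lax 2-morphism $(\rho,\mu):\underline{\mathrm{PaB}}^{\mathrm{op}}\to\mathcal{PE}\mathrm{nd}_{\mathcal C}$ (a lax 2-action of $\underline{\mathrm{PaB}}$ on $\mathcal C$) consists of linear functors $\rho:\underline{\mathrm{PaB}}(r)^{\mathrm{op}}\to\mathcal{PE}\mathrm{nd}_{\mathcal C}(r)$, $r\ge 0$, that are equivariant for $S_r$ and send the tree $1$ to the unit, and maps $\mu_{A;B_1,\dots,B_n}:\rho(A)\circ(\rho(B_1),\dots,\rho(B_n))\to\rho(A\circ(B_1,\dots,B_n))$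 that are natural in $A,B_1,\dots,B_n$, associative (up to the Fubini isomorphism of coends) and equivariant. It is *strong* if all $\mu$ are isomorphisms and *representative* if for all $r\ge0$, $A\in\mathcal T_r$ and $M_1,\dots,M_r\in\mathcal C$ the functor $\rho(A)(\bullet,M_1,\dots,M_r)$ is representable, i.e. isomorphic to $\mathrm{Hom}_{\mathcal C}(X,\bullet)$ for some $X\in\mathcal C$. Strong 2-morphisms $(T,\mu):\underline{\mathrm{PaB}}\to\mathcal{E}\mathrm{nd}_{\mathcal C}$ are defined in the same way. For $A\in\mathcal T_r$ and $p\in\{1,\dots,r\}$, $A\circ_p\emptyset$ denotes the composition with $\emptyset$ at $p$ and with the unit at the other letters, and likewise $\rho(A)\circ_p\rho(\emptyset)$. Iterating $\mu$ along $\mathrm{std}_r=12\circ_2(12\circ_2(\cdots(12\circ_2 12)))$ gives a natural transformation $\mu_{\mathrm{std}_r}:\int_{\mathrm{std}_r}\rho(12)^{r-1}\to\rho(\mathrm{std}_r)$ from the iterated coend. **Proposition.** Let $(\rho,\mu):\underline{\mathrm{PaB}}^{\mathrm{op}}\to\mathcal{PE}\mathrm{nd}_{\mathcal C}$ be a lax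 2-morphism such that 1. $\rho(\emptyset)$ is representable; 2. for all $M_1,M_2\in\mathcal C$ the functor $\rho(12)(\bullet,M_1,M_2)$ is representable; 3. $\mu_{\mathrm{std}_r}:\int_{\mathrm{std}_r}\rho(12)^{r-1}\to\rho(\mathrm{std}_r)$ is an isomorphism for every $r\ge3$; 4. $\mu:\rho(\mathrm{std}_r)\circ_p\rho(\emptyset)\to\rho(\mathrm{std}_r\circ_p\emptyset)$ is an isomorphism for all $r\ge1$ and $p\in\{1,\dots,r\}$. Then $\rho$ is representative and strong, and it induces a strong 2-morphism $T:\underline{\mathrm{PaB}}\to\mathcal{E}\mathrm{nd}_{\mathcal C}$: there are natural isomorphisms $\theta_A:\mathrm{Hom}_{\mathcal C}(T(A)(\bullet),\bullet)\to\rho(A)$, natural in $A$, equivariant, canonical for $A=1$, and compatible with the maps $\mu$ of $T$ and of $\rho$. Moreover $\mathcal C$ is a braided tensor category (with $\mathbb C$-bilinear tensor product) with tensor product $T(12)$, unit object $T(\emptyset)$ and braiding $T(\sigma)$; if in addition the map $\mu_{1;1}$ of $T$ is the identity of $\mathrm{id}_{\mathcal C}$, then its associator is given by $T(\alpha)$ together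 with the maps $\mu$ of $T$ for $(12)3=12\circ_1 12$ and $1(23)=12\circ_2 12$, and its unit isomorphisms are given by the maps $\mu$ of $T$ for $12\circ_1\emptyset=1$ and $12\circ_2\emptyset=1$. -/

import Mathlib

namespace PaBOp

open CategoryTheory Opposite

/-- The Artin relations between the generators `σ_i`, `i : ℕ`. -/
inductive braidRel : FreeGroup ℕ → Prop
  | yangBaxter (i : ℕ) : braidRel
      (FreeGroup.of i * FreeGroup.of (i + 1) * FreeGroup.of i *
        (FreeGroup.of (i + 1) * FreeGroup.of i * FreeGroup.of (i + 1))⁻¹)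
  | far (i j : ℕ) (h : i + 2 ≤ j) : braidRel
      (FreeGroup.of i * FreeGroup.of j * (FreeGroup.of j * FreeGroup.of i)⁻¹)

/-- The braid group `B_∞` on countably many strands, by its Artin presentation. The braid group
`B_n` is its subgroup `strands n` generated by the first `n - 1` generators. -/
abbrev BraidInf : Type := PresentedGroup {r | braidRel r}

namespace BraidInf

/-- The crossing of the strands in positions `i` and `i + 1` (positions are counted from `0`). -/
def gen (i : ℕ) : BraidInf := PresentedGroup.of i

theorem gen_yangBaxter (i : ℕ) :
    gen i * gen (i + 1) * gen i = gen (i + 1) * gen i * gen (i + 1) :=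
  PresentedGroup.mk_eq_mk_of_mul_inv_mem (braidRel.yangBaxter i)

theorem gen_far {i j : ℕ} (h : i + 2 ≤ j) : gen i * gen j = gen j * gen i :=
  PresentedGroup.mk_eq_mk_of_mul_inv_mem (braidRel.far i j h)

theorem commute_gen {i j : ℕ} (h : i + 2 ≤ j ∨ j + 2 ≤ i) : Commute (gen i) (gen j) := by
  rcases h with h | h
  · exact gen_far h
  · exact (gen_far h).symm

/-- Homomorphisms out of the braid group from elements satisfying the Artin relations. -/
def lift {G : Type} [Group G] (f : ℕ → G)
    (yb : ∀ i, f i * f (i + 1) * f i = f (i + 1) * f i * f (i + 1))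
    (far : ∀ i j, i + 2 ≤ j → f i * f j = f j * f i) : BraidInf →* G :=
  PresentedGroup.toGroup (f := f) (by
    rintro r (⟨i⟩ | ⟨i, j, h⟩)
    · simp only [map_mul, map_inv, FreeGroup.lift_apply_of, yb i, mul_inv_cancel]
    · simp only [map_mul, map_inv, FreeGroup.lift_apply_of, far i j h, mul_inv_cancel])

@[simp] theorem lift_gen {G : Type} [Group G] (f : ℕ → G) (yb) (far) (i : ℕ) :
    lift f yb far (gen i) = f i := PresentedGroup.toGroup.of _

/-- The underlying permutation of a braid. -/
def perm : BraidInf →* Equiv.Perm ℕ :=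
  lift (fun i => Equiv.swap i (i + 1))
    (by
      intro i; ext x
      simp only [Equiv.Perm.mul_apply, Equiv.swap_apply_def]
      split_ifs <;> omega)
    (by
      intro i j h; ext x
      simp only [Equiv.Perm.mul_apply, Equiv.swap_apply_def]
      split_ifs <;> omega)

@[simp] theorem perm_gen (i : ℕ) : perm (gen i) = Equiv.swap i (i + 1) := lift_gen _ _ _ i

/-- The braid moved to the right by `o` positions. -/
def shift (o : ℕ) : BraidInf →* BraidInf :=
  lift (fun i => gen (o + i)) (fun i => gen_yangBaxter (o + i))
    (fun _ _ h => gen_far (by omega))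

@[simp] theorem shift_gen (o i : ℕ) : shift o (gen i) = gen (o + i) := lift_gen _ _ _ i

/-- The braids that involve only the positions `a, …, b - 1`. -/
def on (a b : ℕ) : Subgroup BraidInf := Subgroup.closure {x | ∃ i, a ≤ i ∧ i + 1 < b ∧ x = gen i}

theorem gen_mem_on {a b i : ℕ} (h : a ≤ i) (h' : i + 1 < b) : gen i ∈ on a b :=
  Subgroup.subset_closure ⟨i, h, h', rfl⟩

theorem on_mono {a b a' b' : ℕ} (h : a' ≤ a) (h' : b ≤ b') : on a b ≤ on a' b' :=
  Subgroup.closure_mono (by rintro _ ⟨i, h1, h2, rfl⟩; exact ⟨i, by omega, by omega, rfl⟩)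

theorem commute_on {a b c d : ℕ} (h : b ≤ c) {x y : BraidInf} (hx : x ∈ on a b) (hy : y ∈ on c d) :
    Commute x y := by
  induction hx using Subgroup.closure_induction with
  | mem x hx =>
    obtain ⟨i, _, hi, rfl⟩ := hx
    induction hy using Subgroup.closure_induction with
    | mem y hy =>
      obtain ⟨j, hj, _, rfl⟩ := hy
      exact commute_gen (Or.inl (by omega))
    | one => exact Commute.one_right _
    | mul _ _ _ _ h1 h2 => exact h1.mul_right h2
    | inv _ _ h1 => exact h1.inv_right
  | one => exact Commute.one_left _
  | mul _ _ _ _ h1 h2 => exact h1.mul_left h2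
  | inv _ _ h1 => exact h1.inv_left

/-- The strand in position `o` crosses the `b` strands in positions `o + 1, …, o + b`. -/
def row (o : ℕ) : ℕ → BraidInf
  | 0 => 1
  | b + 1 => row o b * gen (o + b)

/-- The block of the `a` strands in positions `o, …, o + a - 1` crosses, as a ribbon without
twist, the following block of `b` strands. In particular `cross o 1 1 = gen o`. -/
def cross (o : ℕ) : ℕ → ℕ → BraidInf
  | 0, _ => 1
  | a + 1, b => row (o + a) b * cross o a b

theorem row_add (o b c : ℕ) : row o (b + c) = row o b * row (o + b) c := by
  induction c with
  | zero => simp [row]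
  | succ c ih => rw [← Nat.add_assoc, row, ih, row, mul_assoc, Nat.add_assoc]

theorem row_mem (o b : ℕ) : row o b ∈ on o (o + b + 1) := by
  induction b with
  | zero => exact one_mem _
  | succ b ih =>
    exact mul_mem (on_mono le_rfl (by omega) ih) (gen_mem_on (by omega) (by omega))

theorem cross_mem (o a b : ℕ) : cross o a b ∈ on o (o + a + b) := by
  induction a with
  | zero => exact one_mem _
  | succ a ih =>
    exact mul_mem (on_mono (by omega) (by omega) (row_mem (o + a) b))
      (on_mono le_rfl (by omega) ih)

theorem row_mul_gen (o b j : ℕ) (h : j + 1 < b) :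
    row o b * gen (o + j) = gen (o + j + 1) * row o b := by
  induction b with
  | zero => omega
  | succ b ih =>
    rcases Nat.lt_or_ge (j + 1) b with h' | h'
    · rw [row, mul_assoc, (commute_gen (i := o + b) (j := o + j) (Or.inr (by omega))).eq,
        ← mul_assoc, ih h', mul_assoc]
    · obtain rfl : b = j + 1 := by omega
      have hc : Commute (row o j) (gen (o + j + 1)) :=
        commute_on (b := o + j + 1) (c := o + j + 1) (d := o + j + 3) le_rfl (row_mem o j)
          (gen_mem_on le_rfl (by omega))
      rw [row, row, ← Nat.add_assoc]
      calc row o j * gen (o + j) * gen (o + j + 1) * gen (o + j)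
          = row o j * (gen (o + j) * gen (o + j + 1) * gen (o + j)) := by simp only [mul_assoc]
        _ = row o j * gen (o + j + 1) * (gen (o + j) * gen (o + j + 1)) := by
            rw [gen_yangBaxter]; simp only [mul_assoc]
        _ = _ := by rw [hc.eq]; simp only [mul_assoc]

theorem cross_mul_gen (o a b j : ℕ) (h : j + 1 < b) :
    cross o a b * gen (o + j) = gen (o + a + j) * cross o a b := by
  induction a with
  | zero => simp [cross]
  | succ a ih =>
    rw [cross, mul_assoc, ih, ← mul_assoc, row_mul_gen (o + a) b j h, mul_assoc]
    congr 2; omega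

theorem cross_mul_row (o a b j c : ℕ) (h : j + c < b) :
    cross o a b * row (o + j) c = row (o + a + j) c * cross o a b := by
  induction c with
  | zero => simp [row]
  | succ c ih =>
    rw [row, ← mul_assoc, ih (by omega), mul_assoc,
      Nat.add_assoc o j c, cross_mul_gen o a b (j + c) (by omega), row, mul_assoc,
      ← Nat.add_assoc]

theorem cross_mul_cross (o a b c : ℕ) :
    cross o a (b + c) * cross o b c = cross (o + a) b c * cross o a (b + c) := by
  suffices H : ∀ b', b' ≤ b →
      cross o a (b + c) * cross o b' c = cross (o + a) b' c * cross o a (b + c) from H b le_rfl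
  intro b' hb
  induction b' with
  | zero => simp [cross]
  | succ b' ih =>
    rcases Nat.eq_zero_or_pos c with rfl | hc
    · rw [cross, row, one_mul, ih (by omega), cross, row, one_mul]
    · rw [cross, ← mul_assoc, cross_mul_row o a (b + c) b' c (by omega), mul_assoc, ih (by omega),
        cross, mul_assoc]

theorem cross_add (o a b c : ℕ) : cross o a (b + c) = cross o a b * cross (o + b) a c := by
  induction a with
  | zero => simp [cross]
  | succ a ih =>
    have hc : Commute (cross o a b) (row (o + a + b) c) :=
      commute_on le_rfl (cross_mem o a b) (row_mem _ _)
    rw [cross, ih, row_add, cross, cross]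
    have e : o + b + a = o + a + b := by omega
    rw [e, mul_assoc, ← mul_assoc (row (o + a + b) c), ← hc.eq]
    simp only [mul_assoc]

theorem cross_yangBaxter (o a b c : ℕ) :
    cross o a b * cross (o + b) a c * cross o b c =
      cross (o + a) b c * cross o a c * cross (o + c) a b := by
  rw [← cross_add, cross_mul_cross, Nat.add_comm b c, cross_add, mul_assoc]

/-- The first position of block number `i`, if block `j` has `k j` strands. -/
def off (k : ℕ → ℕ) (i : ℕ) : ℕ := ∑ j ∈ Finset.range i, k j

theorem off_succ (k : ℕ → ℕ) (i : ℕ) : off k (i + 1) = off k i + k i := Finset.sum_range_succ _ _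

theorem off_mono (k : ℕ → ℕ) {i j : ℕ} (h : i ≤ j) : off k i ≤ off k j :=
  Finset.sum_le_sum_of_subset (Finset.range_mono h)

theorem off_comp_perm (k : ℕ → ℕ) (π : Equiv.Perm ℕ) (n : ℕ) (h : ∀ i, i < n ↔ π i < n) :
    off (k ∘ π) n = off k n := by
  apply Finset.sum_equiv π
  · intro i; simpa using h i
  · intro i _; rfl

theorem off_comp_swap (k : ℕ → ℕ) (i n : ℕ) (h : n ≠ i + 1) :
    off (k ∘ Equiv.swap i (i + 1)) n = off k n := by
  apply off_comp_perm
  intro x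
  simp only [Equiv.swap_apply_def]
  split_ifs <;> omega

/-- Permutations act on braid-valued functions of the block sizes. -/
def act : Equiv.Perm ℕ →* MulAut ((ℕ → ℕ) → BraidInf) where
  toFun π :=
    { toFun := fun f k => f (k ∘ π)
      invFun := fun f k => f (k ∘ π.symm)
      left_inv := fun f => by funext k; simp [Function.comp_assoc]
      right_inv := fun f => by funext k; simp [Function.comp_assoc]
      map_mul' := fun _ _ => rfl }
  map_one' := rfl
  map_mul' _ _ := rfl

/-- The cabling of a generator, as a function of the block sizes, with its permutation. -/
def cableGen (i : ℕ) : ((ℕ → ℕ) → BraidInf) ⋊[act] Equiv.Perm ℕ :=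
  ⟨fun k => cross (off k i) (k i) (k (i + 1)), Equiv.swap i (i + 1)⟩

theorem act_apply (π : Equiv.Perm ℕ) (f : (ℕ → ℕ) → BraidInf) (k : ℕ → ℕ) :
    act π f k = f (k ∘ π) := rfl

theorem swap_left' (i : ℕ) : Equiv.swap i (i + 1) i = i + 1 := Equiv.swap_apply_left _ _

theorem swap_off {i j : ℕ} (h : j ≠ i) (h' : j ≠ i + 1) : Equiv.swap i (i + 1) j = j :=
  Equiv.swap_apply_of_ne_of_ne h h'

theorem cable_yangBaxter (i : ℕ) : cableGen i * cableGen (i + 1) * cableGen i =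
    cableGen (i + 1) * cableGen i * cableGen (i + 1) := by
  apply SemidirectProduct.ext
  · funext k
    have s1 : Equiv.swap (i + 1) (i + 1 + 1) i = i := swap_off (by omega) (by omega)
    have s2 : Equiv.swap i (i + 1) (i + 1 + 1) = i + 1 + 1 := swap_off (by omega) (by omega)
    simp only [cableGen, SemidirectProduct.mul_left, SemidirectProduct.mul_right,
      Pi.mul_apply, act_apply, Equiv.Perm.coe_mul, ← Function.comp_assoc]
    simp only [off_succ, off_comp_swap _ i i (by omega), off_comp_swap _ (i + 1) i (by omega),
      Function.comp_apply, Equiv.swap_apply_left, Equiv.swap_apply_right, s1, s2]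
    exact cross_yangBaxter _ _ _ _
  · have := congrArg perm (gen_yangBaxter i)
    simpa [cableGen] using this

theorem cable_far (i j : ℕ) (h : i + 2 ≤ j) :
    cableGen i * cableGen j = cableGen j * cableGen i := by
  apply SemidirectProduct.ext
  · funext k
    have s1 : Equiv.swap i (i + 1) j = j := swap_off (by omega) (by omega)
    have s2 : Equiv.swap i (i + 1) (j + 1) = j + 1 := swap_off (by omega) (by omega)
    have s3 : Equiv.swap j (j + 1) i = i := swap_off (by omega) (by omega)
    have s4 : Equiv.swap j (j + 1) (i + 1) = i + 1 := swap_off (by omega) (by omega)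
    simp only [cableGen, SemidirectProduct.mul_left, Pi.mul_apply, act_apply]
    simp only [off_comp_swap _ i j (by omega), off_comp_swap _ j i (by omega),
      Function.comp_apply, s1, s2, s3, s4]
    refine (commute_on ?_ (cross_mem _ _ _) (cross_mem _ _ _)).eq
    rw [← off_succ, ← off_succ]
    exact off_mono k h
  · have := congrArg perm (gen_far h)
    simpa [cableGen] using this

/-- Cabling is a crossed homomorphism: it is a homomorphism into a semidirect product. -/
def cableHom : BraidInf →* ((ℕ → ℕ) → BraidInf) ⋊[act] Equiv.Perm ℕ :=
  lift cableGen cable_yangBaxter cable_far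

/-- The cabling of `β`: the strand in position `j` of the first factor is replaced by `k j` parallel
strands. It is determined by `cable_gen` and `cable_mul` below. -/
def cable (β : BraidInf) (k : ℕ → ℕ) : BraidInf := (cableHom β).left k

theorem cableHom_right (β : BraidInf) : (cableHom β).right = perm β := by
  have : SemidirectProduct.rightHom.comp cableHom = perm := by
    apply PresentedGroup.ext
    intro i
    change (cableHom (gen i)).right = perm (gen i)
    rw [perm_gen, cableHom, lift_gen, cableGen]
  exact DFunLike.congr_fun this β

theorem cable_gen (i : ℕ) (k : ℕ → ℕ) :
    cable (gen i) k = cross (off k i) (k i) (k (i + 1)) := by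
  rw [cable, cableHom, lift_gen, cableGen]

@[simp] theorem cable_one (k : ℕ → ℕ) : cable 1 k = 1 := by simp [cable]

theorem cable_mul (β γ : BraidInf) (k : ℕ → ℕ) :
    cable (β * γ) k = cable β k * cable γ (k ∘ perm β) := by
  simp [cable, act_apply, cableHom_right]

theorem cable_inv (β : BraidInf) (k : ℕ → ℕ) :
    cable β⁻¹ k = (cable β (k ∘ perm β⁻¹))⁻¹ := by
  rw [eq_inv_iff_mul_eq_one, ← cable_mul, inv_mul_cancel, cable_one]

/-- The braid group `B_n` on `n` strands, inside `B_∞`. -/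
def strands (n : ℕ) : Subgroup BraidInf := on 0 n

theorem perm_on {a b : ℕ} {β : BraidInf} (h : β ∈ on a b) {x : ℕ} (hx : x < a ∨ b ≤ x) :
    perm β x = x := by
  induction h using Subgroup.closure_induction with
  | mem β hβ =>
    obtain ⟨i, h1, h2, rfl⟩ := hβ
    rw [perm_gen]; exact swap_off (by omega) (by omega)
  | one => simp
  | mul _ _ _ _ h1 h2 => simp [h1, h2]
  | inv _ _ h1 => rw [map_inv, Equiv.Perm.inv_eq_iff_eq, h1]

theorem perm_lt {n : ℕ} {β : BraidInf} (h : β ∈ strands n) (x : ℕ) : x < n ↔ perm β x < n := by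
  constructor
  · intro hx
    by_contra h'
    have e := perm_on h (x := perm β x) (Or.inr (by omega))
    have := (perm β).injective e
    omega
  · intro hx
    by_contra h'
    have e := perm_on h (x := x) (Or.inr (by omega))
    omega

theorem off_perm {n : ℕ} {β : BraidInf} (h : β ∈ strands n) (k : ℕ → ℕ) :
    off (k ∘ perm β) n = off k n :=
  off_comp_perm k _ n (perm_lt h)

theorem cable_mem {n : ℕ} {β : BraidInf} (h : β ∈ strands n) (k : ℕ → ℕ) :
    cable β k ∈ strands (off k n) := by
  induction h using Subgroup.closure_induction generalizing k with
  | mem β hβ =>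
    obtain ⟨i, h1, h2, rfl⟩ := hβ
    rw [cable_gen]
    refine on_mono (Nat.zero_le _) ?_ (cross_mem _ _ _)
    rw [← off_succ, ← off_succ]
    exact off_mono k h2
  | one => rw [cable_one]; exact one_mem _
  | mul β γ hβ hγ h1 h2 =>
    rw [cable_mul]
    refine mul_mem (h1 k) ?_
    rw [← off_perm hβ]; exact h2 _
  | inv β hβ h1 =>
    rw [cable_inv]
    refine inv_mem ?_
    rw [← off_perm (β := β⁻¹) (inv_mem hβ)]; exact h1 _

theorem perm_row (o b x : ℕ) : perm (row o b) x =
    if x = o + b then o else if o ≤ x ∧ x < o + b then x + 1 else x := by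
  induction b generalizing x with
  | zero => simp only [row, map_one, Equiv.Perm.one_apply]; split_ifs <;> omega
  | succ b ih =>
    rw [row, map_mul, perm_gen, Equiv.Perm.mul_apply, ih]
    simp only [Equiv.swap_apply_def]
    split_ifs <;> omega

theorem perm_cross (o a b x : ℕ) : perm (cross o a b) x =
    if o ≤ x ∧ x < o + b then x + a
    else if o + b ≤ x ∧ x < o + b + a then x - b else x := by
  induction a generalizing x with
  | zero => simp only [cross, map_one, Equiv.Perm.one_apply]; split_ifs <;> omega
  | succ a ih =>
    rw [cross, map_mul, Equiv.Perm.mul_apply, ih, perm_row]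
    split_ifs <;> omega

theorem perm_cable (β : BraidInf) (k : ℕ → ℕ) (j r : ℕ) (h : r < k (perm β j)) :
    perm (cable β k) (off (k ∘ perm β) j + r) = off k (perm β j) + r := by
  have hβ : β ∈ Subgroup.closure (Set.range gen) := by
    have : Subgroup.closure (Set.range gen) = ⊤ := PresentedGroup.closure_range_of _
    rw [this]; trivial
  induction hβ using Subgroup.closure_induction generalizing k j with
  | mem β hβ =>
    obtain ⟨i, rfl⟩ := hβ
    rw [perm_gen] at h ⊢
    rw [cable_gen, perm_cross]
    rcases lt_trichotomy j i with hj | rfl | hj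
    · have e : Equiv.swap i (i + 1) j = j := swap_off (by omega) (by omega)
      rw [off_comp_swap _ _ _ (by omega)]; rw [e] at h ⊢
      have := off_mono k (show j + 1 ≤ i by omega)
      rw [off_succ] at this
      rw [if_neg (by omega), if_neg (by omega)]
    · rw [off_comp_swap _ _ _ (by omega)]; rw [Equiv.swap_apply_left] at h ⊢
      rw [if_pos (by omega), off_succ]; omega
    · rcases Nat.eq_or_lt_of_le (show i + 1 ≤ j from hj) with rfl | hj'
      · rw [off_succ, off_comp_swap _ _ _ (by omega)]
        rw [Equiv.swap_apply_right] at h ⊢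
        simp only [Function.comp_apply, Equiv.swap_apply_left]
        rw [if_neg (by omega), if_pos (by omega)]; omega
      · have e : Equiv.swap i (i + 1) j = j := swap_off (by omega) (by omega)
        rw [off_comp_swap _ _ _ (by omega)]; rw [e] at h ⊢
        have := off_mono k (show i + 1 + 1 ≤ j by omega)
        rw [off_succ, off_succ] at this
        rw [if_neg (by omega), if_neg (by omega)]
  | one => simp
  | mul β γ _ _ h1 h2 =>
    have e : k ∘ perm (β * γ) = (k ∘ perm β) ∘ perm γ := by rw [map_mul]; rfl
    rw [map_mul, Equiv.Perm.mul_apply] at h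
    rw [cable_mul, map_mul, Equiv.Perm.mul_apply, e, h2 _ _ h, h1 _ _ h, map_mul,
      Equiv.Perm.mul_apply]
  | inv β _ h1 =>
    have e : (k ∘ perm β⁻¹) ∘ perm β = k := by
      rw [Function.comp_assoc, map_inv, ← Equiv.Perm.coe_mul, inv_mul_cancel]; rfl
    have e' : perm β (perm β⁻¹ j) = j := by simp
    have := h1 (k ∘ perm β⁻¹) (perm β⁻¹ j) (by rw [e']; exact h)
    rw [e, e'] at this
    rw [cable_inv, map_inv, Equiv.Perm.inv_eq_iff_eq, this]

theorem shift_mem {n o : ℕ} {β : BraidInf} (h : β ∈ strands n) : shift o β ∈ on o (o + n) := by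
  induction h using Subgroup.closure_induction with
  | mem β hβ =>
    obtain ⟨i, h1, h2, rfl⟩ := hβ
    rw [shift_gen]; exact gen_mem_on (by omega) (by omega)
  | one => rw [map_one]; exact one_mem _
  | mul _ _ _ _ h1 h2 => rw [map_mul]; exact mul_mem h1 h2
  | inv _ _ h1 => rw [map_inv]; exact inv_mem h1

theorem perm_shift (o : ℕ) (β : BraidInf) (x : ℕ) : perm (shift o β) (o + x) = o + perm β x := by
  have hβ : β ∈ Subgroup.closure (Set.range gen) := by
    have : Subgroup.closure (Set.range gen) = ⊤ := PresentedGroup.closure_range_of _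
    rw [this]; trivial
  induction hβ using Subgroup.closure_induction generalizing x with
  | mem β hβ =>
    obtain ⟨i, rfl⟩ := hβ
    simp only [shift_gen, perm_gen, Equiv.swap_apply_def]
    split_ifs <;> omega
  | one => simp
  | mul _ _ _ _ h1 h2 => simp [h1, h2]
  | inv β _ h1 => rw [map_inv, map_inv, Equiv.Perm.inv_eq_iff_eq, h1]; simp


/-- The juxtaposition of the braids `f i`, `i` running through the list, from position `o` on;
`f i` occupies a block of `w i` strands. -/
def blocks {I : Type} (f : I → BraidInf) (w : I → ℕ) : ℕ → List I → BraidInf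
  | _, [] => 1
  | o, i :: l => shift o (f i) * blocks f w (o + w i) l

theorem blocks_mem {I : Type} {f : I → BraidInf} {w : I → ℕ} (h : ∀ i, f i ∈ strands (w i))
    (o : ℕ) (l : List I) : blocks f w o l ∈ on o (o + (l.map w).sum) := by
  induction l generalizing o with
  | nil => exact one_mem _
  | cons i l ih =>
    rw [List.map_cons, List.sum_cons]
    exact mul_mem (on_mono le_rfl (by omega) (shift_mem (h i)))
      (on_mono (by omega) (by omega) (ih (o + w i)))

theorem perm_blocks {I X : Type} {f : I → BraidInf} {w : I → ℕ} (h : ∀ i, f i ∈ strands (w i))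
    (W W' : I → List X) (hW : ∀ i, (W i).length = w i) (hW' : ∀ i, (W' i).length = w i)
    (hp : ∀ i (j : ℕ), (W i)[perm (f i) j]? = (W' i)[j]?) (l : List I) (o x : ℕ) :
    ∃ y, perm (blocks f w o l) (o + x) = o + y ∧ (l.flatMap W)[y]? = (l.flatMap W')[x]? := by
  induction l generalizing o x with
  | nil => exact ⟨x, by simp [blocks], by simp⟩
  | cons i l ih =>
    simp only [blocks, map_mul, Equiv.Perm.mul_apply, List.flatMap_cons]
    rcases Nat.lt_or_ge x (w i) with hx | hx
    · refine ⟨perm (f i) x, ?_, ?_⟩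
      · rw [perm_on (blocks_mem h _ _) (Or.inl (by omega)), perm_shift]
      · rw [List.getElem?_append_left (by rw [hW]; exact (perm_lt (h i) x).1 hx),
          List.getElem?_append_left (by rw [hW']; exact hx), hp]
    · obtain ⟨x, rfl⟩ := Nat.exists_eq_add_of_le hx
      obtain ⟨y, hy, hy'⟩ := ih (o + w i) x
      refine ⟨w i + y, ?_, ?_⟩
      · rw [← Nat.add_assoc, hy, Nat.add_assoc, perm_shift, perm_on (h i) (Or.inr (by omega))]
      · rw [List.getElem?_append_right (by rw [hW]; omega),
          List.getElem?_append_right (by rw [hW']; omega), hW, hW']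
        simpa using hy'

/-- The block sizes along a list. -/
def width {I : Type} (w : I → ℕ) (l : List I) (j : ℕ) : ℕ := (l[j]?.map w).getD 0

theorem off_width_cons {I : Type} (w : I → ℕ) (i : I) (l : List I) (j : ℕ) :
    off (width w (i :: l)) (j + 1) = w i + off (width w l) j := by
  rw [off, Finset.sum_range_succ', Nat.add_comm]
  simp [width, off]

theorem off_width {I : Type} (w : I → ℕ) (l : List I) :
    off (width w l) l.length = (l.map w).sum := by
  induction l with
  | nil => simp [off]
  | cons i l ih => rw [List.length_cons, off_width_cons, ih]; simp

theorem getElem?_flatMap {I X : Type} (W : I → List X) (l : List I) (j r : ℕ)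
    (h : r < width (fun i => (W i).length) l j) :
    (l.flatMap W)[off (width (fun i => (W i).length) l) j + r]? =
      l[j]?.bind (fun i => (W i)[r]?) := by
  induction l generalizing j with
  | nil => simp [width] at h
  | cons i l ih =>
    cases j with
    | zero =>
      have h' : r < (W i).length := by simpa [width] using h
      simp [off, List.getElem?_append_left h']
    | succ j =>
      rw [off_width_cons, List.flatMap_cons,
        List.getElem?_append_right (by omega), List.getElem?_cons_succ,
        ← ih j (by simpa [width] using h)]
      congr 1; omega

theorem exists_off (k : ℕ → ℕ) (n x : ℕ) (h : x < off k n) :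
    ∃ j r, j < n ∧ r < k j ∧ x = off k j + r := by
  induction n with
  | zero => simp [off] at h
  | succ n ih =>
    rcases Nat.lt_or_ge x (off k n) with h' | h'
    · obtain ⟨j, r, hj, hr, e⟩ := ih h'
      exact ⟨j, r, by omega, hr, e⟩
    · rw [off_succ] at h
      exact ⟨n, x - off k n, by omega, by omega, by omega⟩

theorem width_comp {I : Type} (w : I → ℕ) {l l' : List I} {π : ℕ → ℕ}
    (h : ∀ j : ℕ, l[π j]? = l'[j]?) : width w l ∘ π = width w l' := by
  funext j; simp [width, h]

theorem perm_cable_flatMap {I X : Type} (W : I → List X) {l l' : List I} (hl : l'.length = l.length)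
    {β : BraidInf} (hβ : β ∈ strands l.length) (hp : ∀ j : ℕ, l[perm β j]? = l'[j]?) (x : ℕ) :
    (l.flatMap W)[perm (cable β (width (fun i => (W i).length) l)) x]? = (l'.flatMap W)[x]? := by
  set k := width (fun i => (W i).length) l with hk
  have hk' : k ∘ perm β = width (fun i => (W i).length) l' := width_comp _ hp
  have ho := off_perm hβ k
  rcases Nat.lt_or_ge x (off k l.length) with hx | hx
  · rw [← ho] at hx
    obtain ⟨j, r, hj, hr, rfl⟩ := exists_off _ _ _ hx
    rw [perm_cable β k j r hr, getElem?_flatMap W l _ _ hr, hp, hk', getElem?_flatMap]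
    rw [← hk']; exact hr
  · rw [perm_on (cable_mem hβ k) (Or.inr hx), List.getElem?_eq_none, List.getElem?_eq_none]
    · rw [List.length_flatMap, ← off_width, hl, ← hk', ho]; exact hx
    · rw [List.length_flatMap, ← off_width]; exact hx

end BraidInf

/-- Parenthesized words with letters in `I`: the free magma with a unit. The unit is the tree
`∅` without leaves; grafting it at a leaf erases that leaf, since it is a unit for the product. -/
abbrev Tree (I : Type) : Type := WithOne (FreeMagma I)

namespace Tree

variable {I J K : Type}

/-- The tree with one leaf, labelled `i`. -/
def leaf (i : I) : Tree I := ((FreeMagma.of i : FreeMagma I) : WithOne (FreeMagma I))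

/-- Grafting of the trees `B i` at the leaves. -/
def subst (B : I → Tree J) : Tree I →* Tree J := WithOne.lift (FreeMagma.lift B)

/-- The labels of the leaves, from left to right. -/
def leaves (t : Tree I) : List I := (WithOne.lift (FreeMagma.lift FreeMonoid.of) t).toList

theorem induction {p : Tree I → Prop} (one : p 1) (of : ∀ i, p (leaf i))
    (mul : ∀ s t, p s → p t → p (s * t)) (t : Tree I) : p t := by
  induction t using WithOne.recOneCoe with
  | one => exact one
  | coe t =>
    induction t using FreeMagma.recOnMul with
    | ih1 i => exact of i
    | ih2 s t hs ht => exact mul s t hs ht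

@[simp] theorem subst_leaf (B : I → Tree J) (i : I) : subst B (leaf i) = B i := rfl

@[simp] theorem leaves_one : leaves (1 : Tree I) = [] := rfl
@[simp] theorem leaves_leaf (i : I) : leaves (leaf i) = [i] := rfl
@[simp] theorem leaves_mul (s t : Tree I) : leaves (s * t) = leaves s ++ leaves t := by
  simp [leaves]

theorem leaves_subst (B : I → Tree J) (t : Tree I) :
    leaves (subst B t) = (leaves t).flatMap (fun i => leaves (B i)) := by
  induction t using Tree.induction with
  | one => simp
  | of i => simp
  | mul s t hs ht => simp [hs, ht]

theorem subst_subst (B : I → Tree J) (C : J → Tree K) (t : Tree I) :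
    subst C (subst B t) = subst (fun i => subst C (B i)) t := by
  induction t using Tree.induction with
  | one => simp
  | of i => simp
  | mul s t hs ht => simp [hs, ht]

end Tree

/-- Objects of `PaB(I)`: parenthesized words in which every letter `i : I` occurs exactly once
(there are none if `I` is infinite). For `I` with `r` elements this is `𝒯_r`; operads are indexed
by finite sets here, the actions of the symmetric groups being the relabellings by bijections. -/
@[ext] structure PaB (I : Type) where
  tree : Tree I
  nodup : tree.leaves.Nodup
  mem_leaves : ∀ i, i ∈ tree.leaves

namespace PaB

open BraidInf

variable {I J K : Type}

/-- The permutation `g_A` of the letters, as a list. -/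
def leaves (A : PaB I) : List I := A.tree.leaves

theorem length_leaves (A B : PaB I) : A.leaves.length = B.leaves.length :=
  ((List.perm_ext_iff_of_nodup A.nodup B.nodup).2
    fun i => ⟨fun _ => B.mem_leaves i, fun _ => A.mem_leaves i⟩).length_eq

/-- A morphism `A ⟶ B` of `PaB(I)`: a braid on `|I|` strands whose permutation carries the letter in
position `j` of `B` to its position in `A`. (The morphisms of the `ℂ`-linear category are the formal
linear combinations of these; `ℂ`-linear functors out of it are functors out of this groupoid.) -/
@[ext] structure Hom (A B : PaB I) where
  braid : BraidInf
  mem : braid ∈ strands A.leaves.length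
  perm_leaves : ∀ j : ℕ, A.leaves[perm braid j]? = B.leaves[j]?

instance : Category (PaB I) where
  Hom := Hom
  id A := ⟨1, one_mem _, fun j => by simp⟩
  comp {A B _} f g := ⟨f.braid * g.braid,
    mul_mem f.mem (by rw [length_leaves A B]; exact g.mem),
    fun j => by rw [map_mul, Equiv.Perm.mul_apply, f.perm_leaves, g.perm_leaves]⟩
  id_comp f := Hom.ext (one_mul f.braid)
  comp_id f := Hom.ext (mul_one f.braid)
  assoc f g h := Hom.ext (mul_assoc f.braid g.braid h.braid)

/-- The tree `∅`. -/
def empty (I : Type) [IsEmpty I] : PaB I := ⟨1, by simp, fun i => isEmptyElim i⟩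

/-- The tree with one leaf. -/
def single (i : I) (h : ∀ j, j = i) : PaB I := ⟨Tree.leaf i, by simp, fun j => by simp [h j]⟩

/-- Operadic composition `A ∘ (B_i)` of trees. -/
def comp {J : I → Type} (A : PaB I) (B : ∀ i, PaB (J i)) : PaB (Σ i, J i) where
  tree := Tree.subst (fun i => Tree.subst (fun j => Tree.leaf ⟨i, j⟩) (B i).tree) A.tree
  nodup := by
    simp only [Tree.leaves_subst, Tree.leaves_leaf]
    rw [List.nodup_flatMap]
    refine ⟨fun i _ => ?_, ?_⟩
    · rw [← List.map_eq_flatMap]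
      exact (B i).nodup.map fun a b h => by simpa using h
    · refine A.nodup.imp fun {a b} hab => ?_
      simp only [Function.onFun, ← List.map_eq_flatMap]
      intro x hx hx'
      simp only [List.mem_map] at hx hx'
      obtain ⟨_, _, rfl⟩ := hx
      obtain ⟨_, _, e⟩ := hx'
      exact hab (congrArg Sigma.fst e).symm
  mem_leaves := by
    rintro ⟨i, j⟩
    simp only [Tree.leaves_subst, Tree.leaves_leaf, List.mem_flatMap, List.mem_singleton]
    exact ⟨i, A.mem_leaves i, j, (B i).mem_leaves j, rfl⟩

theorem leaves_comp {J : I → Type} (A : PaB I) (B : ∀ i, PaB (J i)) :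
    (A.comp B).leaves = A.leaves.flatMap fun i => (B i).leaves.map (Sigma.mk i) := by
  simp only [leaves, comp, Tree.leaves_subst, Tree.leaves_leaf, ← List.map_eq_flatMap]

/-- Operadic composition `f ∘ (g_i)` of braids: the cabling of `f`, followed by the `g_i` side by
side. -/
def compMap {J : I → Type} {A A' : PaB I} {B B' : ∀ i, PaB (J i)} (f : A ⟶ A')
    (g : ∀ i, B i ⟶ B' i) : A.comp B ⟶ A'.comp B' where
  braid := cable f.braid (width (fun i => (B i).leaves.length) A.leaves) *
    blocks (fun i => (g i).braid) (fun i => (B i).leaves.length) 0 A'.leaves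
  mem := by
    have h1 := cable_mem f.mem (width (fun i => (B i).leaves.length) A.leaves)
    have h2 := blocks_mem (fun i => (g i).mem) 0 A'.leaves
    have e := off_perm f.mem (width (fun i => (B i).leaves.length) A.leaves)
    rw [width_comp _ f.perm_leaves, length_leaves A A', off_width, ← length_leaves A A'] at e
    rw [leaves_comp, List.length_flatMap]
    simp only [List.length_map, Nat.zero_add] at h2 ⊢
    rw [e] at h2
    rw [← off_width]
    exact mul_mem h1 h2
  perm_leaves := by
    intro j
    rw [map_mul, Equiv.Perm.mul_apply, leaves_comp, leaves_comp]
    have hc := perm_cable_flatMap (fun i => (B i).leaves.map (Sigma.mk i))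
      (length_leaves A' A) f.mem f.perm_leaves
    simp only [List.length_map] at hc
    rw [hc]
    obtain ⟨y, hy, hy'⟩ := perm_blocks (fun i => (g i).mem)
      (fun i => (B i).leaves.map (Sigma.mk i)) (fun i => (B' i).leaves.map (Sigma.mk i))
      (fun i => by simp) (fun i => by simp [length_leaves (B i) (B' i)])
      (fun i j => by simp [(g i).perm_leaves]) A'.leaves 0 j
    simp only [Nat.zero_add] at hy
    rw [hy, hy']

/-- Renaming of the letters. -/
def relabelObj (e : I ≃ J) (A : PaB I) : PaB J where
  tree := Tree.subst (fun i => Tree.leaf (e i)) A.tree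
  nodup := by
    simp only [Tree.leaves_subst, Tree.leaves_leaf, ← List.map_eq_flatMap]
    exact A.nodup.map e.injective
  mem_leaves j := by
    simp only [Tree.leaves_subst, Tree.leaves_leaf, List.mem_flatMap, List.mem_singleton]
    exact ⟨e.symm j, A.mem_leaves _, by simp⟩

theorem leaves_relabel (e : I ≃ J) (A : PaB I) : (A.relabelObj e).leaves = A.leaves.map e := by
  simp only [leaves, relabelObj, Tree.leaves_subst, Tree.leaves_leaf, ← List.map_eq_flatMap]

/-- Renaming of the letters, as a functor: the action of the symmetric groups. -/
def relabel (e : I ≃ J) : PaB I ⥤ PaB J where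
  obj := relabelObj e
  map f := ⟨f.braid, by rw [leaves_relabel, List.length_map]; exact f.mem,
    fun j => by simp [leaves_relabel, f.perm_leaves]⟩
  map_id _ := rfl
  map_comp _ _ := rfl

theorem comp_assoc {J : I → Type} {K : ∀ i, J i → Type} (A : PaB I) (B : ∀ i, PaB (J i))
    (C : ∀ i j, PaB (K i j)) :
    (relabel (Equiv.sigmaAssoc K)).obj ((A.comp B).comp fun p => C p.1 p.2) =
      A.comp fun i => (B i).comp (C i) := by
  ext : 1
  simp [relabel, relabelObj, comp, Tree.subst_subst]
  rfl

theorem relabel_comp {I' : Type} {J : I → Type} {J' : I' → Type} (A : PaB I) (B : ∀ i, PaB (J i))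
    (B' : ∀ i, PaB (J' i)) (e : I ≃ I') (h : ∀ i, J i ≃ J' (e i))
    (hB : ∀ i, (relabel (h i)).obj (B i) = B' (e i)) :
    (relabel (Equiv.sigmaCongr e h)).obj (A.comp B) = ((relabel e).obj A).comp B' := by
  ext : 1
  simp [relabel, relabelObj, comp, Tree.subst_subst, ← hB]
  rfl

theorem relabel_empty_comp [IsEmpty I] {J : I → Type} (A : PaB I) (B : ∀ i, PaB (J i)) :
    (relabel (Equiv.equivOfIsEmpty I (Σ i, J i))).obj A = A.comp B := by
  ext : 1
  simp only [relabel, relabelObj, comp]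
  congr 2
  funext i; exact isEmptyElim i

/-- The unit `1` of the operad. -/
def unary : PaB Unit := single () fun _ => rfl

/-- The tree `12`. -/
def two : PaB (Fin 2) := ⟨Tree.leaf 0 * Tree.leaf 1, by simp, fun i => by fin_cases i <;> simp⟩

/-- The tree `(12)3`. -/
def threeL : PaB (Fin 3) :=
  ⟨(Tree.leaf 0 * Tree.leaf 1) * Tree.leaf 2, by simp, fun i => by fin_cases i <;> simp⟩

/-- The tree `1(23)`. -/
def threeR : PaB (Fin 3) :=
  ⟨Tree.leaf 0 * (Tree.leaf 1 * Tree.leaf 2), by simp, fun i => by fin_cases i <;> simp⟩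

/-- The trivial braid `(12)3 ⟶ 1(23)`. -/
def α : threeL ⟶ threeR := Hom.mk 1 (one_mem _) fun _ => rfl

/-- The tree `21`. -/
def twoOp : PaB (Fin 2) := (relabel (Equiv.swap 0 1)).obj two

/-- The elementary crossing `12 ⟶ 21`. -/
def σ : two ⟶ twoOp := Hom.mk (gen 0) (gen_mem_on le_rfl (by decide)) fun j => by
  have h1 : two.leaves = [0, 1] := rfl
  have h2 : twoOp.leaves = [1, 0] := rfl
  rw [h1, h2, perm_gen]
  match j with
  | 0 => rfl
  | 1 => rfl
  | j + 2 => rw [Equiv.swap_apply_of_ne_of_ne (by omega) (by omega)]; rfl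

/-- The family of index sets `J, K`. -/
def pairIdx (J K : Type) : Fin 2 → Type
  | 0 => J
  | 1 => K

/-- The family `A, B`. -/
def pair (A : PaB J) (B : PaB K) : ∀ i, PaB (pairIdx J K i)
  | 0 => A
  | 1 => B

/-- The index set of `std r`; it has `r` elements. -/
def stdIdx : ℕ → Type
  | 0 => Empty
  | 1 => Unit
  | 2 => Fin 2
  | r + 3 => Σ i, pairIdx Unit (stdIdx (r + 2)) i

/-- The standard tree `1(2(⋯(r-1 r)⋯))`, as the iterated composition
`12 ∘_2 (12 ∘_2 (⋯ (12 ∘_2 12)))`. -/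
def std : ∀ r, PaB (stdIdx r)
  | 0 => empty Empty
  | 1 => unary
  | 2 => two
  | r + 3 => two.comp (pair unary (std (r + 2)))

/-- The index set of the tree grafted at `q` by `erase p`: empty if `q = p`, a point otherwise. -/
def puncture (p q : I) : Type := PLift (q ≠ p)

open Classical in
/-- The family of trees that is `∅` at `p` and the unit `1` elsewhere, so that
`A.comp (erase p) = A ∘_p ∅`. -/
noncomputable def erase (p q : I) : PaB (puncture p q) :=
  if h : q = p then
    haveI : IsEmpty (puncture p q) := ⟨fun x => x.down h⟩
    empty _
  else single ⟨h⟩ fun _ => rfl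

/-- `{0, 1} ⊔ {0} ≃ {0, 1, 2}`, in order. -/
def sigmaL : (Σ i, pairIdx (Fin 2) Unit i) ≃ Fin 3 where
  toFun
    | ⟨0, (0 : Fin 2)⟩ => 0
    | ⟨0, (1 : Fin 2)⟩ => 1
    | ⟨1, _⟩ => 2
  invFun
    | 0 => ⟨0, (0 : Fin 2)⟩
    | 1 => ⟨0, (1 : Fin 2)⟩
    | 2 => ⟨1, ()⟩
  left_inv := by
    rintro ⟨i, j⟩
    fin_cases i
    · change Fin 2 at j; fin_cases j <;> rfl
    · rfl
  right_inv i := by fin_cases i <;> rfl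

/-- `{0} ⊔ {0, 1} ≃ {0, 1, 2}`, in order. -/
def sigmaR : (Σ i, pairIdx Unit (Fin 2) i) ≃ Fin 3 where
  toFun
    | ⟨0, _⟩ => 0
    | ⟨1, (0 : Fin 2)⟩ => 1
    | ⟨1, (1 : Fin 2)⟩ => 2
  invFun
    | 0 => ⟨0, ()⟩
    | 1 => ⟨1, (0 : Fin 2)⟩
    | 2 => ⟨1, (1 : Fin 2)⟩
  left_inv := by
    rintro ⟨i, j⟩
    fin_cases i
    · rfl
    · change Fin 2 at j; fin_cases j <;> rfl
  right_inv i := by fin_cases i <;> rfl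

/-- `∅ ⊔ {0} ≃ {0}`. -/
def sigmaEmptyL : (Σ i, pairIdx Empty Unit i) ≃ Unit where
  toFun _ := ()
  invFun _ := ⟨1, ()⟩
  left_inv := by
    rintro ⟨i, j⟩
    fin_cases i
    · exact Empty.elim j
    · rfl
  right_inv _ := rfl

/-- `{0} ⊔ ∅ ≃ {0}`. -/
def sigmaEmptyR : (Σ i, pairIdx Unit Empty i) ≃ Unit where
  toFun _ := ()
  invFun _ := ⟨0, ()⟩
  left_inv := by
    rintro ⟨i, j⟩
    fin_cases i
    · rfl
    · exact Empty.elim j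
  right_inv _ := rfl

/-- The sum of one point is a point. -/
def sigmaUnit : (Σ _ : Unit, Unit) ≃ Unit where
  toFun _ := ()
  invFun _ := ⟨(), ()⟩
  left_inv _ := rfl
  right_inv _ := rfl

theorem relabel_sigmaL : (relabel sigmaL).obj (two.comp (pair two unary)) = threeL :=
  PaB.ext rfl

theorem relabel_sigmaR : (relabel sigmaR).obj (two.comp (pair unary two)) = threeR :=
  PaB.ext rfl

theorem relabel_sigmaEmptyL :
    (relabel sigmaEmptyL).obj (two.comp (pair (empty Empty) unary)) = unary :=
  PaB.ext rfl

theorem relabel_sigmaEmptyR :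
    (relabel sigmaEmptyR).obj (two.comp (pair unary (empty Empty))) = unary :=
  PaB.ext rfl

theorem relabel_sigmaUnit : (relabel sigmaUnit).obj (unary.comp fun _ => unary) = unary :=
  PaB.ext rfl

end PaB
end PaBOp

namespace PaBOp
open CategoryTheory Opposite

universe u
section
variable (C : Type u) [SmallCategory C]

/-- Functors `C × (C^op)^I → Vect_ℂ`. Those that are linear in each variable are the objects of
`PEnd_C(I)`; see `PEnd.IsMultilinear`. -/
abbrev PEnd (I : Type) : Type _ := (I → C)ᵒᵖ ⥤ C ⥤ ModuleCat.{u} ℂ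

/-- Functors `C^I → C`. -/
abbrev EndC (I : Type) : Type _ := (I → C) ⥤ C

variable {C}

/-- Restriction of families of objects along `e`. -/
def reindex {I J : Type} (e : I → J) : (J → C) ⥤ (I → C) where
  obj M i := M (e i)
  map φ i := φ (e i)

/-- Functors `C^I → D` that are `ℂ`-linear in each variable. -/
structure IsMultilinear [Preadditive C] [Linear ℂ C] {I : Type} {D : Type*} [Category D]
    [Preadditive D] [Linear ℂ D]
    (F : (I → C) ⥤ D) : Prop where
  map_add : ∀ {M N : I → C} (i : I) (f g h : M ⟶ N), (∀ j, j ≠ i → g j = f j ∧ h j = f j) →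
    f i = g i + h i → F.map f = F.map g + F.map h
  map_smul : ∀ {M N : I → C} (i : I) (c : ℂ) (f g : M ⟶ N), (∀ j, j ≠ i → g j = f j) →
    f i = c • g i → F.map f = c • F.map g

namespace PEnd

/-- Linearity in each of the contravariant variables and in the covariant one. -/
structure IsMultilinear [Preadditive C] [Linear ℂ C] {I : Type} (F : PEnd C I) : Prop where
  map_add : ∀ {M N : I → C} (i : I) (f g h : M ⟶ N), (∀ j, j ≠ i → g j = f j ∧ h j = f j) →
    f i = g i + h i → F.map f.op = F.map g.op + F.map h.op
  map_smul : ∀ {M N : I → C} (i : I) (c : ℂ) (f g : M ⟶ N), (∀ j, j ≠ i → g j = f j) →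
    f i = c • g i → F.map f.op = c • F.map g.op
  additive : ∀ M, (F.obj M).Additive
  linear : ∀ M, (F.obj M).Linear ℂ

/-- Renaming of the variables. -/
def relabel {I J : Type} (e : I ≃ J) : PEnd C I ⥤ PEnd C J :=
  (Functor.whiskeringLeft _ _ _).obj (reindex e).op

/-- The unit of the operad `PEnd_C`: the functor `Hom_C(M, L)`. -/
def unit [Preadditive C] [Linear ℂ C] : PEnd C Unit :=
  (Pi.eval (fun _ : Unit => C) ()).op ⋙ linearCoyoneda ℂ C

section Coend

variable {I : Type} {J : I → Type} (F : PEnd C I) (G : ∀ i, PEnd C (J i))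

/-- The vector space `G_i(N_i, M_i)`. -/
abbrev fibre (M : (Σ i, J i) → C) (N : I → C) (i : I) : Type u :=
  ((G i).obj (op fun j => M ⟨i, j⟩)).obj (N i)

/-- Generators `x ⊗ ⨂ y_i` of the coend over `N`. -/
abbrev Gen (M : (Σ i, J i) → C) (L : C) : Type u :=
  Σ N : I → C, (F.obj (op N)).obj L × (∀ i, fibre G M N i)

variable {F G} in
/-- The generator `x ⊗ ⨂ y_i` at `N`. -/
noncomputable abbrev sym {M : (Σ i, J i) → C} {L : C} (N : I → C) (x : (F.obj (op N)).obj L)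
    (y : ∀ i, fibre G M N i) : Gen F G M L →₀ ℂ := Finsupp.single ⟨N, x, y⟩ 1

/-- The relations of the coend: multilinearity of `x ⊗ ⨂ y_i` and dinaturality in `N`. -/
inductive Rel (M : (Σ i, J i) → C) (L : C) : (Gen F G M L →₀ ℂ) → Prop
  | add_left (N) (x x' : (F.obj (op N)).obj L) (y : ∀ i, fibre G M N i) :
      Rel M L (sym N (x + x') y - (sym N x y + sym N x' y))
  | smul_left (N) (c : ℂ) (x : (F.obj (op N)).obj L) (y : ∀ i, fibre G M N i) :
      Rel M L (sym N (c • x) y - c • sym N x y)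
  | add_right (N) (x : (F.obj (op N)).obj L) (i : I) (y z w : ∀ i, fibre G M N i)
      (h : ∀ j, j ≠ i → z j = y j ∧ w j = y j) (hi : y i = z i + w i) :
      Rel M L (sym N x y - (sym N x z + sym N x w))
  | smul_right (N) (x : (F.obj (op N)).obj L) (i : I) (c : ℂ) (y z : ∀ i, fibre G M N i)
      (h : ∀ j, j ≠ i → z j = y j) (hi : y i = c • z i) :
      Rel M L (sym N x y - c • sym N x z)
  | dinatural (N N' : I → C) (φ : N ⟶ N') (x : (F.obj (op N')).obj L) (y : ∀ i, fibre G M N i) :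
      Rel M L (sym N ((F.map φ.op).app L x) y -
        sym N' x fun i => ((G i).obj (op fun j => M ⟨i, j⟩)).map (φ i) (y i))

/-- The coend `∫^{N ∈ C^I} F(L, N) ⊗ ⨂_i G_i(N_i, M_i)`. -/
abbrev Coend (M : (Σ i, J i) → C) (L : C) : Type u :=
  (Gen F G M L →₀ ℂ) ⧸ Submodule.span ℂ {z | Rel F G M L z}

variable {F G}

/-- The class of `x ⊗ ⨂ y_i` in the coend. -/
noncomputable def ι {M : (Σ i, J i) → C} {L : C} (N : I → C) (x : (F.obj (op N)).obj L)
    (y : ∀ i, fibre G M N i) : Coend F G M L := Submodule.Quotient.mk (sym N x y)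

theorem ι_eq_of_rel {M : (Σ i, J i) → C} {L : C} {z : Gen F G M L →₀ ℂ} (h : Rel F G M L z) :
    (Submodule.Quotient.mk z : Coend F G M L) = 0 :=
  (Submodule.Quotient.mk_eq_zero _).2 (Submodule.subset_span h)

section
variable {M : (Σ i, J i) → C} {L : C}

theorem ι_add_left (N : I → C) (x x' : (F.obj (op N)).obj L) (y : ∀ i, fibre G M N i) :
    ι N (x + x') y = ι N x y + ι N x' y := by
  have := ι_eq_of_rel (Rel.add_left (F := F) (G := G) N x x' y)
  rwa [Submodule.Quotient.mk_sub, Submodule.Quotient.mk_add, sub_eq_zero] at this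

theorem ι_smul_left (N : I → C) (c : ℂ) (x : (F.obj (op N)).obj L) (y : ∀ i, fibre G M N i) :
    ι N (c • x) y = c • ι N x y := by
  have := ι_eq_of_rel (Rel.smul_left (F := F) (G := G) N c x y)
  rwa [Submodule.Quotient.mk_sub, Submodule.Quotient.mk_smul, sub_eq_zero] at this

theorem ι_add_right (N : I → C) (x : (F.obj (op N)).obj L) (i : I) (y z w : ∀ i, fibre G M N i)
    (h : ∀ j, j ≠ i → z j = y j ∧ w j = y j) (hi : y i = z i + w i) :
    ι N x y = ι N x z + ι N x w := by
  have := ι_eq_of_rel (Rel.add_right (F := F) (G := G) N x i y z w h hi)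
  rwa [Submodule.Quotient.mk_sub, Submodule.Quotient.mk_add, sub_eq_zero] at this

theorem ι_smul_right (N : I → C) (x : (F.obj (op N)).obj L) (i : I) (c : ℂ)
    (y z : ∀ i, fibre G M N i) (h : ∀ j, j ≠ i → z j = y j) (hi : y i = c • z i) :
    ι N x y = c • ι N x z := by
  have := ι_eq_of_rel (Rel.smul_right (F := F) (G := G) N x i c y z h hi)
  rwa [Submodule.Quotient.mk_sub, Submodule.Quotient.mk_smul, sub_eq_zero] at this

theorem ι_dinatural (N N' : I → C) (φ : N ⟶ N') (x : (F.obj (op N')).obj L)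
    (y : ∀ i, fibre G M N i) :
    ι N ((F.map φ.op).app L x) y =
      ι N' x fun i => ((G i).obj (op fun j => M ⟨i, j⟩)).map (φ i) (y i) := by
  have := ι_eq_of_rel (Rel.dinatural (F := F) (G := G) N N' φ x y)
  rwa [Submodule.Quotient.mk_sub, sub_eq_zero] at this

theorem Coend.hom_ext {V : Type*} [AddCommGroup V] [Module ℂ V] {f g : Coend F G M L →ₗ[ℂ] V}
    (h : ∀ N x y, f (ι N x y) = g (ι N x y)) : f = g := by
  apply Submodule.linearMap_qext
  apply Finsupp.lhom_ext'
  rintro ⟨N, x, y⟩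
  ext
  exact h N x y

/-- Linear maps out of the coend. -/
noncomputable def Coend.desc {V : Type*} [AddCommGroup V] [Module ℂ V]
    (f : ∀ N : I → C, (F.obj (op N)).obj L → (∀ i, fibre G M N i) → V)
    (add_left : ∀ N x x' y, f N (x + x') y = f N x y + f N x' y)
    (smul_left : ∀ N (c : ℂ) x y, f N (c • x) y = c • f N x y)
    (add_right : ∀ N x i y z w, (∀ j, j ≠ i → z j = y j ∧ w j = y j) → y i = z i + w i →
      f N x y = f N x z + f N x w)
    (smul_right : ∀ N x i (c : ℂ) y z, (∀ j, j ≠ i → z j = y j) → y i = c • z i →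
      f N x y = c • f N x z)
    (dinatural : ∀ N N' (φ : N ⟶ N') x y, f N ((F.map φ.op).app L x) y =
      f N' x fun i => ((G i).obj (op fun j => M ⟨i, j⟩)).map (φ i) (y i)) :
    Coend F G M L →ₗ[ℂ] V :=
  Submodule.liftQ _ (Finsupp.linearCombination ℂ fun g : Gen F G M L => f g.1 g.2.1 g.2.2) (by
    rw [Submodule.span_le]
    rintro _ (⟨N, x, x', y⟩ | ⟨N, c, x, y⟩ | ⟨N, x, i, y, z, w, h, hi⟩ | ⟨N, x, i, c, y, z, h, hi⟩ |
      ⟨N, N', φ, x, y⟩)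
    · simp [sym, Finsupp.linearCombination_single, add_left]
    · simp [sym, Finsupp.linearCombination_single, smul_left]
    · simp [sym, Finsupp.linearCombination_single, add_right N x i y z w h hi]
    · simp [sym, Finsupp.linearCombination_single, smul_right N x i c y z h hi]
    · simp [sym, Finsupp.linearCombination_single, dinatural N N' φ x y])

theorem Coend.desc_ι {V : Type*} [AddCommGroup V] [Module ℂ V]
    (f : ∀ N : I → C, (F.obj (op N)).obj L → (∀ i, fibre G M N i) → V)
    (h1) (h2) (h3) (h4) (h5) (N : I → C) (x : (F.obj (op N)).obj L) (y : ∀ i, fibre G M N i) :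
    Coend.desc f h1 h2 h3 h4 h5 (ι N x y) = f N x y := by
  simp [Coend.desc, ι, sym]

end

/-- Functoriality of the coend in `F`, `G`, `M` and `L`. -/
noncomputable def Coend.map {F' : PEnd C I} {G' : ∀ i, PEnd C (J i)} {M M' : (Σ i, J i) → C}
    {L L' : C} (φ : ∀ N, (F.obj (op N)).obj L ⟶ (F'.obj (op N)).obj L')
    (hφ : ∀ {N N' : I → C} (f : N ⟶ N') x,
      φ N ((F.map f.op).app L x) = (F'.map f.op).app L' (φ N' x))
    (ψ : ∀ i N, ((G i).obj (op fun j => M ⟨i, j⟩)).obj N ⟶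
      ((G' i).obj (op fun j => M' ⟨i, j⟩)).obj N)
    (hψ : ∀ i {N N' : C} (f : N ⟶ N') y, ψ i N' (((G i).obj (op fun j => M ⟨i, j⟩)).map f y) =
      ((G' i).obj (op fun j => M' ⟨i, j⟩)).map f (ψ i N y)) :
    Coend F G M L →ₗ[ℂ] Coend F' G' M' L' :=
  Coend.desc (fun N x y => ι N (φ N x) fun i => ψ i (N i) (y i))
    (fun N x x' y => by rw [map_add, ι_add_left])
    (fun N c x y => by rw [map_smul, ι_smul_left])
    (fun N x i y z w h hi => ι_add_right N _ i _ _ _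
      (fun j hj => by rw [(h j hj).1, (h j hj).2]; exact ⟨rfl, rfl⟩) (by rw [hi, map_add]))
    (fun N x i c y z h hi => ι_smul_right N _ i c _ _
      (fun j hj => by rw [h j hj]) (by rw [hi, map_smul]))
    (fun N N' f x y => by
      rw [hφ, ι_dinatural]
      congr 1
      funext i
      rw [hψ])

theorem Coend.map_ι {F' : PEnd C I} {G' : ∀ i, PEnd C (J i)} {M M' : (Σ i, J i) → C}
    {L L' : C} (φ : ∀ N, (F.obj (op N)).obj L ⟶ (F'.obj (op N)).obj L') (hφ)
    (ψ : ∀ i N, ((G i).obj (op fun j => M ⟨i, j⟩)).obj N ⟶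
      ((G' i).obj (op fun j => M' ⟨i, j⟩)).obj N) (hψ) (N) (x) (y) :
    Coend.map (F := F) (G := G) φ hφ ψ hψ (ι N x y) = ι N (φ N x) fun i => ψ i (N i) (y i) :=
  Coend.desc_ι _ _ _ _ _ _ _ _ _

section
variable {F' F'' : PEnd C I} {G' G'' : ∀ i, PEnd C (J i)} {M M' M'' : (Σ i, J i) → C} {L L' L'' : C}

theorem Coend.map_map {φ : ∀ N, (F.obj (op N)).obj L ⟶ (F'.obj (op N)).obj L'} (hφ)
    {ψ : ∀ i N, ((G i).obj (op fun j => M ⟨i, j⟩)).obj N ⟶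
      ((G' i).obj (op fun j => M' ⟨i, j⟩)).obj N} (hψ)
    {φ' : ∀ N, (F'.obj (op N)).obj L' ⟶ (F''.obj (op N)).obj L''} (hφ')
    {ψ' : ∀ i N, ((G' i).obj (op fun j => M' ⟨i, j⟩)).obj N ⟶
      ((G'' i).obj (op fun j => M'' ⟨i, j⟩)).obj N} (hψ')
    {φ'' : ∀ N, (F.obj (op N)).obj L ⟶ (F''.obj (op N)).obj L''} (hφ'')
    {ψ'' : ∀ i N, ((G i).obj (op fun j => M ⟨i, j⟩)).obj N ⟶
      ((G'' i).obj (op fun j => M'' ⟨i, j⟩)).obj N} (hψ'')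
    (e : ∀ N, φ N ≫ φ' N = φ'' N) (e' : ∀ i N, ψ i N ≫ ψ' i N = ψ'' i N) :
    ModuleCat.ofHom (Coend.map (F := F) (G := G) φ hφ ψ hψ) ≫
      ModuleCat.ofHom (Coend.map φ' hφ' ψ' hψ') =
      ModuleCat.ofHom (Coend.map φ'' hφ'' ψ'' hψ'') := by
  obtain rfl : (fun N => φ N ≫ φ' N) = φ'' := funext e
  obtain rfl : (fun i N => ψ i N ≫ ψ' i N) = ψ'' := funext fun i => funext (e' i)
  ext1
  apply Coend.hom_ext
  intro N x y
  rw [ModuleCat.hom_comp, LinearMap.comp_apply]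
  simp only [ModuleCat.hom_ofHom, Coend.map_ι]
  rfl

theorem Coend.map_square {F₁ : PEnd C I} {G₁ : ∀ i, PEnd C (J i)} {M₁ : (Σ i, J i) → C} {L₁ : C}
    {φ : ∀ N, (F.obj (op N)).obj L ⟶ (F'.obj (op N)).obj L'} (hφ)
    {ψ : ∀ i N, ((G i).obj (op fun j => M ⟨i, j⟩)).obj N ⟶
      ((G' i).obj (op fun j => M' ⟨i, j⟩)).obj N} (hψ)
    {φ' : ∀ N, (F'.obj (op N)).obj L' ⟶ (F''.obj (op N)).obj L''} (hφ')
    {ψ' : ∀ i N, ((G' i).obj (op fun j => M' ⟨i, j⟩)).obj N ⟶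
      ((G'' i).obj (op fun j => M'' ⟨i, j⟩)).obj N} (hψ')
    {χ : ∀ N, (F.obj (op N)).obj L ⟶ (F₁.obj (op N)).obj L₁} (hχ)
    {ω : ∀ i N, ((G i).obj (op fun j => M ⟨i, j⟩)).obj N ⟶
      ((G₁ i).obj (op fun j => M₁ ⟨i, j⟩)).obj N} (hω)
    {χ' : ∀ N, (F₁.obj (op N)).obj L₁ ⟶ (F''.obj (op N)).obj L''} (hχ')
    {ω' : ∀ i N, ((G₁ i).obj (op fun j => M₁ ⟨i, j⟩)).obj N ⟶
      ((G'' i).obj (op fun j => M'' ⟨i, j⟩)).obj N} (hω')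
    (e : ∀ N, φ N ≫ φ' N = χ N ≫ χ' N) (e' : ∀ i N, ψ i N ≫ ψ' i N = ω i N ≫ ω' i N) :
    ModuleCat.ofHom (Coend.map (F := F) (G := G) φ hφ ψ hψ) ≫
      ModuleCat.ofHom (Coend.map φ' hφ' ψ' hψ') =
    ModuleCat.ofHom (Coend.map (F := F) (G := G) χ hχ ω hω) ≫
      ModuleCat.ofHom (Coend.map χ' hχ' ω' hω') := by
  ext1
  apply Coend.hom_ext
  intro N x y
  rw [ModuleCat.hom_comp, ModuleCat.hom_comp, LinearMap.comp_apply, LinearMap.comp_apply]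
  simp only [ModuleCat.hom_ofHom, Coend.map_ι]
  have h1 := ConcreteCategory.congr_hom (e N) x
  have h2 := fun i => ConcreteCategory.congr_hom (e' i (N i)) (y i)
  simp only [ConcreteCategory.comp_apply] at h1 h2
  rw [h1, funext h2]

theorem Coend.map_id {φ : ∀ N, (F.obj (op N)).obj L ⟶ (F.obj (op N)).obj L} (hφ)
    {ψ : ∀ i N, ((G i).obj (op fun j => M ⟨i, j⟩)).obj N ⟶
      ((G i).obj (op fun j => M ⟨i, j⟩)).obj N} (hψ)
    (e : ∀ N, φ N = 𝟙 _) (e' : ∀ i N, ψ i N = 𝟙 _) :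
    ModuleCat.ofHom (Coend.map (F := F) (G := G) φ hφ ψ hψ) = 𝟙 (ModuleCat.of ℂ _) := by
  ext1
  apply Coend.hom_ext
  intro N x y
  rw [ModuleCat.hom_ofHom, Coend.map_ι]
  simp only [e, e']
  rfl

end

variable (F G) in
/-- The coend as a functor of the output variable. -/
noncomputable def compObj (M : (Σ i, J i) → C) : C ⥤ ModuleCat.{u} ℂ where
  obj L := ModuleCat.of ℂ (Coend F G M L)
  map f := ModuleCat.ofHom <|
    Coend.map (fun N => (F.obj (op N)).map f)
      (fun g x => (ConcreteCategory.congr_hom ((F.map g.op).naturality f) x).symm)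
      (fun _ _ => 𝟙 _) (fun _ _ _ _ _ => rfl)
  map_id L := Coend.map_id _ _ (fun N => (F.obj (op N)).map_id L) (fun _ _ => rfl)
  map_comp f g := (Coend.map_map _ _ _ _ _ _ (fun N => ((F.obj (op N)).map_comp f g).symm)
    (fun _ _ => Category.id_comp _)).symm

/-- The operadic composition of `PEnd_C`, by coends. -/
noncomputable def comp (F : PEnd C I) (G : ∀ i, PEnd C (J i)) : PEnd C (Σ i, J i) where
  obj M := compObj F G M.unop
  map {M M'} h :=
    { app := fun L => ModuleCat.ofHom <|
        Coend.map (fun N => 𝟙 _) (fun {N N'} g x => rfl)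
          (fun i N => (((reindex (Sigma.mk i)).op ⋙ G i).map h).app N)
          (fun i N N' g y => ConcreteCategory.congr_hom
            ((((reindex (Sigma.mk i)).op ⋙ G i).map h).naturality g) y)
      naturality := fun _ _ f => Coend.map_square _ _ _ _ _ _ _ _
          (fun _ => (Category.comp_id _).trans (Category.id_comp _).symm)
          (fun _ _ => (Category.id_comp _).trans (Category.comp_id _).symm) }
  map_id M := by
    ext L : 2
    exact Coend.map_id _ _ (fun _ => rfl) (fun i N => by
      rw [CategoryTheory.Functor.map_id]; rfl)
  map_comp {M M' M''} h k := by
    ext L : 2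
    exact (Coend.map_map _ _ _ _ _ _ (fun _ => Category.comp_id _) (fun i N => by
      rw [CategoryTheory.Functor.map_comp]; rfl)).symm

/-- The operadic composition of `PEnd_C` on natural transformations. -/
noncomputable def compMap {F F' : PEnd C I} {G G' : ∀ i, PEnd C (J i)} (φ : F ⟶ F')
    (ψ : ∀ i, G i ⟶ G' i) : comp F G ⟶ comp F' G' where
  app M :=
    { app := fun L => ModuleCat.ofHom <|
        Coend.map (fun N => (φ.app (op N)).app L)
          (fun {N N'} g x => ConcreteCategory.congr_hom
            (congrArg (fun t => t.app L) (φ.naturality g.op)) x)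
          (fun i N => ((ψ i).app ((reindex (Sigma.mk i)).op.obj M)).app N)
          (fun i N N' g y => ConcreteCategory.congr_hom
            (((ψ i).app ((reindex (Sigma.mk i)).op.obj M)).naturality g) y)
      naturality := fun _ _ f => Coend.map_square _ _ _ _ _ _ _ _
          (fun N => (φ.app (op N)).naturality f)
          (fun _ _ => (Category.id_comp _).trans (Category.comp_id _).symm) }
  naturality M M' h := by
    ext L : 2
    exact Coend.map_square _ _ _ _ _ _ _ _
      (fun _ => (Category.id_comp _).trans (Category.comp_id _).symm)
      (fun i N => congrArg (fun t => t.app N)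
        ((ψ i).naturality ((reindex (Sigma.mk i)).op.map h)))

end Coend
end PEnd

namespace EndC

variable {I : Type} {J : I → Type}

/-- Renaming of the variables. -/
def relabel {I J : Type} (e : I ≃ J) : EndC C I ⥤ EndC C J :=
  (Functor.whiskeringLeft _ _ _).obj (reindex e)

/-- The operadic composition of the endomorphism operad. -/
def comp (F : EndC C I) (G : ∀ i, EndC C (J i)) : EndC C (Σ i, J i) :=
  Functor.pi' (fun i => reindex (Sigma.mk i) ⋙ G i) ⋙ F

/-- The operadic composition of the endomorphism operad on natural transformations. -/
def compMap {F F' : EndC C I} {G G' : ∀ i, EndC C (J i)} (φ : F ⟶ F') (ψ : ∀ i, G i ⟶ G' i) :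
    comp F G ⟶ comp F' G' :=
  Functor.whiskerRight (NatTrans.pi' fun i => Functor.whiskerLeft (reindex (Sigma.mk i)) (ψ i)) F ≫
    Functor.whiskerLeft _ φ

end EndC
end

section
variable (C : Type u) [SmallCategory C] [Preadditive C] [Linear ℂ C]

/-- The functors `ρ(I) : PaB(I)^op → PEnd_C(I)` underlying a lax 2-action: they take the unit to the
unit and are equivariant. -/
structure PreAction where
  F (I : Type) : (PaB I)ᵒᵖ ⥤ PEnd C I
  multilinear : ∀ {I : Type} (A : PaB I), ((F I).obj (op A)).IsMultilinear
  unit_eq : (F Unit).obj (op PaB.unary) = PEnd.unit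
  relabel_eq : ∀ {I J : Type} (e : I ≃ J), (PaB.relabel e).op ⋙ F J = F I ⋙ PEnd.relabel e

namespace PreAction

variable {C} (ρ : PreAction C) {I J : Type}

/-- The value `ρ(A)`. -/
abbrev V (A : PaB I) : PEnd C I := (ρ.F I).obj (op A)

theorem relabel_obj {e : I ≃ J} {A : PaB I} {B : PaB J} (h : (PaB.relabel e).obj A = B) :
    (PEnd.relabel e).obj (ρ.V A) = ρ.V B := by
  subst h
  exact (Functor.congr_obj (ρ.relabel_eq e) (op A)).symm

/-- The identification of `ρ(A)` with `ρ(e A)` after renaming the variables. -/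
def transport {e : I ≃ J} {A : PaB I} {B : PaB J} (h : (PaB.relabel e).obj A = B)
    {M : J → C} {L : C} (x : ((ρ.V A).obj (op fun i => M (e i))).obj L) :
    ((ρ.V B).obj (op M)).obj L :=
  ((eqToHom (ρ.relabel_obj h)).app (op M)).app L x

/-- Morphisms of `C` as elements of `ρ(1) = Hom_C`. -/
def ofHom {M : Unit → C} {L : C} (f : M () ⟶ L) : ((ρ.V PaB.unary).obj (op M)).obj L :=
  ((eqToHom ρ.unit_eq.symm).app (op M)).app L f

end PreAction

/-- A lax 2-morphism `(ρ, μ) : PaB^op → PEnd_C`, i.e. a lax 2-action of `PaB` on `C`.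
The maps `μ_{A; B_i} : ρ(A) ∘ (ρ(B_i)) ⟶ ρ(A ∘ (B_i))` are natural in the trees (`μ_natural`),
associative (`μ_assoc`: the Fubini isomorphism of coends takes `(x ⊗ y) ⊗ z` to `x ⊗ (y ⊗ z)`) and
equivariant (`μ_relabel`). Composing an operation without inputs with nothing changes nothing
(`μ_empty`). -/
structure LaxAction extends PreAction C where
  μ {I : Type} {J : I → Type} (A : PaB I) (B : ∀ i, PaB (J i)) :
    PEnd.comp (toPreAction.V A) (fun i => toPreAction.V (B i)) ⟶ toPreAction.V (A.comp B)
  μ_natural : ∀ {I : Type} {J : I → Type} {A A' : PaB I} {B B' : ∀ i, PaB (J i)}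
    (f : A ⟶ A') (g : ∀ i, B i ⟶ B' i),
    PEnd.compMap ((F I).map f.op) (fun i => (F (J i)).map (g i).op) ≫ μ A B =
      μ A' B' ≫ (F _).map (PaB.compMap f g).op
  μ_empty : ∀ {I : Type} [IsEmpty I] {J : I → Type} (A : PaB I) (B : ∀ i, PaB (J i))
    (M : (Σ i, J i) → C) (L : C)
    (x : ((toPreAction.V A).obj (op fun i => M (Equiv.equivOfIsEmpty I (Σ i, J i) i))).obj L)
    (y : ∀ i, PEnd.fibre (fun i => toPreAction.V (B i)) M
      (fun i => M (Equiv.equivOfIsEmpty I (Σ i, J i) i)) i),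
    ((μ A B).app (op M)).app L (PEnd.ι _ x y) =
      toPreAction.transport (PaB.relabel_empty_comp A B) x
  μ_assoc : ∀ {I : Type} {J : I → Type} {K : ∀ i, J i → Type} (A : PaB I) (B : ∀ i, PaB (J i))
    (D : ∀ i j, PaB (K i j)) (M : (Σ i, Σ j, K i j) → C) (L : C)
    (N : I → C) (x : ((toPreAction.V A).obj (op N)).obj L)
    (N' : ∀ i, J i → C) (y : ∀ i, ((toPreAction.V (B i)).obj (op (N' i))).obj (N i))
    (z : ∀ i j, ((toPreAction.V (D i j)).obj (op fun k => M ⟨i, j, k⟩)).obj (N' i j)),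
    toPreAction.transport (PaB.comp_assoc A B D) (M := M)
      (((μ (A.comp B) fun p => D p.1 p.2).app (op fun q => M (Equiv.sigmaAssoc K q))).app L
        (PEnd.ι (fun p => N' p.1 p.2)
          (((μ A B).app (op fun p => N' p.1 p.2)).app L (PEnd.ι N x y))
          (fun p => z p.1 p.2))) =
      ((μ A fun i => (B i).comp (D i)).app (op M)).app L
        (PEnd.ι N x fun i => ((μ (B i) (D i)).app (op fun q => M ⟨i, q⟩)).app (N i)
          (PEnd.ι (N' i) (y i) (z i)))
  μ_relabel : ∀ {I I' : Type} {J : I → Type} {J' : I' → Type} (A : PaB I) (B : ∀ i, PaB (J i))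
    (B' : ∀ i, PaB (J' i)) (e : I ≃ I') (h : ∀ i, J i ≃ J' (e i))
    (hB : ∀ i, (PaB.relabel (h i)).obj (B i) = B' (e i)) (M : (Σ i, J' i) → C) (L : C)
    (N : I' → C) (x : ((toPreAction.V A).obj (op fun i => N (e i))).obj L)
    (y : ∀ i, ((toPreAction.V (B i)).obj (op fun j => M ⟨e i, h i j⟩)).obj (N (e i)))
    (y' : ∀ i, ((toPreAction.V (B' i)).obj (op fun j => M ⟨i, j⟩)).obj (N i))
    (_ : ∀ i, y' (e i) = toPreAction.transport (hB i) (M := fun j => M ⟨e i, j⟩) (y i)),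
    ((μ ((PaB.relabel e).obj A) B').app (op M)).app L
      (PEnd.ι N (toPreAction.transport (e := e) rfl x) y') =
      toPreAction.transport (PaB.relabel_comp A B B' e h hB) (M := M)
        (((μ A B).app (op fun p => M (Equiv.sigmaCongr e h p))).app L
          (PEnd.ι (fun i => N (e i)) x y))

namespace LaxAction

variable {C} (ρ : LaxAction C)

/-- All `μ` are isomorphisms. -/
def IsStrong : Prop :=
  ∀ {I : Type} {J : I → Type} (A : PaB I) (B : ∀ i, PaB (J i)), IsIso (ρ.μ A B)

end LaxAction

/-- `F` is isomorphic to `Hom_C(X, -)` for some `X`. -/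
def IsRepresentable {C : Type u} [SmallCategory C] [Preadditive C] [Linear ℂ C]
    (F : C ⥤ ModuleCat.{u} ℂ) : Prop :=
  ∃ X : C, Nonempty (F ≅ (linearCoyoneda ℂ C).obj (op X))

namespace LaxAction
variable {C} (ρ : LaxAction C)

/-- All functors `ρ(A)(-, M)` are representable. -/
def IsRepresentative : Prop :=
  ∀ {I : Type} (A : PaB I) (M : I → C), IsRepresentable ((ρ.V A).obj (op M))

/-- The iterated coend `∫_{std_r} ρ(12)^{r-1}` for `r = n + 2`. -/
noncomputable def stdCoend : ∀ n, PEnd C (PaB.stdIdx (n + 2))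
  | 0 => ρ.V PaB.two
  | n + 1 => PEnd.comp (J := PaB.pairIdx Unit (PaB.stdIdx (n + 2))) (ρ.V PaB.two) fun
      | 0 => ρ.V PaB.unary
      | 1 => stdCoend n

/-- The natural transformation `μ_{std_r} : ∫_{std_r} ρ(12)^{r-1} ⟶ ρ(std_r)` for `r = n + 2`. -/
noncomputable def stdMap : ∀ n, ρ.stdCoend n ⟶ ρ.V (PaB.std (n + 2))
  | 0 => 𝟙 _
  | n + 1 => PEnd.compMap (J := PaB.pairIdx Unit (PaB.stdIdx (n + 2))) (𝟙 _)
      (fun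
        | 0 => 𝟙 (ρ.V PaB.unary)
        | 1 => stdMap n) ≫
      ρ.μ PaB.two (PaB.pair PaB.unary (PaB.std (n + 2)))

end LaxAction

/-- The functors `T(I) : PaB(I) → End_C(I)` underlying a 2-morphism: they take the unit to the
identity functor and are equivariant. -/
structure PreEndMorphism where
  F (I : Type) : PaB I ⥤ EndC C I
  multilinear : ∀ {I : Type} (A : PaB I), IsMultilinear ((F I).obj A)
  unit_eq : (F Unit).obj PaB.unary = Pi.eval (fun _ : Unit => C) ()
  relabel_eq : ∀ {I J : Type} (e : I ≃ J), PaB.relabel e ⋙ F J = F I ⋙ EndC.relabel e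

namespace PreEndMorphism

variable {C} (T : PreEndMorphism C) {I J : Type}

/-- The value `T(A)`. -/
abbrev V (A : PaB I) : EndC C I := (T.F I).obj A

theorem relabel_obj {e : I ≃ J} {A : PaB I} {B : PaB J} (h : (PaB.relabel e).obj A = B) :
    (EndC.relabel e).obj (T.V A) = T.V B := by
  subst h
  exact (Functor.congr_obj (T.relabel_eq e) A).symm

/-- The identification of `T(A)` with `T(e A)` after renaming the variables. -/
def transport {e : I ≃ J} {A : PaB I} {B : PaB J} (h : (PaB.relabel e).obj A = B) (M : J → C) :
    (T.V A).obj (fun i => M (e i)) ≅ (T.V B).obj M :=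
  (eqToIso (T.relabel_obj h)).app M

/-- The identification of `T(1)` with the identity functor. -/
def unitIso (M : Unit → C) : (T.V PaB.unary).obj M ≅ M () := (eqToIso T.unit_eq).app M

end PreEndMorphism

/-- A lax 2-morphism `(T, μ) : PaB → End_C`, with the same laws as for `LaxAction`. -/
structure LaxEndMorphism extends PreEndMorphism C where
  μ {I : Type} {J : I → Type} (A : PaB I) (B : ∀ i, PaB (J i)) :
    EndC.comp (toPreEndMorphism.V A) (fun i => toPreEndMorphism.V (B i)) ⟶
      toPreEndMorphism.V (A.comp B)
  μ_natural : ∀ {I : Type} {J : I → Type} {A A' : PaB I} {B B' : ∀ i, PaB (J i)}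
    (f : A ⟶ A') (g : ∀ i, B i ⟶ B' i),
    EndC.compMap ((F I).map f) (fun i => (F (J i)).map (g i)) ≫ μ A' B' =
      μ A B ≫ (F _).map (PaB.compMap f g)
  μ_empty : ∀ {I : Type} [IsEmpty I] {J : I → Type} (A : PaB I) (B : ∀ i, PaB (J i))
    (M : (Σ i, J i) → C),
    (μ A B).app M = (toPreEndMorphism.V A).map (fun i => isEmptyElim i) ≫
      (toPreEndMorphism.transport (PaB.relabel_empty_comp A B) M).hom
  μ_assoc : ∀ {I : Type} {J : I → Type} {K : ∀ i, J i → Type} (A : PaB I) (B : ∀ i, PaB (J i))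
    (D : ∀ i j, PaB (K i j)) (M : (Σ i, Σ j, K i j) → C),
    (μ A B).app (fun p => (toPreEndMorphism.V (D p.1 p.2)).obj fun k => M ⟨p.1, p.2, k⟩) ≫
      (μ (A.comp B) fun p => D p.1 p.2).app (fun q => M (Equiv.sigmaAssoc K q)) ≫
        (toPreEndMorphism.transport (PaB.comp_assoc A B D) M).hom =
    (toPreEndMorphism.V A).map (fun i => (μ (B i) (D i)).app fun q => M ⟨i, q⟩) ≫
      (μ A fun i => (B i).comp (D i)).app M
  μ_relabel : ∀ {I I' : Type} {J : I → Type} {J' : I' → Type} (A : PaB I) (B : ∀ i, PaB (J i))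
    (B' : ∀ i, PaB (J' i)) (e : I ≃ I') (h : ∀ i, J i ≃ J' (e i))
    (hB : ∀ i, (PaB.relabel (h i)).obj (B i) = B' (e i)) (M : (Σ i, J' i) → C),
    (μ A B).app (fun p => M (Equiv.sigmaCongr e h p)) ≫
      (toPreEndMorphism.transport (PaB.relabel_comp A B B' e h hB) M).hom =
    (toPreEndMorphism.V A).map
        (fun i => (toPreEndMorphism.transport (hB i) fun j => M ⟨e i, j⟩).hom) ≫
      (toPreEndMorphism.transport (e := e) rfl
        fun i => (toPreEndMorphism.V (B' i)).obj fun j => M ⟨i, j⟩).hom ≫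
        (μ ((PaB.relabel e).obj A) B').app M

namespace LaxEndMorphism

variable {C} (T : LaxEndMorphism C)

/-- All `μ` are isomorphisms. -/
def IsStrong : Prop :=
  ∀ {I : Type} {J : I → Type} (A : PaB I) (B : ∀ i, PaB (J i)), IsIso (T.μ A B)

/-- The map `μ_{1; 1}` is the identity of the identity functor. -/
def IsNormalized : Prop :=
  ∀ M : Unit → C,
    (T.μ PaB.unary fun _ => PaB.unary).app (fun p => M (PaB.sigmaUnit p)) ≫
      (T.transport PaB.relabel_sigmaUnit M).hom =
    (T.V PaB.unary).map fun i => (T.unitIso fun j => M (PaB.sigmaUnit ⟨i, j⟩)).hom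

end LaxEndMorphism

/-- `T` is induced by `ρ`: natural isomorphisms `θ_A : Hom_C(T(A)(-), -) ≅ ρ(A)`, natural in `A`,
equivariant, canonical at `A = 1`, and carrying the composition `μ` of `T` to that of `ρ`. -/
structure Represents (ρ : LaxAction C) (T : LaxEndMorphism C) where
  θ {I : Type} (A : PaB I) : (T.V A).op ⋙ linearCoyoneda ℂ C ≅ ρ.V A
  θ_natural : ∀ {I : Type} {A A' : PaB I} (f : A ⟶ A'),
    Functor.whiskerRight (NatTrans.op ((T.F I).map f)) (linearCoyoneda ℂ C) ≫ (θ A).hom =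
      (θ A').hom ≫ (ρ.F I).map f.op
  θ_unit : ∀ (M : Unit → C) (L : C) (f : M () ⟶ L),
    ((θ PaB.unary).hom.app (op M)).app L ((T.unitIso M).hom ≫ f) = ρ.ofHom f
  θ_relabel : ∀ {I J : Type} (e : I ≃ J) (A : PaB I) (M : J → C) (L : C)
    (f : (T.V ((PaB.relabel e).obj A)).obj M ⟶ L),
    ((θ ((PaB.relabel e).obj A)).hom.app (op M)).app L f =
      ρ.transport (e := e) rfl (((θ A).hom.app (op fun i => M (e i))).app L
        ((T.transport (e := e) rfl M).hom ≫ f))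
  θ_μ : ∀ {I : Type} {J : I → Type} (A : PaB I) (B : ∀ i, PaB (J i)) (M : (Σ i, J i) → C) (L : C)
    (N : I → C) (f : (T.V A).obj N ⟶ L) (g : ∀ i, (T.V (B i)).obj (fun j => M ⟨i, j⟩) ⟶ N i)
    (k : (T.V (A.comp B)).obj M ⟶ L), (T.μ A B).app M ≫ k = (T.V A).map g ≫ f →
    ((ρ.μ A B).app (op M)).app L
      (PEnd.ι N (((θ A).hom.app (op N)).app L f)
        fun i => ((θ (B i)).hom.app (op fun j => M ⟨i, j⟩)).app (N i) (g i)) =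
      ((θ (A.comp B)).hom.app (op M)).app L k

open MonoidalCategory in
/-- The braided monoidal structure of `C` comes from `T`: the tensor product is `T(12)` (by `τ`), the
unit object is `T(∅)` (by `η`), the braiding is `T` of the crossing, and, if `μ_{1; 1}` is the
identity, the associator is `T` of the trivial braid between `(12)3` and `1(23)` together with `μ`,
and the unitors are `μ` for `12 ∘_1 ∅ = 1` and `12 ∘_2 ∅ = 1`. -/
structure InducedBraiding {C : Type u} [SmallCategory C] [Preadditive C] [Linear ℂ C]
    (T : LaxEndMorphism C) [MonoidalCategory C] [BraidedCategory C] where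
  τ (N : Fin 2 → C) : N 0 ⊗ N 1 ≅ (T.V PaB.two).obj N
  τ_natural : ∀ {N N' : Fin 2 → C} (f : N ⟶ N'),
    (f 0 ⊗ₘ f 1) ≫ (τ N').hom = (τ N).hom ≫ (T.V PaB.two).map f
  η (M : Empty → C) : 𝟙_ C ≅ (T.V (PaB.empty Empty)).obj M
  braiding : ∀ N : Fin 2 → C,
    (β_ (N 0) (N 1)).hom ≫ (τ fun i => N (Equiv.swap 0 1 i)).hom ≫
        (T.transport (e := Equiv.swap 0 1) rfl N).hom =
      (τ N).hom ≫ ((T.F (Fin 2)).map PaB.σ).app N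
  associator : T.IsNormalized → ∀ X : Fin 3 → C,
    (α_ (X 0) (X 1) (X 2)).hom ≫
        ((T.unitIso fun _ => X 0).inv ⊗ₘ (τ fun j => X (PaB.sigmaR ⟨1, j⟩)).hom) ≫
        (τ fun i => (T.V (PaB.pair PaB.unary PaB.two i)).obj fun j => X (PaB.sigmaR ⟨i, j⟩)).hom ≫
        (T.μ PaB.two (PaB.pair PaB.unary PaB.two)).app (fun p => X (PaB.sigmaR p)) ≫
        (T.transport PaB.relabel_sigmaR X).hom =
      ((τ fun j => X (PaB.sigmaL ⟨0, j⟩)).hom ⊗ₘ (T.unitIso fun _ => X 2).inv) ≫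
        (τ fun i => (T.V (PaB.pair PaB.two PaB.unary i)).obj fun j => X (PaB.sigmaL ⟨i, j⟩)).hom ≫
        (T.μ PaB.two (PaB.pair PaB.two PaB.unary)).app (fun p => X (PaB.sigmaL p)) ≫
        (T.transport PaB.relabel_sigmaL X).hom ≫ ((T.F (Fin 3)).map PaB.α).app X
  leftUnitor : T.IsNormalized → ∀ X : Unit → C,
    (λ_ (X ())).hom = ((η _).hom ⊗ₘ (T.unitIso X).inv) ≫
      (τ fun i => (T.V (PaB.pair (PaB.empty Empty) PaB.unary i)).obj
        fun j => X (PaB.sigmaEmptyL ⟨i, j⟩)).hom ≫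
      (T.μ PaB.two (PaB.pair (PaB.empty Empty) PaB.unary)).app (fun p => X (PaB.sigmaEmptyL p)) ≫
      (T.transport PaB.relabel_sigmaEmptyL X).hom ≫ (T.unitIso X).hom
  rightUnitor : T.IsNormalized → ∀ X : Unit → C,
    (ρ_ (X ())).hom = ((T.unitIso X).inv ⊗ₘ (η _).hom) ≫
      (τ fun i => (T.V (PaB.pair PaB.unary (PaB.empty Empty) i)).obj
        fun j => X (PaB.sigmaEmptyR ⟨i, j⟩)).hom ≫
      (T.μ PaB.two (PaB.pair PaB.unary (PaB.empty Empty))).app (fun p => X (PaB.sigmaEmptyR p)) ≫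
      (T.transport PaB.relabel_sigmaEmptyR X).hom ≫ (T.unitIso X).hom

end
end PaBOp

open CategoryTheory Opposite PaBOp

/-!
A lax action `ρ` whose functors are representable is the same thing as a family of functors `T(A)`
with a comultiplication `ν : T(A ∘ B) ⟶ T(A) ∘ T(B)`, by the Yoneda lemma. The theorem says that few
instances of representability and of invertibility of `ν` suffice for all of them, and that `ν⁻¹`
then makes `C` a braided tensor category.

**Representability.** The category `PaB(I)` is a connected groupoid (`PaB.isoOfHom`,
`PaB.nonempty_hom`), so every `ρ(A)` is isomorphic to `ρ` of a relabelled standard tree. At standard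
trees `ρ` is an iterated coend of `ρ(12)`, and a coend of representable functors is computed by the
co-Yoneda lemma `PEnd.coYoneda`. This gives `LaxAction.isRepresentative_of_std`. The equivariance
and the unit of `T` are equalities of functors, so the representing objects are not chosen
arbitrarily: the choice `rep` depends only on the functor to be represented and on a suggestion,
which is the label of the letter for a tree with one letter.

**Strength.** The map `μ_{A; B}` of `ρ` is invertible if and only if `ν_{A; B}` is
(`PreRepresents.isIso_μ_iff`). As all trees with the same letters are isomorphic, this depends only
on the numbers of letters (`PreRepresents.Strong.congr`), and it propagates along associativity by
two-out-of-three (`StrongAt.assoc_right`, `StrongAt.assoc_left`). The point that is not formal is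
the start, `ν_{12; 1, 1}`, about which nothing is assumed (`PreRepresents.strong2_one_one`). If `∅`
is grafted at the middle letter of `1(23)`, this map is the first factor of an isomorphism, hence a
split monomorphism. If `∅` is grafted at the first letter, the map tensored with the unit object is
the second factor of an isomorphism. As tensoring with the unit object is isomorphic to the
identity, the map is an epimorphism, hence invertible. All other cases follow by induction on the
numbers of letters (`PreRepresents.strong_of_generators`). The inverses of `ν` are the maps `μ` of
the strong 2-morphism `T` (`PreRepresents.endMorphism`).

**The braided tensor category.** The map `μ_{1; 1}` of `T` is a central automorphism `z` of the
identity functor. Multiplying `μ` by `z⁻¹` at every letter does not change the functors `T(A)`, and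
yields a normalized 2-morphism (`LaxEndMorphism.exists_normalized`). For the coherence laws,
consider the category `Word C` of parenthesized words labelled by objects of `C`, whose morphisms
are braids with labelled strands. There concatenation is a tensor product for which the pentagon,
the triangle and the hexagons hold by inspection of braids (`Word.pentagon`, `Word.triangle`,
`Word.hexagon`, `Word.hexagon'`). The 2-morphism `T` evaluates words to objects of `C`, functorially
(`PreEndMorphism.ev`, `PreEndMorphism.evMap`), and `μ` provides natural isomorphisms
`m : ev v ⊗ ev w ≅ ev (v w)`, which transport the associator, the braiding and the unit isomorphisms of words to
those defined by `T(α)`, `T(σ)` and `μ` (`LaxEndMorphism.IsStrong.assoc_ev`,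
`LaxEndMorphism.braid_ev`, `LaxEndMorphism.IsNormalized.leftUnitorHom_ev`). Since every object is
isomorphic to the value of a word with one letter, the coherence laws hold in `C`.
-/

namespace PaBOp

universe u

/-! ### The groupoids `PaB(I)` -/

namespace BraidInf

/-- Every rearrangement of a list is realized by a braid. -/
theorem exists_braid_of_perm {X : Type*} {l l' : List X} (h : l.Perm l') :
    ∃ β ∈ strands l.length, ∀ j : ℕ, l[perm β j]? = l'[j]? := by
  induction h with
  | nil => exact ⟨1, one_mem _, by simp⟩
  | @cons x l l' _ ih =>
    obtain ⟨β, hβ, h⟩ := ih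
    refine ⟨shift 1 β, on_mono (Nat.zero_le _) (by simp [Nat.add_comm]) (shift_mem hβ), ?_⟩
    rintro (_ | j)
    · rw [perm_on (shift_mem hβ) (Or.inl Nat.zero_lt_one)]; rfl
    · rw [Nat.add_comm j 1, perm_shift, Nat.add_comm 1, Nat.add_comm 1]
      simpa using h j
  | swap x y l =>
    refine ⟨gen 0, gen_mem_on le_rfl (by simp), ?_⟩
    rintro (_ | _ | j)
    · simp
    · simp
    · rw [perm_gen, Equiv.swap_apply_of_ne_of_ne (by omega) (by omega)]; rfl
  | @trans l₁ l₂ l₃ h₁ _ ih₁ ih₂ =>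
    obtain ⟨β, hβ, h⟩ := ih₁
    obtain ⟨γ, hγ, h'⟩ := ih₂
    refine ⟨β * γ, mul_mem hβ (h₁.length_eq ▸ hγ), fun j => ?_⟩
    rw [map_mul, Equiv.Perm.mul_apply, h, h']

end BraidInf

namespace PaB

open BraidInf

variable {I J K : Type}

@[simp] theorem id_braid (A : PaB I) : Hom.braid (𝟙 A) = 1 := rfl

@[simp] theorem comp_braid {A B D : PaB I} (f : A ⟶ B) (g : B ⟶ D) :
    Hom.braid (f ≫ g) = Hom.braid f * Hom.braid g := rfl

theorem hom_ext {A B : PaB I} {f g : A ⟶ B} (h : Hom.braid f = Hom.braid g) : f = g := Hom.ext h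

/-- The inverse of a braid. -/
def inv {A B : PaB I} (f : A ⟶ B) : B ⟶ A where
  braid := f.braid⁻¹
  mem := inv_mem (by rw [length_leaves B A]; exact f.mem)
  perm_leaves j := by
    have := f.perm_leaves (perm f.braid⁻¹ j)
    rw [← this]; simp

/-- Every morphism of `PaB(I)` is invertible. -/
def isoOfHom {A B : PaB I} (f : A ⟶ B) : A ≅ B where
  hom := f
  inv := inv f
  hom_inv_id := Hom.ext (mul_inv_cancel f.braid)
  inv_hom_id := Hom.ext (inv_mul_cancel f.braid)

/-- Any two trees with the same letters are connected by a braid, so they are isomorphic. -/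
theorem nonempty_hom (A B : PaB I) : Nonempty (A ⟶ B) := by
  obtain ⟨β, h, h'⟩ := exists_braid_of_perm ((List.perm_ext_iff_of_nodup A.nodup B.nodup).2
    fun i => ⟨fun _ => B.mem_leaves i, fun _ => A.mem_leaves i⟩)
  exact ⟨⟨β, h, h'⟩⟩

theorem finite (A : PaB I) : Finite I :=
  Set.finite_univ_iff.1 ((A.leaves.finite_toSet).subset fun i _ => A.mem_leaves i)

theorem finite_stdIdx (r : ℕ) : Finite (stdIdx r) := (std r).finite

/-- The standard tree with `r` leaves has `r` letters. -/
theorem card_stdIdx : ∀ r, Nat.card (stdIdx r) = r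
  | 0 => Nat.card_of_isEmpty (α := Empty)
  | 1 => Nat.card_unique (α := Unit)
  | 2 => Nat.card_fin 2
  | r + 3 => by
    have := finite_stdIdx (r + 2)
    have e : stdIdx (r + 3) ≃ Unit ⊕ stdIdx (r + 2) :=
      { toFun := fun p => match p with
          | ⟨0, x⟩ => Sum.inl x
          | ⟨1, x⟩ => Sum.inr x
        invFun := fun s => match s with
          | Sum.inl x => ⟨0, x⟩
          | Sum.inr x => ⟨1, x⟩
        left_inv := by rintro ⟨i, x⟩; fin_cases i <;> rfl
        right_inv := by rintro (x | x) <;> rfl }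
    rw [Nat.card_congr e, Nat.card_sum, card_stdIdx (r + 2), Nat.card_unique]; omega

theorem exists_equiv_stdIdx (I : Type) [Finite I] {r : ℕ} (h : Nat.card I = r) :
    Nonempty (stdIdx r ≃ I) := by
  have := finite_stdIdx r
  exact Finite.card_eq.1 ((card_stdIdx r).trans h.symm)

instance nonempty (I : Type) [Finite I] : Nonempty (PaB I) := by
  obtain ⟨e⟩ := exists_equiv_stdIdx I rfl
  exact ⟨(relabel e).obj (std _)⟩

@[simp] theorem leaves_unary : unary.leaves = [()] := rfl
@[simp] theorem leaves_two : two.leaves = [0, 1] := rfl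

theorem relabel_refl (A : PaB I) : (relabel (Equiv.refl I)).obj A = A := by
  ext : 1
  change Tree.subst (fun i => Tree.leaf i) A.tree = A.tree
  induction A.tree using Tree.induction with
  | one => simp
  | of i => simp
  | mul s t hs ht => simp [hs, ht]

theorem relabel_relabel (e : I ≃ J) (e' : J ≃ K) (A : PaB I) :
    (relabel e').obj ((relabel e).obj A) = (relabel (e.trans e')).obj A := by
  ext : 1
  simp [relabel, relabelObj, Tree.subst_subst]

theorem relabel_obj_leaves (e : I ≃ J) (A : PaB I) :
    ((relabel e).obj A).leaves = A.leaves.map e := leaves_relabel e A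

end PaB
end PaBOp

namespace PaBOp

universe u

/-! ### Coends of representable functors -/

section
variable {C : Type u} [SmallCategory C]

namespace PEnd

/-- Composition in `PEnd` is functorial, so it takes isomorphisms to isomorphisms. -/
theorem isIso_compMap {I : Type} {J : I → Type} {F F' : PEnd C I} {G G' : ∀ i, PEnd C (J i)}
    (φ : F ⟶ F') (ψ : ∀ i, G i ⟶ G' i) [IsIso φ] [∀ i, IsIso (ψ i)] : IsIso (compMap φ ψ) := by
  have key : ∀ {F F' : PEnd C I} {G G' : ∀ i, PEnd C (J i)} (φ : F ⟶ F') (ψ : ∀ i, G i ⟶ G' i)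
      (φ' : F' ⟶ F) (ψ' : ∀ i, G' i ⟶ G i), φ ≫ φ' = 𝟙 _ → (∀ i, ψ i ≫ ψ' i = 𝟙 _) →
      compMap φ ψ ≫ compMap φ' ψ' = 𝟙 _ := by
    intro F F' G G' φ ψ φ' ψ' h h'
    ext M L : 4
    refine (Coend.map_map _ _ _ _ (φ'' := fun N => 𝟙 _) (fun f x => rfl) (ψ'' := fun i N => 𝟙 _)
      (fun i N N' f y => rfl) ?_ ?_).trans (Coend.map_id _ _ (fun _ => rfl) fun _ _ => rfl)
    · intro N
      exact congrArg (fun t => (t.app (op N)).app L) h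
    · intro i N
      exact congrArg (fun t => (t.app _).app N) (h' i)
  exact ⟨compMap (inv φ) (fun i => inv (ψ i)), key _ _ _ _ (by simp) (by simp),
    key _ _ _ _ (by simp) (by simp)⟩

/-- The action of `comp F G` on morphisms of the output variable, on generators of the coend. -/
theorem comp_map_ι {I : Type} {J : I → Type} {F : PEnd C I} {G : ∀ i, PEnd C (J i)}
    {M : (Σ i, J i) → C} {L L' : C} (f : L ⟶ L') (N : I → C) (x : (F.obj (op N)).obj L)
    (y : ∀ i, fibre G M N i) :
    ((comp F G).obj (op M)).map f (ι (F := F) (G := G) (M := M) N x y) =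
      ι (F := F) (G := G) (M := M) N ((F.obj (op N)).map f x) y := by
  exact Coend.map_ι (F := F) (G := G) (F' := F) (G' := G) (M := M) (M' := M)
    (fun N => (F.obj (op N)).map f)
    (fun g x => (ConcreteCategory.congr_hom ((F.map g.op).naturality f) x).symm) (fun _ _ => 𝟙 _)
    (fun _ _ _ _ _ => rfl) N x y

/-- The action of `comp F G` on morphisms of the input variables, on generators of the coend. -/
theorem comp_map_app_ι {I : Type} {J : I → Type} {F : PEnd C I} {G : ∀ i, PEnd C (J i)}
    {M M' : (Σ i, J i) → C} {L : C} (φ : M ⟶ M') (N : I → C) (x : (F.obj (op N)).obj L)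
    (y : ∀ i, fibre G M' N i) :
    ((comp F G).map φ.op).app L (ι (F := F) (G := G) (M := M') N x y) =
      ι (F := F) (G := G) (M := M) N x fun i => ((G i).map (Quiver.Hom.op
        (X := fun j => M ⟨i, j⟩) (Y := fun j => M' ⟨i, j⟩) fun j => φ ⟨i, j⟩)).app (N i) (y i) := by
  exact Coend.map_ι (F := F) (G := G) (F' := F) (G' := G) (M := M') (M' := M)
    (fun N => 𝟙 _) (fun {N N'} g x => rfl)
    (fun i N => (((reindex (Sigma.mk i)).op ⋙ G i).map φ.op).app N)
    (fun i N N' g y => ConcreteCategory.congr_hom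
      ((((reindex (Sigma.mk i)).op ⋙ G i).map φ.op).naturality g) y) N x y

theorem compMap_app_ι {I : Type} {J : I → Type} {F F' : PEnd C I} {G G' : ∀ i, PEnd C (J i)}
    (φ : F ⟶ F') (ψ : ∀ i, G i ⟶ G' i)
    {M : (Σ i, J i) → C} {L : C} (N : I → C) (x : (F.obj (op N)).obj L)
    (y : ∀ i, fibre G M N i) :
    ((compMap φ ψ).app (op M)).app L (ι (F := F) (G := G) (M := M) N x y) =
      ι (F := F') (G := G') (M := M) N ((φ.app (op N)).app L x) fun i =>
        ((ψ i).app (op fun j => M ⟨i, j⟩)).app (N i) (y i) := by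
  exact Coend.map_ι (F := F) (G := G) (F' := F') (G' := G') (M := M) (M' := M)
    (fun N => (φ.app (op N)).app L)
    (fun {N N'} g x => ConcreteCategory.congr_hom
      (congrArg (fun t => t.app L) (φ.naturality g.op)) x)
    (fun i N => ((ψ i).app ((reindex (Sigma.mk i)).op.obj (op M))).app N)
    (fun i N N' g y => ConcreteCategory.congr_hom
      (((ψ i).app ((reindex (Sigma.mk i)).op.obj (op M))).naturality g) y) N x y

end PEnd
end

section
variable {C : Type u} [SmallCategory C] [Preadditive C] [Linear ℂ C]

/-- The element of `F(X)` that corresponds to a natural transformation `Hom_C(X, -) ⟶ F`. -/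
def univ {F : C ⥤ ModuleCat.{u} ℂ} {X : C} (ψ : (linearCoyoneda ℂ C).obj (op X) ⟶ F) : F.obj X :=
  ψ.app X (𝟙 X)

/-- The Yoneda lemma: a natural transformation out of `Hom_C(X, -)` is determined by its universal
element. -/
theorem app_eq_map_univ {F : C ⥤ ModuleCat.{u} ℂ} {X : C}
    (ψ : (linearCoyoneda ℂ C).obj (op X) ⟶ F) {L : C} (f : X ⟶ L) :
    ψ.app L f = F.map f (univ ψ) := by
  have := ConcreteCategory.congr_hom (ψ.naturality f) (𝟙 X)
  refine Eq.trans (congrArg (ψ.app L) ?_) this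
  exact (Category.id_comp f).symm

namespace PEnd

/-- Pulling back an element along a family of arrows is additive in each of the arrows. -/
theorem IsMultilinear.map_add_apply {I : Type} {F : PEnd C I} (hF : F.IsMultilinear) {M N : I → C}
    {L : C} (x : (F.obj (op N)).obj L) (i : I) (f g h : M ⟶ N)
    (hj : ∀ j, j ≠ i → g j = f j ∧ h j = f j) (hi : f i = g i + h i) :
    (F.map f.op).app L x = (F.map g.op).app L x + (F.map h.op).app L x := by
  rw [hF.map_add i f g h hj hi]; rfl

theorem IsMultilinear.map_smul_apply {I : Type} {F : PEnd C I} (hF : F.IsMultilinear) {M N : I → C}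
    {L : C} (x : (F.obj (op N)).obj L) (i : I) (c : ℂ) (f g : M ⟶ N)
    (hj : ∀ j, j ≠ i → g j = f j) (hi : f i = c • g i) :
    (F.map f.op).app L x = c • (F.map g.op).app L x := by
  rw [hF.map_smul i c f g hj hi]; rfl

section
variable {I : Type} {J : I → Type} {F : PEnd C I} {G : ∀ i, PEnd C (J i)} {M : (Σ i, J i) → C}
  {X : I → C} (ψ : ∀ i, (linearCoyoneda ℂ C).obj (op (X i)) ≅ (G i).obj (op fun j => M ⟨i, j⟩))

/-- The arrow `X ⟶ N` that corresponds to an element of a represented functor. -/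
def arrow {N : I → C} (y : ∀ i, fibre G M N i) : X ⟶ N := fun i => (ψ i).inv.app (N i) (y i)

theorem map_arrow {N : I → C} (y : ∀ i, fibre G M N i) (i : I) :
    ((G i).obj (op fun j => M ⟨i, j⟩)).map (arrow ψ y i) (univ (ψ i).hom) = y i := by
  rw [← app_eq_map_univ]
  exact ConcreteCategory.congr_hom ((ψ i).inv_hom_id_app (N i)) (y i)

theorem arrow_univ : arrow ψ (fun i => univ (ψ i).hom) = 𝟙 X := by
  funext i
  exact ConcreteCategory.congr_hom ((ψ i).hom_inv_id_app (X i)) (𝟙 (X i))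

theorem arrow_map {N N' : I → C} (φ : N ⟶ N') (y : ∀ i, fibre G M N i) :
    arrow ψ (fun i => ((G i).obj (op fun j => M ⟨i, j⟩)).map (φ i) (y i)) = arrow ψ y ≫ φ := by
  funext i
  exact ConcreteCategory.congr_hom ((ψ i).inv.naturality (φ i)) (y i)

/-- Every generator of the coend can be moved to the representing objects. -/
theorem ι_eq_ι_univ {L : C} {N : I → C} (x : (F.obj (op N)).obj L) (y : ∀ i, fibre G M N i) :
    (ι N x y : Coend F G M L) =
      ι X ((F.map (arrow ψ y).op).app L x) fun i => univ (ψ i).hom := by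
  rw [ι_dinatural]
  congr 1
  funext i
  exact (map_arrow ψ y i).symm

/-- The co-Yoneda lemma: `∫^N F(L, N) ⊗ ⨂ Hom(X_i, N_i) ≅ F(L, X)`. -/
noncomputable def coYoneda (hF : F.IsMultilinear) (L : C) :
    (F.obj (op X)).obj L ≃ₗ[ℂ] Coend F G M L where
  toFun x := ι X x fun i => univ (ψ i).hom
  map_add' x y := ι_add_left _ _ _ _
  map_smul' c x := ι_smul_left _ _ _ _
  invFun := Coend.desc (fun N x y => (F.map (arrow ψ y).op).app L x)
    (fun N x x' y => map_add _ _ _)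
    (fun N c x y => map_smul _ _ _)
    (fun N x i y z w h hi => hF.map_add_apply x i _ _ _
      (fun j hj => by simp only [arrow]; rw [(h j hj).1, (h j hj).2]; exact ⟨rfl, rfl⟩)
      (by simp only [arrow]; rw [hi]; exact map_add ((ψ i).inv.app (N i)).hom _ _))
    (fun N x i c y z h hi => hF.map_smul_apply x i c _ _
      (fun j hj => by simp only [arrow]; rw [h j hj])
      (by simp only [arrow]; rw [hi]; exact map_smul ((ψ i).inv.app (N i)).hom _ _))
    (fun N N' φ x y => by rw [arrow_map, op_comp, F.map_comp]; rfl)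
  left_inv x := by
    simp only [Coend.desc_ι, arrow_univ]
    rw [op_id, F.map_id]; rfl
  right_inv z := by
    let f : (F.obj (op X)).obj L →ₗ[ℂ] Coend F G M L :=
      { toFun := fun x => ι X x fun i => univ (ψ i).hom
        map_add' := fun x y => ι_add_left _ _ _ _
        map_smul' := fun c x => ι_smul_left _ _ _ _ }
    refine LinearMap.congr_fun (f := f.comp (Coend.desc _ _ _ _ _ _)) (g := LinearMap.id) ?_ z
    apply Coend.hom_ext
    intro N x y
    rw [LinearMap.comp_apply, Coend.desc_ι]
    exact (ι_eq_ι_univ ψ x y).symm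

/-- The co-Yoneda lemma as an isomorphism of functors of the output variable. -/
noncomputable def coYonedaIso (hF : F.IsMultilinear) :
    F.obj (op X) ≅ (comp F G).obj (op M) :=
  NatIso.ofComponents (fun L => (coYoneda ψ hF L).toModuleIso) (fun f => by
    ext x; exact (comp_map_ι f X x _).symm)

end
end PEnd

theorem IsRepresentable.of_iso {F G : C ⥤ ModuleCat.{u} ℂ} (h : IsRepresentable F) (e : F ≅ G) :
    IsRepresentable G := by
  obtain ⟨X, ⟨i⟩⟩ := h
  exact ⟨X, ⟨e.symm ≪≫ i⟩⟩

/-- A coend composition of representable functors is representable: if `Y_i` represents `G_i`, the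
object that represents `F(-, Y)` represents the composition. -/
theorem PEnd.isRepresentable_comp {I : Type} {J : I → Type} {F : PEnd C I} {G : ∀ i, PEnd C (J i)}
    (hF : F.IsMultilinear) (hF' : ∀ N, IsRepresentable (F.obj (op N)))
    (hG : ∀ i N, IsRepresentable ((G i).obj (op N))) (M : (Σ i, J i) → C) :
    IsRepresentable ((PEnd.comp F G).obj (op M)) := by
  choose X ψ using fun i => hG i fun j => M ⟨i, j⟩
  exact (hF' X).of_iso (coYonedaIso (fun i => (ψ i).some.symm) hF)

/-! ### Representability of `ρ(A)` -/

namespace PreAction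

variable (ρ : PreAction C)

theorem isRepresentable_relabel {I J : Type} (e : I ≃ J) {A : PaB I}
    (h : ∀ M, IsRepresentable ((ρ.V A).obj (op M))) (M : J → C) :
    IsRepresentable ((ρ.V ((PaB.relabel e).obj A)).obj (op M)) := by
  rw [← ρ.relabel_obj (e := e) rfl]
  exact h _

theorem isRepresentable_unary (M : Unit → C) :
    IsRepresentable ((ρ.V PaB.unary).obj (op M)) := by
  rw [show ρ.V PaB.unary = _ from ρ.unit_eq]
  exact ⟨M (), ⟨Iso.refl _⟩⟩

/-- Representability of `ρ(A)(-, M)` depends only on the number of letters of `A`, since every tree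
is isomorphic in `PaB` to a relabelled standard tree. -/
theorem isRepresentable_of_std
    (h : ∀ r M, IsRepresentable ((ρ.V (PaB.std r)).obj (op M)))
    {I : Type} (A : PaB I) (M : I → C) : IsRepresentable ((ρ.V A).obj (op M)) := by
  have := A.finite
  obtain ⟨e⟩ := PaB.exists_equiv_stdIdx I rfl
  obtain ⟨f⟩ := PaB.nonempty_hom ((PaB.relabel e).obj (PaB.std _)) A
  exact (ρ.isRepresentable_relabel e (h _) M).of_iso
    (((ρ.F I).mapIso (PaB.isoOfHom f).op).symm.app (op M))

end PreAction

namespace LaxAction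

variable (ρ : LaxAction C)

theorem isRepresentable_stdCoend
    (h₂ : ∀ M : Fin 2 → C, IsRepresentable ((ρ.V PaB.two).obj (op M))) :
    ∀ n M, IsRepresentable ((ρ.stdCoend n).obj (op M))
  | 0, M => h₂ M
  | n + 1, M => PEnd.isRepresentable_comp (ρ.multilinear _) h₂ (fun i => match i with
      | 0 => ρ.isRepresentable_unary
      | 1 => isRepresentable_stdCoend h₂ n) M

/-- Representability of all `ρ(A)` from that of `ρ(∅)` and `ρ(12)`: the iterated coends of `ρ(12)`
are representable, and they compute `ρ` at the standard trees. -/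
theorem isRepresentative_of_std
    (h₁ : IsRepresentable ((ρ.V (PaB.empty Empty)).obj (op Empty.elim)))
    (h₂ : ∀ M : Fin 2 → C, IsRepresentable ((ρ.V PaB.two).obj (op M)))
    (h₃ : ∀ n : ℕ, IsIso (ρ.stdMap (n + 1))) : ρ.IsRepresentative := by
  intro I A M
  refine ρ.isRepresentable_of_std ?_ A M
  rintro (_ | _ | _ | r) M
  · rw [show M = Empty.elim from Subsingleton.elim (α := Empty → C) _ _]; exact h₁
  · exact ρ.isRepresentable_unary M
  · exact h₂ M
  · have := h₃ r
    exact (ρ.isRepresentable_stdCoend h₂ (r + 1) M).of_iso ((asIso (ρ.stdMap (r + 1))).app (op M))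

/-- If the iterated maps `μ_{std}` are isomorphisms, then so is every single map `μ` for the
grafting of a standard tree at the second letter of `12`: consecutive iterated maps differ by it. -/
theorem isIso_μ_two_unary_std (h₃ : ∀ n : ℕ, IsIso (ρ.stdMap (n + 1))) (n : ℕ) :
    IsIso (ρ.μ PaB.two (PaB.pair PaB.unary (PaB.std (n + 2)))) := by
  have h : IsIso (ρ.stdMap n) := by
    cases n with
    | zero => exact inferInstanceAs (IsIso (𝟙 _))
    | succ n => exact h₃ n
  have h' := h₃ n
  rw [stdMap] at h'
  refine @IsIso.of_isIso_comp_left _ _ _ _ _ _ _ (@PEnd.isIso_compMap _ _ _ _ _ _ _ _ _ _ _ ?_) h'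
  rintro (i : Fin 2)
  match i with
  | 0 => exact inferInstanceAs (IsIso (𝟙 _))
  | 1 => exact h

end LaxAction
end
end PaBOp

namespace PaBOp

universe u

/-! ### Representing objects, chosen strictly equivariantly -/

section
variable {C : Type u} [SmallCategory C] [Preadditive C] [Linear ℂ C]

open Classical in
/-- A representing object of `F`, together with the representation. If the suggestion `o` is `X` and
`F` is equal to `Hom(X, -)`, then `X` itself is taken; the choice depends only on `F` and `o`. -/
noncomputable def rep (F : C ⥤ ModuleCat.{u} ℂ) (h : IsRepresentable F) :
    Option C → Σ' X : C, (linearCoyoneda ℂ C).obj (op X) ≅ F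
  | some X => if e : (linearCoyoneda ℂ C).obj (op X) = F then ⟨X, eqToIso e⟩
      else ⟨h.choose, h.choose_spec.some.symm⟩
  | none => ⟨h.choose, h.choose_spec.some.symm⟩

theorem rep_some (X : C) (h : IsRepresentable ((linearCoyoneda ℂ C).obj (op X))) :
    rep _ h (some X) = ⟨X, Iso.refl _⟩ := by
  simp [rep]

/-- The linear co-Yoneda embedding is fully faithful. -/
noncomputable def linearCoyonedaFF : (linearCoyoneda ℂ C).FullyFaithful :=
  Functor.FullyFaithful.ofFullyFaithful _

section
variable {D : Type u} [Category.{u} D] (F : Dᵒᵖ ⥤ C ⥤ ModuleCat.{u} ℂ)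
  (h : ∀ M, IsRepresentable (F.obj (op M))) (o : D → Option C)

/-- The chosen object that represents `F(M)`. -/
noncomputable def repObj (M : D) : C := (rep _ (h M) (o M)).1

/-- The chosen representation of `F(M)`. -/
noncomputable def repIso (M : D) :
    (linearCoyoneda ℂ C).obj (op (repObj F h o M)) ≅ F.obj (op M) := (rep _ (h M) (o M)).2

/-- The functor `T` such that `Hom(T(M), -) ≅ F(M)`. -/
noncomputable def repFunctor : D ⥤ C where
  obj := repObj F h o
  map {M N} φ := (linearCoyonedaFF.preimage
    ((repIso F h o N).hom ≫ F.map φ.op ≫ (repIso F h o M).inv)).unop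
  map_id M := by
    apply Quiver.Hom.op_inj
    apply linearCoyonedaFF.map_injective
    simp
  map_comp {M N P} φ χ := by
    apply Quiver.Hom.op_inj
    apply linearCoyonedaFF.map_injective
    simp

/-- The isomorphism `Hom(T(M), -) ≅ F(M)`. -/
noncomputable def repFunctorIso (M : D) :
    (linearCoyoneda ℂ C).obj (op ((repFunctor F h o).obj M)) ≅ F.obj (op M) := repIso F h o M

theorem map_repFunctor_map {M N : D} (φ : M ⟶ N) :
    (linearCoyoneda ℂ C).map ((repFunctor F h o).map φ).op =
      (repFunctorIso F h o N).hom ≫ F.map φ.op ≫ (repFunctorIso F h o M).inv :=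
  linearCoyonedaFF.map_preimage _

/-- The representations, as a natural isomorphism. -/
noncomputable def repθ : (repFunctor F h o).op ⋙ linearCoyoneda ℂ C ≅ F :=
  NatIso.ofComponents (fun M => repFunctorIso F h o M.unop) (by
    intro M N φ
    have := map_repFunctor_map F h o φ.unop
    rw [Quiver.Hom.op_unop, ← Category.assoc, Iso.eq_comp_inv] at this
    exact this)

variable {F h o}
variable {F' : Dᵒᵖ ⥤ C ⥤ ModuleCat.{u} ℂ} {h' : ∀ M, IsRepresentable (F'.obj (op M))}
  {o' : D → Option C}

/-- The natural transformation of representing functors that corresponds to `t`. -/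
noncomputable def repMap (t : F' ⟶ F) : repFunctor F h o ⟶ repFunctor F' h' o' where
  app M := (linearCoyonedaFF.preimage
    ((repFunctorIso F' h' o' M).hom ≫ t.app (op M) ≫ (repFunctorIso F h o M).inv)).unop
  naturality M N φ := by
    apply Quiver.Hom.op_inj
    apply linearCoyonedaFF.map_injective
    simp [map_repFunctor_map]

theorem map_repMap_app (t : F' ⟶ F) (M : D) :
    (linearCoyoneda ℂ C).map ((repMap (h := h) (o := o) (h' := h') (o' := o') t).app M).op =
      (repFunctorIso F' h' o' M).hom ≫ t.app (op M) ≫ (repFunctorIso F h o M).inv :=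
  linearCoyonedaFF.map_preimage _

theorem repMap_id : repMap (𝟙 F) = 𝟙 (repFunctor F h o) := by
  ext M
  apply Quiver.Hom.op_inj
  apply linearCoyonedaFF.map_injective
  rw [map_repMap_app]
  simp

theorem repMap_comp {F'' : Dᵒᵖ ⥤ C ⥤ ModuleCat.{u} ℂ} {h'' : ∀ M, IsRepresentable (F''.obj (op M))}
    {o'' : D → Option C} (t : F' ⟶ F) (t' : F'' ⟶ F') :
    repMap (h := h) (o := o) (h' := h'') (o' := o'') (t' ≫ t) =
      repMap (h' := h') (o' := o') t ≫ repMap t' := by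
  ext M
  apply Quiver.Hom.op_inj
  apply linearCoyonedaFF.map_injective
  rw [map_repMap_app]
  simp [map_repMap_app]

theorem repMap_repθ (t : F' ⟶ F) :
    Functor.whiskerRight (NatTrans.op (repMap (h := h) (o := o) (h' := h') (o' := o') t))
      (linearCoyoneda ℂ C) ≫ (repθ F h o).hom = (repθ F' h' o').hom ≫ t := by
  ext M : 2
  have := map_repMap_app (h := h) (o := o) (h' := h') (o' := o') t M.unop
  rw [← Category.assoc, Iso.eq_comp_inv] at this
  exact this

/-- The representing functor depends only on `F` and the suggestions. -/
theorem repFunctor_congr (e : F = F') (e' : o = o') :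
    repFunctor F h o = repFunctor F' h' o' := by subst e e'; rfl

theorem repMap_congr {F₁ F₁' : Dᵒᵖ ⥤ C ⥤ ModuleCat.{u} ℂ}
    {h₁ : ∀ M, IsRepresentable (F₁.obj (op M))} {o₁ : D → Option C}
    {h₁' : ∀ M, IsRepresentable (F₁'.obj (op M))} {o₁' : D → Option C} (e₁ : F = F₁)
    (e₂ : F' = F₁') (e₃ : o = o₁) (e₄ : o' = o₁') {t : F' ⟶ F} {t₁ : F₁' ⟶ F₁}
    (ht : HEq t t₁) :
    HEq (repMap (h := h) (o := o) (h' := h') (o' := o') t)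
      (repMap (h := h₁) (o := o₁) (h' := h₁') (o' := o₁') t₁) := by
  subst e₁ e₂ e₃ e₄
  obtain rfl := eq_of_heq ht
  rfl

theorem repθ_congr (e : F = F') (e' : o = o') (M : D) (L : C)
    (f : (repFunctor F' h' o').obj M ⟶ L) (s : repFunctor F h o = repFunctor F' h' o') :
    ((repθ F' h' o').hom.app (op M)).app L f =
      ((eqToHom e).app (op M)).app L
        (((repθ F h o).hom.app (op M)).app L ((eqToHom s).app M ≫ f)) := by
  subst e e'
  rw [eqToHom_refl, eqToHom_refl]
  exact congrArg (((repθ F h o).hom.app (op M)).app L) (Category.id_comp f).symm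

end

/-- The label of the letter of a word of length one; there is none for other words. -/
def letter {I : Type} : List I → (I → C) → Option C
  | [i], M => some (M i)
  | _, _ => none

omit [SmallCategory C] [Preadditive C] [Linear ℂ C] in
theorem letter_map {I J : Type} (e : I → J) (l : List I) (M : J → C) :
    letter (l.map e) M = letter l fun i => M (e i) := by
  match l with
  | [] => rfl
  | [i] => rfl
  | _ :: _ :: _ => rfl

/-- With the suggestion `M ↦ M ()`, the functor that represents `Hom(M(), -)` is equal, and not only
isomorphic, to the evaluation. This makes `T(1)` the identity functor on the nose. -/
theorem repFunctor_unit {F : PEnd C Unit} (e : F = PEnd.unit) (h) :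
    repFunctor F h (fun M => some (M ())) = Pi.eval (fun _ : Unit => C) () := by
  subst e
  let R : (M : Unit → C) → Σ' X : C, (linearCoyoneda ℂ C).obj (op X) ≅ PEnd.unit.obj (op M) :=
    fun M => rep (PEnd.unit.obj (op M)) (h M) (some (M ()))
  have hR : R = fun M => ⟨M (), Iso.refl _⟩ := funext fun M => rep_some (M ()) (h M)
  refine Functor.hext (fun M => congrArg (fun R => (R M).1) hR) fun M N φ => ?_
  change HEq (linearCoyonedaFF.preimage
    ((R N).2.hom ≫ PEnd.unit.map φ.op ≫ (R M).2.inv)).unop (φ ())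
  rw [hR]
  refine heq_of_eq (Quiver.Hom.op_inj (linearCoyonedaFF.map_injective ?_))
  exact (linearCoyonedaFF.map_preimage _).trans
    ((Category.id_comp ((linearCoyoneda ℂ C).map (φ ()).op ≫ 𝟙 _)).trans (Category.comp_id _))

theorem repθ_unit {F : PEnd C Unit} (e : F = PEnd.unit) (h) (M : Unit → C) (L : C)
    (f : M () ⟶ L)
    (s : repFunctor F h (fun M => some (M ())) = Pi.eval (fun _ : Unit => C) ()) :
    ((repθ F h (fun M => some (M ()))).hom.app (op M)).app L ((eqToHom s).app M ≫ f) =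
      ((eqToHom e.symm).app (op M)).app L f := by
  subst e
  have h1 : ∀ (p : Σ' X : C, (linearCoyoneda ℂ C).obj (op X) ≅ PEnd.unit.obj (op M))
      (_ : p = ⟨M (), Iso.refl _⟩) (s : p.1 = M ()),
      p.2.hom.app L (eqToHom s ≫ f) = f := by
    rintro p rfl s
    exact Category.id_comp f
  rw [eqToHom_refl, eqToHom_app]
  exact h1 _ (rep_some (M ()) (h M)) _

theorem isMultilinear_repFunctor {I : Type} {F : PEnd C I} (hF : F.IsMultilinear) (h o) :
    IsMultilinear (repFunctor F h o) where
  map_add i f g k hj hi := by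
    have := hF.additive
    apply Quiver.Hom.op_inj
    apply linearCoyonedaFF.map_injective
    rw [map_repFunctor_map, hF.map_add i f g k hj hi, Preadditive.add_comp, Preadditive.comp_add,
      ← map_repFunctor_map, ← map_repFunctor_map]
    ext L x
    exact (Preadditive.add_comp _ _ _ _ _ x).symm
  map_smul i c f g hj hi := by
    apply Quiver.Hom.op_inj
    apply linearCoyonedaFF.map_injective
    rw [map_repFunctor_map, hF.map_smul i c f g hj hi, Linear.smul_comp, Linear.comp_smul,
      ← map_repFunctor_map]
    ext L x
    exact (Linear.smul_comp _ _ _ _ _ x).symm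

namespace LaxAction

variable {ρ : LaxAction C} (hρ : ρ.IsRepresentative)

/-- The suggested representing object of `ρ(A)(-, M)`: if `A` has a single letter `i`, it is `M i`.
-/
def hint {I : Type} (A : PaB I) (M : I → C) : Option C := letter A.leaves M

/-- The functors `T(I)` induced by `ρ`: the functor `T(A)` represents `ρ(A)`. -/
noncomputable def inducedPre : PreEndMorphism C where
  F I :=
    { obj := fun A => repFunctor (ρ.V A) (hρ A) (hint A)
      map := fun f => repMap ((ρ.F I).map f.op)
      map_id := fun A => by rw [op_id, (ρ.F I).map_id, repMap_id]
      map_comp := fun f g => by rw [op_comp, (ρ.F I).map_comp, repMap_comp] }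
  multilinear A := isMultilinear_repFunctor (ρ.multilinear A) _ _
  unit_eq := repFunctor_unit ρ.unit_eq _
  -- The choice of `T(A)(M)` depends only on the functor `ρ(A)(-, M)` and on the suggestion, and
  -- both are equivariant, hence so is `T`.
  relabel_eq {I J} e := by
    have ho : ∀ A : PaB I,
        hint (C := C) ((PaB.relabel e).obj A) = fun M => hint A fun i => M (e i) := by
      intro A; funext M
      rw [hint, PaB.relabel_obj_leaves, letter_map]; rfl
    have hF : ∀ A : PaB I, ρ.V ((PaB.relabel e).obj A) = (PEnd.relabel e).obj (ρ.V A) := fun A =>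
      (ρ.relabel_obj rfl).symm
    refine Functor.hext (fun A => ?_) fun A B f => ?_
    · exact repFunctor_congr (D := J → C) (h := hρ _) (h' := fun M => hρ A _)
        (o' := fun M => hint A fun i => M (e i)) (hF A) (ho A)
    · exact repMap_congr (D := J → C) (h := hρ _) (h' := hρ _) (h₁ := fun M => hρ A _)
        (h₁' := fun M => hρ B _)
        (o₁ := fun M => hint A fun i => M (e i)) (o₁' := fun M => hint B fun i => M (e i))
        (t := (ρ.F J).map ((PaB.relabel e).map f).op)
        (t₁ := (PEnd.relabel e).map ((ρ.F I).map f.op)) (hF A) (hF B) (ho A) (ho B)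
        (Functor.hcongr_hom (ρ.relabel_eq e) f.op)

/-- The isomorphisms `Hom(T(A)(-), -) ≅ ρ(A)`. -/
noncomputable def inducedθ {I : Type} (A : PaB I) :
    ((inducedPre hρ).V A).op ⋙ linearCoyoneda ℂ C ≅ ρ.V A := repθ _ _ _

theorem inducedθ_relabel {I J : Type} (e : I ≃ J) (A : PaB I) (M : J → C) (L : C)
    (f : ((inducedPre hρ).V ((PaB.relabel e).obj A)).obj M ⟶ L) :
    ((inducedθ hρ ((PaB.relabel e).obj A)).hom.app (op M)).app L f =
      ρ.transport (e := e) rfl (((inducedθ hρ A).hom.app (op fun i => M (e i))).app L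
        (((inducedPre hρ).transport (e := e) rfl M).hom ≫ f)) := by
  have ho : hint (C := C) ((PaB.relabel e).obj A) = fun M => hint A fun i => M (e i) := by
    funext M
    rw [hint, PaB.relabel_obj_leaves, letter_map]; rfl
  exact repθ_congr (F := (PEnd.relabel e).obj (ρ.V A)) (h := fun M => hρ A _) (ρ.relabel_obj rfl)
    ho.symm M L f ((inducedPre hρ).relabel_obj rfl)

end LaxAction
end
end PaBOp

namespace PaBOp

universe u

/-! ### The comultiplication of the representing functors -/

section
variable {C : Type u} [SmallCategory C] [Preadditive C] [Linear ℂ C]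

theorem app_map_apply {D : Type*} [Category D] {F G : D ⥤ ModuleCat.{u} ℂ} (t : F ⟶ G) {X Y : D}
    (f : X ⟶ Y) (x : F.obj X) : t.app Y (F.map f x) = G.map f (t.app X x) :=
  ConcreteCategory.congr_hom (t.naturality f) x

theorem map_comp_apply {D : Type*} [Category D] (F : D ⥤ ModuleCat.{u} ℂ) {X Y Z : D}
    (f : X ⟶ Y) (g : Y ⟶ Z) (x : F.obj X) : F.map (f ≫ g) x = F.map g (F.map f x) := by
  rw [F.map_comp]; rfl

theorem map_id_apply {D : Type*} [Category D] (F : D ⥤ ModuleCat.{u} ℂ) {X : D}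
    (x : F.obj X) : F.map (𝟙 X) x = x := by
  rw [F.map_id]; rfl

section
variable {F : C ⥤ ModuleCat.{u} ℂ} {X : C} (ψ : (linearCoyoneda ℂ C).obj (op X) ≅ F) {L : C}

/-- A morphism out of a representing object is determined by the image of the universal element. -/
theorem rep_hom_ext {f g : X ⟶ L} (h : F.map f (univ ψ.hom) = F.map g (univ ψ.hom)) : f = g := by
  rw [← app_eq_map_univ, ← app_eq_map_univ] at h
  have h1 : ∀ f : X ⟶ L, ψ.inv.app L (ψ.hom.app L f) = f :=
    ConcreteCategory.congr_hom (ψ.hom_inv_id_app L)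
  rw [← h1 f, ← h1 g, h]

/-- The arrow that corresponds to an element of a represented functor. -/
def repDesc (x : F.obj L) : X ⟶ L := ψ.inv.app L x

theorem map_repDesc (x : F.obj L) : F.map (repDesc ψ x) (univ ψ.hom) = x := by
  rw [← app_eq_map_univ]
  exact ConcreteCategory.congr_hom (ψ.inv_hom_id_app L) x

end

namespace LaxAction

variable (ρ : LaxAction C) {I : Type} {J : I → Type} (A : PaB I) (B : ∀ i, PaB (J i))
  {M : (Σ i, J i) → C} {L : C}

/-- The element `μ(x ⊗ ⨂ y_i)`. -/
noncomputable def mul (N : I → C) (x : ((ρ.V A).obj (op N)).obj L)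
    (y : ∀ i, ((ρ.V (B i)).obj (op fun j => M ⟨i, j⟩)).obj (N i)) :
    ((ρ.V (A.comp B)).obj (op M)).obj L :=
  ((ρ.μ A B).app (op M)).app L (PEnd.ι N x y)

variable {A B}

theorem map_mul {L' : C} (f : L ⟶ L') (N : I → C) (x : ((ρ.V A).obj (op N)).obj L)
    (y : ∀ i, ((ρ.V (B i)).obj (op fun j => M ⟨i, j⟩)).obj (N i)) :
    ((ρ.V (A.comp B)).obj (op M)).map f (ρ.mul A B N x y) =
      ρ.mul A B N (((ρ.V A).obj (op N)).map f x) y :=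
  (app_map_apply ((ρ.μ A B).app (op M)) f _).symm.trans
    (congrArg (((ρ.μ A B).app (op M)).app L') (PEnd.comp_map_ι f N x y))

/-- The relation that defines the coend, for `μ`. -/
theorem mul_dinatural {N N' : I → C} (φ : N ⟶ N') (x : ((ρ.V A).obj (op N')).obj L)
    (y : ∀ i, ((ρ.V (B i)).obj (op fun j => M ⟨i, j⟩)).obj (N i)) :
    ρ.mul A B N (((ρ.V A).map φ.op).app L x) y =
      ρ.mul A B N' x fun i => ((ρ.V (B i)).obj (op fun j => M ⟨i, j⟩)).map (φ i) (y i) :=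
  congrArg (((ρ.μ A B).app (op M)).app L)
    (PEnd.ι_dinatural (F := ρ.V A) (G := fun i => ρ.V (B i)) (M := M) N N' φ x y)

/-- `μ` is natural in the input variables. -/
theorem pull_mul {M' : (Σ i, J i) → C} (φ : M' ⟶ M) (N : I → C) (x : ((ρ.V A).obj (op N)).obj L)
    (y : ∀ i, ((ρ.V (B i)).obj (op fun j => M ⟨i, j⟩)).obj (N i)) :
    ((ρ.V (A.comp B)).map φ.op).app L (ρ.mul A B N x y) =
      ρ.mul A B N x fun i => ((ρ.V (B i)).map (Quiver.Hom.op
        (X := fun j => M' ⟨i, j⟩) (Y := fun j => M ⟨i, j⟩) fun j => φ ⟨i, j⟩)).app (N i) (y i) := by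
  have h := congrArg (fun t => NatTrans.app t L) ((ρ.μ A B).naturality φ.op)
  have h' := ConcreteCategory.congr_hom h
    (PEnd.ι (F := ρ.V A) (G := fun i => ρ.V (B i)) (M := M) N x y)
  exact h'.symm.trans (congrArg (((ρ.μ A B).app (op M')).app L) (PEnd.comp_map_app_ι φ N x y))

/-- `μ` is natural in the trees. -/
theorem braid_mul {A' : PaB I} {B' : ∀ i, PaB (J i)} (f : A ⟶ A') (g : ∀ i, B i ⟶ B' i)
    (N : I → C) (x : ((ρ.V A').obj (op N)).obj L)
    (y : ∀ i, ((ρ.V (B' i)).obj (op fun j => M ⟨i, j⟩)).obj (N i)) :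
    (((ρ.F _).map (PaB.compMap f g).op).app (op M)).app L (ρ.mul A' B' N x y) =
      ρ.mul A B N ((((ρ.F I).map f.op).app (op N)).app L x) fun i =>
        (((ρ.F (J i)).map (g i).op).app (op fun j => M ⟨i, j⟩)).app (N i) (y i) := by
  have h := congrArg (fun t => NatTrans.app (NatTrans.app t (op M)) L) (ρ.μ_natural f g)
  have h' := ConcreteCategory.congr_hom h
    (PEnd.ι (F := ρ.V A') (G := fun i => ρ.V (B' i)) (M := M) N x y)
  exact h'.symm.trans (congrArg (((ρ.μ A B).app (op M)).app L) (PEnd.compMap_app_ι _ _ N x y))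

end LaxAction

/-- Functors `T(A)` that represent the functors `ρ(A)`, compatibly with braids, renamings and the
unit. This is the part of `Represents` that does not involve the composition maps. -/
structure PreRepresents (ρ : LaxAction C) (T : PreEndMorphism C) where
  θ {I : Type} (A : PaB I) : (T.V A).op ⋙ linearCoyoneda ℂ C ≅ ρ.V A
  θ_natural : ∀ {I : Type} {A A' : PaB I} (f : A ⟶ A'),
    Functor.whiskerRight (NatTrans.op ((T.F I).map f)) (linearCoyoneda ℂ C) ≫ (θ A).hom =
      (θ A').hom ≫ (ρ.F I).map f.op
  θ_unit : ∀ (M : Unit → C) (L : C) (f : M () ⟶ L),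
    ((θ PaB.unary).hom.app (op M)).app L ((T.unitIso M).hom ≫ f) = ρ.ofHom f
  θ_relabel : ∀ {I J : Type} (e : I ≃ J) (A : PaB I) (M : J → C) (L : C)
    (f : (T.V ((PaB.relabel e).obj A)).obj M ⟶ L),
    ((θ ((PaB.relabel e).obj A)).hom.app (op M)).app L f =
      ρ.transport (e := e) rfl (((θ A).hom.app (op fun i => M (e i))).app L
        ((T.transport (e := e) rfl M).hom ≫ f))

/-- A representative lax action is represented by functors `T(A)`. -/
noncomputable def LaxAction.inducedPreRepresents {ρ : LaxAction C} (hρ : ρ.IsRepresentative) :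
    PreRepresents ρ (inducedPre hρ) where
  θ := inducedθ hρ
  θ_natural _ := repMap_repθ _
  θ_unit M L f :=
    repθ_unit (F := ρ.V PaB.unary) ρ.unit_eq (hρ _) M L f ((inducedPre hρ).unit_eq)
  θ_relabel := inducedθ_relabel hρ

namespace PreAction

variable {ρ : PreAction C} {I J : Type} {e : I ≃ J} {A : PaB I} {B : PaB J}

theorem transport_map (h : (PaB.relabel e).obj A = B) {M : J → C} {L L' : C} (f : L ⟶ L')
    (x : ((ρ.V A).obj (op fun i => M (e i))).obj L) :
    ρ.transport h (M := M) (((ρ.V A).obj (op fun i => M (e i))).map f x) =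
      ((ρ.V B).obj (op M)).map f (ρ.transport h x) :=
  app_map_apply ((eqToHom (ρ.relabel_obj h)).app (op M)) f x

theorem transport_injective (h : (PaB.relabel e).obj A = B) (M : J → C) (L : C) :
    Function.Injective (ρ.transport h (M := M) (L := L)) := by
  subst h
  intro x y hxy
  have := congrArg (((eqToHom (ρ.relabel_obj (e := e) (A := A) rfl).symm).app (op M)).app L) hxy
  have h0 := congrArg (fun t => NatTrans.app (NatTrans.app t (op M)) L)
    (eqToHom_trans (ρ.relabel_obj (e := e) (A := A) rfl) (ρ.relabel_obj rfl).symm)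
  have h1 : ∀ x, (((eqToHom (ρ.relabel_obj (e := e) (A := A) rfl).symm).app (op M)).app L)
      (ρ.transport (e := e) rfl (M := M) x) = x := ConcreteCategory.congr_hom h0
  rwa [h1, h1] at this

end PreAction

namespace PreRepresents

variable {ρ : LaxAction C} {T : PreEndMorphism C} (P : PreRepresents ρ T) {I : Type}

/-- The representation of `ρ(A)(-, M)` by `T(A)(M)`. -/
noncomputable def iso (A : PaB I) (M : I → C) :
    (linearCoyoneda ℂ C).obj (op ((T.V A).obj M)) ≅ (ρ.V A).obj (op M) := (P.θ A).app (op M)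

/-- The universal element of `ρ(A)(-, M)`. -/
noncomputable def elt (A : PaB I) (M : I → C) : ((ρ.V A).obj (op M)).obj ((T.V A).obj M) :=
  univ (P.iso A M).hom

theorem hom_ext {A : PaB I} {M : I → C} {L : C} {f g : (T.V A).obj M ⟶ L}
    (h : ((ρ.V A).obj (op M)).map f (P.elt A M) = ((ρ.V A).obj (op M)).map g (P.elt A M)) :
    f = g := rep_hom_ext (P.iso A M) h

theorem θ_apply {A : PaB I} {M : I → C} {L : C} (f : (T.V A).obj M ⟶ L) :
    ((P.θ A).hom.app (op M)).app L f = ((ρ.V A).obj (op M)).map f (P.elt A M) :=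
  app_eq_map_univ (P.iso A M).hom f

theorem map_elt (A : PaB I) {M N : I → C} (φ : M ⟶ N) :
    ((ρ.V A).obj (op M)).map ((T.V A).map φ) (P.elt A M) =
      ((ρ.V A).map φ.op).app _ (P.elt A N) := by
  rw [← θ_apply]
  have h := congrArg (fun t => NatTrans.app t ((T.V A).obj N)) ((P.θ A).hom.naturality φ.op)
  have := ConcreteCategory.congr_hom h (𝟙 ((T.V A).obj N))
  refine Eq.trans ?_ this
  exact congrArg (((P.θ A).hom.app (op M)).app _) (Category.comp_id ((T.V A).map φ)).symm

theorem braid_elt {A A' : PaB I} (f : A ⟶ A') (M : I → C) :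
    ((ρ.V A).obj (op M)).map (((T.F I).map f).app M) (P.elt A M) =
      (((ρ.F I).map f.op).app (op M)).app _ (P.elt A' M) := by
  rw [← θ_apply]
  have h := congrArg (fun t => NatTrans.app (NatTrans.app t (op M)) ((T.V A').obj M))
    (P.θ_natural f)
  have := ConcreteCategory.congr_hom h (𝟙 ((T.V A').obj M))
  refine Eq.trans ?_ this
  exact congrArg (((P.θ A).hom.app (op M)).app _) (Category.comp_id (((T.F I).map f).app M)).symm

theorem elt_transport {J : Type} {e : I ≃ J} {A : PaB I} {B : PaB J}
    (h : (PaB.relabel e).obj A = B) (M : J → C) :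
    P.elt B M = ρ.transport h (((ρ.V A).obj (op fun i => M (e i))).map (T.transport h M).hom
      (P.elt A fun i => M (e i))) := by
  subst h
  rw [← θ_apply]
  refine (P.θ_relabel e A M _ (𝟙 _)).trans ?_
  rw [Category.comp_id]

theorem map_elt_of_transport {J : Type} {e : I ≃ J} {A : PaB I} {B : PaB J}
    (h : (PaB.relabel e).obj A = B) {M : J → C} {L : C} (f : (T.V B).obj M ⟶ L) :
    ((ρ.V B).obj (op M)).map f (P.elt B M) =
      ρ.transport h (((ρ.V A).obj (op fun i => M (e i))).map ((T.transport h M).hom ≫ f)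
        (P.elt A fun i => M (e i))) := by
  rw [map_comp_apply, PreAction.transport_map, ← P.elt_transport]

section
variable {J : I → Type} (A : PaB I) (B : ∀ i, PaB (J i))

/-- The objects `T(B_i)(M_i)`. -/
abbrev inner (T : PreEndMorphism C) (B : ∀ i, PaB (J i)) (M : (Σ i, J i) → C) (i : I) : C :=
  (T.V (B i)).obj fun j => M ⟨i, j⟩

/-- The component at `M` of the comultiplication `ν : T(A ∘ B) ⟶ T(A) ∘ T(B)` that represents the
map `μ` of `ρ`. It corresponds to the element `μ(u_A ⊗ ⨂ u_{B_i})`, where `u` are the universal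
elements. -/
noncomputable def νApp (M : (Σ i, J i) → C) :
    (T.V (A.comp B)).obj M ⟶ (T.V A).obj (inner T B M) :=
  repDesc (P.iso (A.comp B) M) (ρ.mul A B (inner T B M) (P.elt A _) fun i => P.elt (B i) _)

theorem νApp_elt (M : (Σ i, J i) → C) :
    ((ρ.V (A.comp B)).obj (op M)).map (P.νApp A B M) (P.elt _ M) =
      ρ.mul A B (inner T B M) (P.elt A _) fun i => P.elt (B i) _ :=
  map_repDesc _ _

variable {A B}

theorem mul_map {M : (Σ i, J i) → C} {L : C} (f : (T.V A).obj (inner T B M) ⟶ L) :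
    ρ.mul A B (inner T B M) (((ρ.V A).obj (op _)).map f (P.elt A _)) (fun i => P.elt (B i) _) =
      ((ρ.V (A.comp B)).obj (op M)).map (P.νApp A B M ≫ f) (P.elt _ M) := by
  rw [map_comp_apply, νApp_elt, ρ.map_mul]

/-- The map `μ` of `ρ` is determined by `ν`: it takes `θ(f) ⊗ ⨂ θ(g_i)` to
`θ(ν ≫ T(A)(g) ≫ f)`. -/
theorem mul_map_map {M : (Σ i, J i) → C} {L : C} {N : I → C} (f : (T.V A).obj N ⟶ L)
    (g : inner T B M ⟶ N) :
    ρ.mul A B N (((ρ.V A).obj (op _)).map f (P.elt A _))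
      (fun i => ((ρ.V (B i)).obj (op fun j => M ⟨i, j⟩)).map (g i) (P.elt (B i) _)) =
      ((ρ.V (A.comp B)).obj (op M)).map (P.νApp A B M ≫ (T.V A).map g ≫ f) (P.elt _ M) := by
  rw [← mul_map, map_comp_apply, map_elt, ← app_map_apply ((ρ.V A).map g.op), ρ.mul_dinatural]

theorem mul_elt_map {M : (Σ i, J i) → C} {N : I → C} (g : inner T B M ⟶ N) :
    ρ.mul A B N (P.elt A _)
      (fun i => ((ρ.V (B i)).obj (op fun j => M ⟨i, j⟩)).map (g i) (P.elt (B i) _)) =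
      ((ρ.V (A.comp B)).obj (op M)).map (P.νApp A B M ≫ (T.V A).map g) (P.elt _ M) := by
  have h := P.mul_map_map (A := A) (L := (T.V A).obj N) (𝟙 _) g
  rwa [map_id_apply, Category.comp_id] at h

variable (A B)

theorem νApp_naturality {M M' : (Σ i, J i) → C} (φ : M ⟶ M') :
    (T.V (A.comp B)).map φ ≫ P.νApp A B M' =
      P.νApp A B M ≫ (T.V A).map fun i => (T.V (B i)).map fun j => φ ⟨i, j⟩ := by
  apply P.hom_ext
  rw [map_comp_apply, map_elt, ← app_map_apply ((ρ.V (A.comp B)).map φ.op), νApp_elt, ρ.pull_mul,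
    ← mul_elt_map]
  congr 1
  funext i
  exact (P.map_elt (B i) fun j => φ ⟨i, j⟩).symm

variable {A B}

/-- `ν` is natural in the trees. -/
theorem ν_natural {A' : PaB I} {B' : ∀ i, PaB (J i)} (f : A ⟶ A') (g : ∀ i, B i ⟶ B' i)
    (M : (Σ i, J i) → C) :
    P.νApp A B M ≫ (T.V A).map (fun i => ((T.F (J i)).map (g i)).app fun j => M ⟨i, j⟩) ≫
        ((T.F I).map f).app _ =
      ((T.F _).map (PaB.compMap f g)).app M ≫ P.νApp A' B' M := by
  apply P.hom_ext
  rw [← mul_map_map, map_comp_apply, braid_elt, braid_elt,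
    ← app_map_apply (((ρ.F _).map (PaB.compMap f g).op).app (op M)), νApp_elt, ρ.braid_mul]
  congr 1
  funext i
  exact P.braid_elt (g i) fun j => M ⟨i, j⟩

end

/-- `ν` is coassociative; this is the associativity of the map `μ` of `ρ`. -/
theorem ν_assoc {J : I → Type} {K : ∀ i, J i → Type} (A : PaB I) (B : ∀ i, PaB (J i))
    (D : ∀ i j, PaB (K i j)) (M : (Σ i, Σ j, K i j) → C) :
    P.νApp (A.comp B) (fun p => D p.1 p.2) (fun q => M (Equiv.sigmaAssoc K q)) ≫
      P.νApp A B (fun p => (T.V (D p.1 p.2)).obj fun k => M ⟨p.1, p.2, k⟩) =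
    (T.transport (PaB.comp_assoc A B D) M).hom ≫ P.νApp A (fun i => (B i).comp (D i)) M ≫
      (T.V A).map fun i => P.νApp (B i) (D i) fun q => M ⟨i, q⟩ := by
  apply P.hom_ext
  apply PreAction.transport_injective (PaB.comp_assoc A B D) M
  have h := ρ.μ_assoc A B D M _ (fun i => (T.V (B i)).obj fun j => (T.V (D i j)).obj
    fun k => M ⟨i, j, k⟩) (P.elt A _) (fun i j => (T.V (D i j)).obj fun k => M ⟨i, j, k⟩)
    (fun i => P.elt (B i) _) (fun i j => P.elt (D i j) _)
  refine Eq.trans ?_ (h.trans ?_)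
  · refine congrArg (ρ.transport (PaB.comp_assoc A B D)) ((P.mul_map _).symm.trans ?_)
    exact congrArg (fun x => ρ.mul (A.comp B) (fun p => D p.1 p.2) _ x fun p => P.elt _ _)
      (P.νApp_elt A B _)
  · refine Eq.trans ?_ (P.map_elt_of_transport (PaB.comp_assoc A B D) _)
    rw [← mul_elt_map]
    refine congrArg (ρ.mul A (fun i => (B i).comp (D i)) _ _) ?_
    funext i
    exact (P.νApp_elt (B i) (D i) fun q => M ⟨i, q⟩).symm

/-- `ν` is equivariant. -/
theorem ν_relabel {I' : Type} {J : I → Type} {J' : I' → Type} (A : PaB I) (B : ∀ i, PaB (J i))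
    (B' : ∀ i, PaB (J' i)) (e : I ≃ I') (h : ∀ i, J i ≃ J' (e i))
    (hB : ∀ i, (PaB.relabel (h i)).obj (B i) = B' (e i)) (M : (Σ i, J' i) → C) :
    (T.transport (PaB.relabel_comp A B B' e h hB) M).hom ≫ P.νApp ((PaB.relabel e).obj A) B' M =
      P.νApp A B (fun p => M (Equiv.sigmaCongr e h p)) ≫
        (T.V A).map (fun i => (T.transport (hB i) fun j => M ⟨e i, j⟩).hom) ≫
        (T.transport (e := e) rfl fun i => (T.V (B' i)).obj fun j => M ⟨i, j⟩).hom := by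
  apply P.hom_ext
  apply PreAction.transport_injective (PaB.relabel_comp A B B' e h hB) M
  refine (P.map_elt_of_transport (PaB.relabel_comp A B B' e h hB) _).symm.trans ?_
  refine (P.νApp_elt _ _ M).trans ?_
  rw [P.elt_transport (e := e) rfl]
  refine Eq.trans ?_ (congrArg (ρ.transport (PaB.relabel_comp A B B' e h hB))
    (P.mul_map_map (A := A) (B := B) (M := fun p => M (Equiv.sigmaCongr e h p))
      (N := fun i => inner T B' M (e i))
      (T.transport (e := e) rfl _).hom fun i => (T.transport (hB i) fun j => M ⟨e i, j⟩).hom))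
  refine ρ.μ_relabel A B B' e h hB M _ _ _ _ _ fun i => ?_
  exact P.elt_transport (hB i) fun j => M ⟨e i, j⟩

/-- `ν` is canonical if `A` has no letters. -/
theorem ν_empty [IsEmpty I] {J : I → Type} (A : PaB I) (B : ∀ i, PaB (J i))
    (M : (Σ i, J i) → C) :
    (T.transport (PaB.relabel_empty_comp A B) M).hom ≫ P.νApp A B M ≫
      (T.V A).map (fun i => isEmptyElim i) = 𝟙 _ := by
  apply P.hom_ext
  apply PreAction.transport_injective (PaB.relabel_empty_comp A B) M
  refine (P.map_elt_of_transport (PaB.relabel_empty_comp A B) _).symm.trans ?_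
  rw [← mul_elt_map, map_id_apply]
  exact ρ.μ_empty A B M _ _ _

/-- The map `μ` of `ρ` is an isomorphism if and only if `ν` is. -/
theorem isIso_μ_iff {J : I → Type} (A : PaB I) (B : ∀ i, PaB (J i)) :
    IsIso (ρ.μ A B) ↔ ∀ M, IsIso (P.νApp A B M) := by
  -- Under the representations and the co-Yoneda isomorphism, `μ` is precomposition with `ν`.
  have key : ∀ M, (P.iso A (inner T B M)).hom ≫
      (PEnd.coYonedaIso (G := fun i => ρ.V (B i)) (fun i => P.iso (B i) fun j => M ⟨i, j⟩)
        (ρ.multilinear A)).hom ≫ (ρ.μ A B).app (op M) =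
      (linearCoyoneda ℂ C).map (P.νApp A B M).op ≫ (P.iso (A.comp B) M).hom := by
    intro M
    ext L f
    refine Eq.trans ?_ (app_eq_map_univ (P.iso (A.comp B) M).hom (P.νApp A B M ≫ f)).symm
    refine Eq.trans ?_ (P.mul_map f)
    exact congrArg (fun x => ρ.mul A B (inner T B M) x fun i => P.elt (B i) _)
      (app_eq_map_univ (P.iso A (inner T B M)).hom f)
  constructor
  · intro h M
    have h1 : IsIso ((linearCoyoneda ℂ C).map (P.νApp A B M).op ≫ (P.iso (A.comp B) M).hom) := by
      rw [← key]; infer_instance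
    have h2 := IsIso.of_isIso_comp_right ((linearCoyoneda ℂ C).map (P.νApp A B M).op)
      (P.iso (A.comp B) M).hom
    have h3 := isIso_of_fully_faithful (linearCoyoneda ℂ C) (P.νApp A B M).op
    exact (isIso_op_iff _).1 h3
  · intro h
    have : ∀ M, IsIso ((ρ.μ A B).app M) := by
      intro M
      have h0 := key M.unop
      have h1 := h M.unop
      rw [← Category.assoc] at h0
      have h2 : IsIso ((linearCoyoneda ℂ C).map (P.νApp A B M.unop).op ≫
        (P.iso (A.comp B) M.unop).hom) := inferInstance
      rw [← h0] at h2
      exact @IsIso.of_isIso_comp_left _ _ _ _ _ _ _ inferInstance h2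
    exact NatIso.isIso_of_isIso_app _

end PreRepresents
end
end PaBOp

namespace PaBOp

universe u

/-! ### Strength -/

theorem isIso_family {ι : Type*} {C : Type*} [Category C] {M N : ι → C} {φ : M ⟶ N}
    (h : ∀ i, IsIso (φ i)) : IsIso φ :=
  ⟨fun i => inv (φ i), by funext i; exact IsIso.hom_inv_id (φ i),
    by funext i; exact IsIso.inv_hom_id (φ i)⟩

section
variable {D : Type*} [Category D] {X Y Z : D}

theorem isIso_comp_of (f : X ⟶ Y) (g : Y ⟶ Z) (hf : IsIso f) (hg : IsIso g) : IsIso (f ≫ g) :=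
  inferInstance

theorem isIso_of_comp_left (f : X ⟶ Y) (g : Y ⟶ Z) (hf : IsIso f) (h : IsIso (f ≫ g)) : IsIso g :=
  IsIso.of_isIso_comp_left f g

theorem isIso_of_comp_right (f : X ⟶ Y) (g : Y ⟶ Z) (hg : IsIso g) (h : IsIso (f ≫ g)) :
    IsIso f :=
  IsIso.of_isIso_comp_right f g

theorem isIso_map_of {E : Type*} [Category E] (F : D ⥤ E) (f : X ⟶ Y) (h : IsIso f) :
    IsIso (F.map f) :=
  inferInstance

theorem inv_square {X' Y' : D} {n : X ⟶ Y} {n' : X' ⟶ Y'} [IsIso n] [IsIso n'] {f : X ⟶ X'}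
    {g : Y ⟶ Y'} (h : f ≫ n' = n ≫ g) : g ≫ inv n' = inv n ≫ f := by
  rw [IsIso.comp_inv_eq, Category.assoc, h, IsIso.inv_hom_id_assoc]

theorem eq_conj_of_squares {X' Y' W W' : D} {f : X ⟶ X'} {g : Y ⟶ Y'} {k : W ⟶ W'} {b : X ≅ Y}
    {b' : X' ≅ Y'} {c : Y ≅ W} {c' : Y' ≅ W'} (h : f ≫ b'.hom = b.hom ≫ g)
    (h' : g ≫ c'.hom = c.hom ≫ k) : f = (b ≪≫ c).hom ≫ k ≫ (c'.symm ≪≫ b'.symm).hom := by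
  simp only [Iso.trans_hom, Iso.symm_hom, Category.assoc]
  rw [← reassoc_of% h', Iso.hom_inv_id_assoc, ← reassoc_of% h, Iso.hom_inv_id, Category.comp_id]

theorem isIso_of_eq {f g : X ⟶ Y} (e : f = g) (h : IsIso g) : IsIso f := e ▸ h

end

instance PaB.isIso_hom {I : Type} {A B : PaB I} (f : A ⟶ B) : IsIso f :=
  (PaB.isoOfHom f).isIso_hom

section
variable {C : Type u} [SmallCategory C] [Preadditive C] [Linear ℂ C]

namespace PreEndMorphism

theorem transport_naturality (T : PreEndMorphism C) {I J : Type} {e : I ≃ J} {A : PaB I} {B : PaB J}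
    (h : (PaB.relabel e).obj A = B) {M N : J → C} (φ : M ⟶ N) :
    (T.V A).map (X := fun i => M (e i)) (Y := fun i => N (e i)) (fun i => φ (e i)) ≫
        (T.transport h N).hom =
      (T.transport h M).hom ≫ (T.V B).map φ :=
  (eqToIso (T.relabel_obj h)).hom.naturality φ

theorem unitIso_naturality (T : PreEndMorphism C) {M N : Unit → C} (φ : M ⟶ N) :
    (T.V PaB.unary).map φ ≫ (T.unitIso N).hom = (T.unitIso M).hom ≫ φ () :=
  (eqToIso T.unit_eq).hom.naturality φ

end PreEndMorphism

/-- The family of families `K, K'`. -/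
def pairFam {a b : Type} (K : a → Type) (K' : b → Type) : ∀ i, PaB.pairIdx a b i → Type
  | 0 => K
  | 1 => K'

/-- The family of families of trees `D, D'`. -/
def pairTrees {a b : Type} {K : a → Type} {K' : b → Type} (D : ∀ j, PaB (K j))
    (D' : ∀ j, PaB (K' j)) : ∀ i j, PaB (pairFam K K' i j)
  | 0 => D
  | 1 => D'

instance finite_pairIdx (a b : Type) [Finite a] [Finite b] : ∀ i, Finite (PaB.pairIdx a b i)
  | 0 => inferInstanceAs (Finite a)
  | 1 => inferInstanceAs (Finite b)

instance finite_pairFam {a b : Type} (K : a → Type) (K' : b → Type) [h : ∀ j, Finite (K j)]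
    [h' : ∀ j, Finite (K' j)] : ∀ i j, Finite (pairFam K K' i j)
  | 0 => h
  | 1 => h'

namespace PreRepresents

variable {ρ : LaxAction C} {T : PreEndMorphism C} (P : PreRepresents ρ T)

/-- `ν` is an isomorphism at the trees `A`, `B_i`. -/
def StrongAt {I : Type} {J : I → Type} (A : PaB I) (B : ∀ i, PaB (J i)) : Prop :=
  ∀ M, IsIso (P.νApp A B M)

/-- `ν` is an isomorphism at all trees with index sets `I`, `J_i`. -/
def Strong {I : Type} (J : I → Type) : Prop :=
  ∀ (A : PaB I) (B : ∀ i, PaB (J i)), P.StrongAt A B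

variable {P} {I : Type} {J : I → Type}

/-- Invertibility of `ν_{A; B}` depends only on the index sets: any two trees with the same letters
are isomorphic, and `ν` is natural. -/
theorem StrongAt.strong {A : PaB I} {B : ∀ i, PaB (J i)} (h : P.StrongAt A B) : P.Strong J := by
  intro A' B' M
  obtain ⟨f⟩ := PaB.nonempty_hom A A'
  have g := fun i => (PaB.nonempty_hom (B i) (B' i)).some
  have h1 : IsIso ((T.V A).map (X := inner T B M) (Y := inner T B' M)
      (fun i => ((T.F (J i)).map (g i)).app fun j => M ⟨i, j⟩)) :=
    isIso_map_of _ _ (isIso_family fun i => inferInstance)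
  exact isIso_of_comp_left (((T.F _).map (PaB.compMap f g)).app M) _ inferInstance
    (isIso_of_eq (P.ν_natural f g M).symm
      (isIso_comp_of _ _ (h M) (isIso_comp_of _ _ h1 inferInstance)))

/-- By equivariance, strength is invariant under bijections of the index sets. -/
theorem Strong.congr' {I' : Type} {J' : I' → Type} (hs : P.Strong J) (e : I ≃ I')
    (h : ∀ i, J i ≃ J' (e i)) : P.Strong J' := by
  intro A' B'
  refine StrongAt.strong (A := (PaB.relabel e).obj ((PaB.relabel e.symm).obj A')) (B := B') ?_ A' B'
  intro M
  let B : ∀ i, PaB (J i) := fun i => (PaB.relabel (h i).symm).obj (B' (e i))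
  have hB : ∀ i, (PaB.relabel (h i)).obj (B i) = B' (e i) := fun i => by
    rw [PaB.relabel_relabel, Equiv.symm_trans_self, PaB.relabel_refl]
  have h1 : IsIso ((T.V ((PaB.relabel e.symm).obj A')).map
      (X := inner T B fun p => M (Equiv.sigmaCongr e h p)) (Y := fun i => inner T B' M (e i))
      (fun i => (T.transport (hB i) fun j => M ⟨e i, j⟩).hom)) :=
    isIso_map_of _ _ (isIso_family fun i => Iso.isIso_hom _)
  exact isIso_of_comp_left (T.transport (PaB.relabel_comp _ B B' e h hB) M).hom _ inferInstance
    (isIso_of_eq (P.ν_relabel ((PaB.relabel e.symm).obj A') B B' e h hB M)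
      (isIso_comp_of _ _ (hs _ B _) (isIso_comp_of _ _ h1 (Iso.isIso_hom _))))

/-- Strength depends only on the cardinalities of the index sets. -/
theorem Strong.congr {I' : Type} {J' : I' → Type} (hs : P.Strong J) (e : I ≃ I')
    [∀ i, Finite (J i)] [∀ i, Finite (J' i)]
    (h : ∀ i, Nat.card (J i) = Nat.card (J' (e i))) : P.Strong J' :=
  hs.congr' e fun i => (Finite.card_eq.1 (h i)).some

theorem strong_of_isEmpty [IsEmpty I] : P.Strong J := by
  intro A B M
  have h1 : IsIso ((T.V A).map (X := inner T B M)
      (Y := fun i => M (Equiv.equivOfIsEmpty I (Σ i, J i) i)) (fun i => isEmptyElim i)) :=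
    isIso_map_of _ _ (isIso_family fun i => isEmptyElim i)
  have h2 := isIso_of_comp_left (T.transport (PaB.relabel_empty_comp A B) M).hom _ inferInstance
    (isIso_of_eq (P.ν_empty A B M) inferInstance)
  exact isIso_of_comp_right _ _ h1 h2

section
variable {K : ∀ i, J i → Type} {A : PaB I} {B : ∀ i, PaB (J i)} {D : ∀ i j, PaB (K i j)}

/-- Associativity: if grafting `B` at `A`, and then `D` at `A ∘ B`, is strong, then the composite of
the other two maps of the associativity square is invertible. -/
theorem isIso_ν_comp (h : P.StrongAt A B) (h' : P.StrongAt (A.comp B) fun p => D p.1 p.2)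
    (M : (Σ i, Σ j, K i j) → C) :
    IsIso (P.νApp A (fun i => (B i).comp (D i)) M ≫
      (T.V A).map (Y := fun i => (T.V (B i)).obj fun j => (T.V (D i j)).obj fun k => M ⟨i, j, k⟩)
        fun i => P.νApp (B i) (D i) fun q => M ⟨i, q⟩) := by
  exact isIso_of_comp_left (T.transport (PaB.comp_assoc A B D) M).hom _ inferInstance
    (isIso_of_eq (P.ν_assoc A B D M).symm (isIso_comp_of _ _ (h' _) (h _)))

theorem isIso_map_ν (hD : ∀ i, P.StrongAt (B i) (D i)) (M : (Σ i, Σ j, K i j) → C) :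
    IsIso ((T.V A).map (X := inner T (fun i => (B i).comp (D i)) M)
      (Y := fun i => (T.V (B i)).obj fun j => (T.V (D i j)).obj fun k => M ⟨i, j, k⟩)
        fun i => P.νApp (B i) (D i) fun q => M ⟨i, q⟩) :=
  isIso_map_of _ _ (isIso_family fun i => hD i _)

/-- Two-out-of-three for associativity: from `(A ∘ B) ∘ D` to `A ∘ (B ∘ D)`. -/
theorem StrongAt.assoc_right (h : P.StrongAt A B) (hD : ∀ i, P.StrongAt (B i) (D i))
    (h' : P.StrongAt (A.comp B) fun p => D p.1 p.2) :
    P.StrongAt A fun i => (B i).comp (D i) := by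
  intro M
  exact isIso_of_comp_right _ _ (isIso_map_ν hD M) (isIso_ν_comp h h' M)

/-- Two-out-of-three for associativity: from `A ∘ (B ∘ D)` to `(A ∘ B) ∘ D`. -/
theorem StrongAt.assoc_left (h : P.StrongAt A B) (hD : ∀ i, P.StrongAt (B i) (D i))
    (h' : P.StrongAt A fun i => (B i).comp (D i)) :
    P.StrongAt (A.comp B) fun p => D p.1 p.2 := by
  intro M'
  let M : (Σ i, Σ j, K i j) → C := fun q => M' ((Equiv.sigmaAssoc K).symm q)
  have hM : M' = fun q => M (Equiv.sigmaAssoc K q) := by funext q; simp [M]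
  rw [hM]
  exact isIso_of_comp_right _ (P.νApp A B fun p => (T.V (D p.1 p.2)).obj fun k => M ⟨p.1, p.2, k⟩)
    (h _) (isIso_of_eq (P.ν_assoc A B D M)
      (isIso_comp_of _ _ (Iso.isIso_hom _) (isIso_comp_of _ _ (h' M) (isIso_map_ν hD M))))

end

/-- If `U = T(∅)`, the object `T(12)(U, Y)` is naturally isomorphic to `Y`. Hence, if the first
objects of two pairs are isomorphic to `U`, the functor `T(12)` takes a morphism of pairs to a
conjugate of its second component. -/
theorem exists_unit_conj (h : P.StrongAt PaB.two (PaB.pair (PaB.empty Empty) PaB.unary))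
    {N N' : Fin 2 → C} (φ : N ⟶ N') [IsIso (φ 0)]
    (a : N' 0 ≅ (T.V (PaB.empty Empty)).obj Empty.elim) :
    ∃ (s : (T.V PaB.two).obj N ≅ N 1) (t : N' 1 ≅ (T.V PaB.two).obj N'),
      (T.V PaB.two).map φ = s.hom ≫ φ 1 ≫ t.hom := by
  -- `W Y` is the pair of the unit object and `Y`, in the form to which `ν_{12; 0, 1}` applies, and
  -- `κ` is the left unit isomorphism.
  let W : C → Fin 2 → C := fun Y =>
    inner T (PaB.pair (PaB.empty Empty) PaB.unary) fun p => (fun _ : Unit => Y) (PaB.sigmaEmptyL p)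
  let Wm : ∀ {Y Z : C}, (Y ⟶ Z) → (W Y ⟶ W Z) := fun f i =>
    (T.V (PaB.pair (PaB.empty Empty) PaB.unary i)).map fun j => f
  let κ : ∀ Y : C, (T.V PaB.two).obj (W Y) ≅ Y := fun Y =>
    (@asIso _ _ _ _ _ (h fun p => (fun _ : Unit => Y) (PaB.sigmaEmptyL p))).symm ≪≫
      T.transport PaB.relabel_sigmaEmptyL (fun _ => Y) ≪≫ T.unitIso fun _ => Y
  have hκ : ∀ {Y Z : C} (f : Y ⟶ Z), (T.V PaB.two).map (Wm f) ≫ (κ Z).hom = (κ Y).hom ≫ f := by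
    intro Y Z f
    have h1 := T.unitIso_naturality (M := fun _ => Y) (N := fun _ => Z) fun _ => f
    have h2 := T.transport_naturality PaB.relabel_sigmaEmptyL (M := fun _ => Y) (N := fun _ => Z)
      fun _ => f
    have h3 := P.νApp_naturality PaB.two (PaB.pair (PaB.empty Empty) PaB.unary)
      (M := fun _ => Y) (M' := fun _ => Z) fun _ => f
    have i1 := h fun p => (fun _ : Unit => Y) (PaB.sigmaEmptyL p)
    have i2 := h fun p => (fun _ : Unit => Z) (PaB.sigmaEmptyL p)
    have h4 := inv_square h3
    calc (T.V PaB.two).map (Wm f) ≫ (κ Z).hom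
        = ((T.V PaB.two).map (Wm f) ≫ inv (P.νApp _ _ _)) ≫
            (T.transport PaB.relabel_sigmaEmptyL (fun _ => Z)).hom ≫
              (T.unitIso fun _ => Z).hom := by
          simp only [κ, Iso.trans_hom, Iso.symm_hom, asIso_inv, Category.assoc]
      _ = inv (P.νApp _ _ _) ≫ ((T.V _).map (X := fun _ => Y) (Y := fun _ => Z) (fun _ => f) ≫
            (T.transport PaB.relabel_sigmaEmptyL (fun _ => Z)).hom) ≫
              (T.unitIso fun _ => Z).hom := by
          rw [show (T.V PaB.two).map (Wm f) ≫ inv (P.νApp _ _ _) = _ from h4]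
          simp only [Category.assoc]
      _ = (κ Y).hom ≫ f := by
          rw [h2, Category.assoc, h1]
          simp only [κ, Iso.trans_hom, Iso.symm_hom, asIso_inv, Category.assoc]
  let z : ∀ Y : C, (T.V (PaB.empty Empty)).obj Empty.elim ≅ W Y 0 := fun Y =>
    (T.V (PaB.empty Empty)).mapIso (Y := fun _ : Empty => Y)
      ⟨fun j => j.elim, fun j => j.elim, by funext j; exact j.elim, by funext j; exact j.elim⟩
  have hz : ∀ {Y Z : C} (f : Y ⟶ Z), (z Y).hom ≫ Wm f 0 = (z Z).hom := by
    intro Y Z f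
    refine ((T.V (PaB.empty Empty)).map_comp (Y := fun _ : Empty => Y) (Z := fun _ : Empty => Z)
      (fun j => j.elim) fun _ => f).symm.trans ?_
    refine congrArg (T.V (PaB.empty Empty)).map ?_
    funext j; exact j.elim
  let e : ∀ {M : Fin 2 → C}, (M 0 ≅ (T.V (PaB.empty Empty)).obj Empty.elim) → (M ≅ W (M 1)) :=
    fun {M} b => Pi.isoMk fun i => match i with
      | 0 => b ≪≫ z _
      | 1 => (T.unitIso fun _ => M 1).symm
  have he : φ ≫ (e a).hom = (e (asIso (φ 0) ≪≫ a)).hom ≫ Wm (φ 1) := by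
    funext i
    match i with
    | 0 =>
      change φ 0 ≫ a.hom ≫ (z _).hom = ((φ 0 ≫ a.hom) ≫ (z _).hom) ≫ Wm (φ 1) 0
      rw [Category.assoc, Category.assoc, hz]
    | 1 =>
      have := T.unitIso_naturality (M := fun _ => N 1) (N := fun _ => N' 1) fun _ => φ 1
      change φ 1 ≫ (T.unitIso fun _ => N' 1).inv =
        (T.unitIso fun _ => N 1).inv ≫ (T.V PaB.unary).map _
      rw [Iso.eq_inv_comp, ← Category.assoc, ← this, Category.assoc, Iso.hom_inv_id,
        Category.comp_id]
      rfl
  have h5 := congrArg (T.V PaB.two).map he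
  rw [Functor.map_comp, Functor.map_comp] at h5
  exact ⟨(T.V PaB.two).mapIso (e (asIso (φ 0) ≪≫ a)) ≪≫ κ _,
    (κ _).symm ≪≫ ((T.V PaB.two).mapIso (e a)).symm, eq_conj_of_squares h5 (hκ _)⟩

/-- A family of trees with prescribed finite sets of letters. -/
noncomputable def someTrees {I : Type} (J : I → Type) [∀ i, Finite (J i)] (i : I) : PaB (J i) :=
  Classical.choice inferInstance

section
variable {a b : Type} {K : a → Type} {K' : b → Type}
  [∀ j, Finite (K j)] [∀ j, Finite (K' j)]

/-- The index sets `K_j` and `K'_j` together, over the disjoint union. -/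
abbrev joint {a b : Type} (K : a → Type) (K' : b → Type) (p : Σ i, PaB.pairIdx a b i) : Type :=
  pairFam K K' p.1 p.2

omit [∀ j, Finite (K j)] [∀ j, Finite (K' j)] in
theorem strongAt_pair {A : PaB a} {B : PaB b} {D : ∀ j, PaB (K j)} {D' : ∀ j, PaB (K' j)}
    (h : P.StrongAt A D) (h' : P.StrongAt B D') :
    ∀ i, P.StrongAt (PaB.pair A B i) (pairTrees D D' i)
  | 0 => h
  | 1 => h'

/-- Associativity for the grafting of two trees at `12`, in terms of index sets: `12 ∘ (A ∘ D, B ∘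
D')` is strong if `(12 ∘ (A, B)) ∘ (D, D')` is. -/
theorem Strong.joint_right [Finite a] [Finite b] (h : P.Strong (PaB.pairIdx a b)) (h₀ : P.Strong K)
    (h₁ : P.Strong K') (h' : P.Strong (joint K K')) :
    P.Strong (PaB.pairIdx (Σ j, K j) (Σ j, K' j)) := by
  have A : PaB a := Classical.choice inferInstance
  have B : PaB b := Classical.choice inferInstance
  have := StrongAt.assoc_right (K := pairFam K K') (h PaB.two (PaB.pair A B))
    (strongAt_pair (h₀ A (someTrees K)) (h₁ B (someTrees K'))) (h' _ _)
  exact this.strong.congr' (Equiv.refl _) fun i => match i with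
    | 0 => Equiv.refl _
    | 1 => Equiv.refl _

/-- The converse of `Strong.joint_right`. -/
theorem Strong.joint_left [Finite a] [Finite b] (h : P.Strong (PaB.pairIdx a b)) (h₀ : P.Strong K)
    (h₁ : P.Strong K') (h' : P.Strong (PaB.pairIdx (Σ j, K j) (Σ j, K' j))) :
    P.Strong (joint K K') := by
  have A : PaB a := Classical.choice inferInstance
  have B : PaB b := Classical.choice inferInstance
  have h2 : P.Strong fun i => Σ j, pairFam K K' i j :=
    h'.congr' (Equiv.refl _) fun i => match i with
      | 0 => Equiv.refl _
      | 1 => Equiv.refl _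
  exact (StrongAt.assoc_left (K := pairFam K K') (h PaB.two (PaB.pair A B))
    (strongAt_pair (h₀ A (someTrees K)) (h₁ B (someTrees K'))) (h2 _ _)).strong

end

variable (P) in
/-- Strength of the compositions `1 ∘ B`, where `B` has `a` letters. -/
def Strong1 (a : ℕ) : Prop := P.Strong fun _ : Unit => Fin a

variable (P) in
/-- Strength of the compositions `A ∘ (B, B')`, where `A`, `B`, `B'` have `2`, `a`, `b` letters. -/
def Strong2 (a b : ℕ) : Prop := P.Strong (PaB.pairIdx (Fin a) (Fin b))

/-- The family of the sets with `x`, `y` and `z` elements. -/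
def tripleIdx (x y z : ℕ) : Fin 3 → Type
  | 0 => Fin x
  | 1 => Fin y
  | 2 => Fin z

instance (x y z : ℕ) : ∀ i, Finite (tripleIdx x y z i)
  | 0 => inferInstanceAs (Finite (Fin x))
  | 1 => inferInstanceAs (Finite (Fin y))
  | 2 => inferInstanceAs (Finite (Fin z))

variable (P) in
/-- Strength of the compositions `A ∘ (B, B', B'')`, where `A`, `B`, `B'`, `B''` have `3`, `x`, `y`,
`z` letters. -/
def Strong3 (x y z : ℕ) : Prop := P.Strong (tripleIdx x y z)

/-- The index sets in `Strong2` may be replaced by any sets of the same cardinality. -/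
theorem Strong2.of {a b : ℕ} {J : Fin 2 → Type} [∀ i, Finite (J i)] (h : P.Strong J)
    (h0 : Nat.card (J 0) = a) (h1 : Nat.card (J 1) = b) : P.Strong2 a b :=
  h.congr (Equiv.refl _) fun i => match i with
    | 0 => h0.trans (Nat.card_fin a).symm
    | 1 => h1.trans (Nat.card_fin b).symm

theorem Strong2.strong {a b : ℕ} {J : Fin 2 → Type} [∀ i, Finite (J i)] (h : P.Strong2 a b)
    (h0 : Nat.card (J 0) = a) (h1 : Nat.card (J 1) = b) : P.Strong J :=
  Strong.congr h (Equiv.refl _) fun i => match i with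
    | 0 => (Nat.card_fin a).trans h0.symm
    | 1 => (Nat.card_fin b).trans h1.symm

/-- The letters of `12` can be renamed, so strength is symmetric in the two grafted trees. -/
theorem Strong2.symm {a b : ℕ} (h : P.Strong2 a b) : P.Strong2 b a :=
  Strong.congr h (Equiv.swap 0 1) fun i => match i with
    | 0 => rfl
    | 1 => rfl

theorem Strong1.strong {a : ℕ} {I : Type} [Unique I] {J : I → Type} [∀ i, Finite (J i)]
    (h : P.Strong1 a) (h0 : Nat.card (J default) = a) : P.Strong J :=
  Strong.congr h (Equiv.ofUnique Unit I) fun i => by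
    rw [Nat.card_fin, ← h0, Subsingleton.elim (α := I) (Equiv.ofUnique Unit I i) default]

theorem Strong1.of {a : ℕ} {I : Type} [Unique I] {J : I → Type} [∀ i, Finite (J i)]
    (h : P.Strong J) (h0 : Nat.card (J default) = a) : P.Strong1 a :=
  Strong.congr h (Equiv.ofUnique I Unit) fun i => by
    rw [Nat.card_fin, ← h0, Subsingleton.elim (α := I) i default]

theorem card_sigma_fin_two (J : Fin 2 → Type) [∀ i, Finite (J i)] :
    Nat.card (Σ i, J i) = Nat.card (J 0) + Nat.card (J 1) := by
  rw [Nat.card_sigma, Fin.sum_univ_two]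

theorem card_sigma_unit (J : Unit → Type) [∀ i, Finite (J i)] :
    Nat.card (Σ i, J i) = Nat.card (J ()) := by
  exact Nat.card_congr (Equiv.uniqueSigma J)

/-- Grafting trees with `x`, `y`, `z` letters at `(12)3 = 12 ∘ (12, 1)` is as strong as grafting
trees with `x + y` and `z` letters at `12`. -/
theorem Strong2.three_left {x y z : ℕ} (h : P.Strong2 2 1) (hxy : P.Strong2 x y)
    (hz : P.Strong1 z) :
    P.Strong3 x y z ↔ P.Strong2 (x + y) z := by
  have h₀ : P.Strong (PaB.pairIdx (Fin 2) Unit) :=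
    h.strong (by simp [PaB.pairIdx]) (by simp [PaB.pairIdx])
  have e : ∀ p : Σ i, PaB.pairIdx (Fin 2) Unit i,
      Nat.card (joint (PaB.pairIdx (Fin x) (Fin y)) (fun _ : Unit => Fin z) p) =
        Nat.card (tripleIdx x y z (PaB.sigmaL p)) := by
    rintro ⟨i, j⟩
    match i, j with
    | 0, (0 : Fin 2) => rfl
    | 0, (1 : Fin 2) => rfl
    | 1, _ => rfl
  constructor
  · intro h3
    refine Strong2.of (h₀.joint_right hxy hz (h3.congr PaB.sigmaL.symm fun i => ?_)) ?_ ?_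
    · rw [e, Equiv.apply_symm_apply]
    · exact (card_sigma_fin_two _).trans (by simp [PaB.pairIdx])
    · exact (card_sigma_unit _).trans (by simp)
  · intro h2
    refine (h₀.joint_left hxy hz (h2.strong ?_ ?_)).congr PaB.sigmaL e
    · exact (card_sigma_fin_two _).trans (by simp [PaB.pairIdx])
    · exact (card_sigma_unit _).trans (by simp)

/-- Grafting trees with `x`, `y`, `z` letters at `1(23) = 12 ∘ (1, 12)` is as strong as grafting
trees with `x` and `y + z` letters at `12`. -/
theorem Strong2.three_right {x y z : ℕ} (h : P.Strong2 1 2) (hx : P.Strong1 x)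
    (hyz : P.Strong2 y z) :
    P.Strong3 x y z ↔ P.Strong2 x (y + z) := by
  have h₀ : P.Strong (PaB.pairIdx Unit (Fin 2)) :=
    h.strong (by simp [PaB.pairIdx]) (by simp [PaB.pairIdx])
  have e : ∀ p : Σ i, PaB.pairIdx Unit (Fin 2) i,
      Nat.card (joint (fun _ : Unit => Fin x) (PaB.pairIdx (Fin y) (Fin z)) p) =
        Nat.card (tripleIdx x y z (PaB.sigmaR p)) := by
    rintro ⟨i, j⟩
    match i, j with
    | 0, _ => rfl
    | 1, (0 : Fin 2) => rfl
    | 1, (1 : Fin 2) => rfl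
  constructor
  · intro h3
    refine Strong2.of (h₀.joint_right hx hyz (h3.congr PaB.sigmaR.symm fun i => ?_)) ?_ ?_
    · rw [e, Equiv.apply_symm_apply]
    · exact (card_sigma_unit _).trans (by simp)
    · exact (card_sigma_fin_two _).trans (by simp [PaB.pairIdx])
  · intro h2
    refine (h₀.joint_left hx hyz (h2.strong ?_ ?_)).congr PaB.sigmaR e
    · exact (card_sigma_unit _).trans (by simp)
    · exact (card_sigma_fin_two _).trans (by simp [PaB.pairIdx])

end PreRepresents
end
end PaBOp

namespace PaBOp

universe u

/-! ### Strength of all compositions -/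

section
variable {C : Type u} [SmallCategory C] [Preadditive C] [Linear ℂ C]

namespace PreRepresents

variable {ρ : LaxAction C} {T : PreEndMorphism C} {P : PreRepresents ρ T}

/-- Associativity for `12 ∘ (1, A)`, when `∅` is grafted at `1` and `E` at `A`. The map `ν_{A; E}`,
up to conjugation, is the second factor `g` of an isomorphism, since tensoring with the unit object
does nothing. The first factor `f` is the map `ν` that grafts `∅` and `A ∘ E` at `12`. -/
theorem exists_unit_tensor {I : Type} [Finite I] {K : I → Type} [∀ i, Finite (K i)]
    (h : P.Strong (PaB.pairIdx Unit I))
    (h' : P.Strong (joint (fun _ : Unit => Empty) K)) (h10 : P.Strong1 0) (h01 : P.Strong2 0 1)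
    (A : PaB I) (E : ∀ i, PaB (K i)) (M : (Σ i, K i) → C) :
    ∃ (X Y Z : C) (f : X ⟶ Y) (g : Y ⟶ Z) (s : Y ≅ _) (t : _ ≅ Z),
      IsIso (f ≫ g) ∧ g = s.hom ≫ P.νApp A E M ≫ t.hom ∧
        (P.Strong2 0 (Nat.card (Σ i, K i)) → IsIso f) := by
  let K' : Unit → Type := fun _ => Empty
  let D : ∀ j, PaB (K' j) := fun _ => PaB.empty Empty
  let M' : (Σ i, Σ j, pairFam K' K i j) → C := fun p => match p with
    | ⟨0, ⟨_, k⟩⟩ => Empty.elim k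
    | ⟨1, q⟩ => M q
  have h1 := isIso_ν_comp (K := pairFam K' K) (D := pairTrees D E)
    (h PaB.two (PaB.pair PaB.unary A)) (h' _ _) M'
  have h0 : P.StrongAt PaB.unary D := h10.strong (by simp [K']) _ _
  have h01' : P.StrongAt PaB.two (PaB.pair (PaB.empty Empty) PaB.unary) :=
    h01.strong (by simp [PaB.pairIdx]) (by simp [PaB.pairIdx]) _ _
  let N' : Fin 2 → C := fun i => (T.V (PaB.pair PaB.unary A i)).obj fun j =>
    (T.V (pairTrees D E i j)).obj fun k => M' ⟨i, j, k⟩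
  let φ : inner T (fun i => (PaB.pair PaB.unary A i).comp (pairTrees D E i)) M' ⟶ N' :=
    fun i => P.νApp _ (pairTrees D E i) fun q => M' ⟨i, q⟩
  have i0 : IsIso (φ 0) := h0 _
  let a : N' 0 ≅ (T.V (PaB.empty Empty)).obj Empty.elim :=
    (T.unitIso fun _ => _) ≪≫ (T.V (PaB.empty Empty)).mapIso (eqToIso (Subsingleton.elim _ _))
  obtain ⟨s, t, e⟩ := exists_unit_conj h01' φ a
  refine ⟨_, _, _, _, _, s, t, h1, e, fun hs => ?_⟩
  have hJ : ∀ i, Finite (Σ j, pairFam K' K i j) := fun i =>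
    have := finite_pairFam K' K i
    have := finite_pairIdx Unit I i
    inferInstance
  refine (Strong2.strong hs ?_ ?_ : P.Strong _) _ _ _
  · exact (card_sigma_unit K').trans (Nat.card_of_isEmpty (α := Empty))
  · rfl

/-- Grafting trees with letters `K` at `A` is strong if grafting `∅` and `A ∘ K` at `12` is. -/
theorem strong_of_strong2_zero {I : Type} [Finite I] {K : I → Type} [∀ i, Finite (K i)]
    (h : P.Strong (PaB.pairIdx Unit I))
    (h' : P.Strong (joint (fun _ : Unit => Empty) K)) (h10 : P.Strong1 0) (h01 : P.Strong2 0 1)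
    (h2 : P.Strong2 0 (Nat.card (Σ i, K i))) : P.Strong K := by
  intro A E M
  obtain ⟨X, Y, Z, f, g, s, t, hfg, rfl, hf⟩ := exists_unit_tensor h h' h10 h01 A E M
  have h3 := isIso_of_comp_left _ _ (hf h2) hfg
  exact isIso_of_comp_right _ _ inferInstance (isIso_of_comp_left _ _ inferInstance h3)

/-- Without knowing that the first factor is invertible, `ν_{A; E}` is still an epimorphism, as the
second factor of an isomorphism. -/
theorem epi_of_unit {I : Type} [Finite I] {K : I → Type} [∀ i, Finite (K i)]
    (h : P.Strong (PaB.pairIdx Unit I))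
    (h' : P.Strong (joint (fun _ : Unit => Empty) K)) (h10 : P.Strong1 0) (h01 : P.Strong2 0 1)
    (A : PaB I) (E : ∀ i, PaB (K i)) (M : (Σ i, K i) → C) : Epi (P.νApp A E M) := by
  obtain ⟨X, Y, Z, f, g, s, t, hfg, rfl, -⟩ := exists_unit_tensor h h' h10 h01 A E M
  have h3 : Epi (s.hom ≫ P.νApp A E M ≫ t.hom) := epi_of_epi f _
  have h4 : P.νApp A E M = s.inv ≫ (s.hom ≫ P.νApp A E M ≫ t.hom) ≫ t.inv := by simp
  rw [h4]
  infer_instance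

end PreRepresents

namespace PaB

/-- `{0} ⊔ {0} ≃ {0, 1}`, in order. -/
def sigmaUnits : (Σ i, pairIdx Unit Unit i) ≃ Fin 2 where
  toFun p := p.1
  invFun
    | 0 => ⟨0, ()⟩
    | 1 => ⟨1, ()⟩
  left_inv := by
    rintro ⟨i, j⟩
    fin_cases i <;> rfl
  right_inv i := by fin_cases i <;> rfl

/-- The sum of one copy of `{0, 1}`. -/
def sigmaUnitTwo : (Σ _ : Unit, Fin 2) ≃ Fin 2 := Equiv.uniqueSigma _

end PaB

namespace PreRepresents

variable {ρ : LaxAction C} {T : PreEndMorphism C} {P : PreRepresents ρ T}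

/-- `ν_{12; 1, 1}` is a split monomorphism, because it is the first factor of an isomorphism when
`∅` is grafted in the middle of `1(23)`, and it is an epimorphism, because it is the second factor
when `∅` is grafted on the left. -/
theorem strong2_one_one (h12 : P.Strong2 1 2) (h101 : P.Strong3 1 0 1) (h011 : P.Strong3 0 1 1)
    (h10 : P.Strong1 0) (h01 : P.Strong2 0 1) : P.Strong2 1 1 := by
  have h : P.Strong (PaB.pairIdx Unit (Fin 2)) :=
    h12.strong (by simp [PaB.pairIdx]) (by simp [PaB.pairIdx])
  let K₁ : Unit → Type := fun _ => Unit
  let K₂ : Fin 2 → Type := PaB.pairIdx Empty Unit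
  have h1 : P.Strong (joint K₁ K₂) := by
    refine h101.congr PaB.sigmaR.symm fun i => ?_
    match i with
    | 0 => exact (Nat.card_fin 1).trans (Nat.card_unique (α := Unit)).symm
    | 1 => exact (Nat.card_fin 0).trans (Nat.card_of_isEmpty (α := Empty)).symm
    | 2 => exact (Nat.card_fin 1).trans (Nat.card_unique (α := Unit)).symm
  let B : ∀ i, PaB (PaB.pairIdx Unit (Fin 2) i) := PaB.pair PaB.unary PaB.two
  let D : ∀ i j, PaB (pairFam K₁ K₂ i j) :=
    pairTrees (fun _ => PaB.unary) (PaB.pair (PaB.empty Empty) PaB.unary)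
  have c0 : Nat.card (Σ j, pairFam K₁ K₂ 0 j) = 1 :=
    (card_sigma_unit K₁).trans (Nat.card_unique (α := Unit))
  have c1 : Nat.card (Σ j, pairFam K₁ K₂ 1 j) = 1 :=
    (card_sigma_fin_two K₂).trans (by simp [K₂, PaB.pairIdx])
  have : ∀ i, Finite (Σ j, pairFam K₁ K₂ i j) := fun i =>
    have := finite_pairFam K₁ K₂ i
    have := finite_pairIdx Unit (Fin 2) i
    inferInstance
  have hs : P.StrongAt PaB.two fun i => (B i).comp (D i) := by
    intro M
    have h2 := isIso_ν_comp (h PaB.two B) (h1 _ fun p => D p.1 p.2) M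
    have h3 : IsSplitMono (P.νApp PaB.two (fun i => (B i).comp (D i)) M) :=
      ⟨⟨⟨_ ≫ inv _, (Category.assoc _ _ _).symm.trans (IsIso.hom_inv_id _ (I := h2))⟩⟩⟩
    have h4 : P.Strong (joint (fun _ : Unit => Empty) fun i : Fin 2 => Σ j, pairFam K₁ K₂ i j) := by
      refine h011.congr PaB.sigmaR.symm fun i => ?_
      match i with
      | 0 => exact (Nat.card_fin 0).trans (Nat.card_of_isEmpty (α := Empty)).symm
      | 1 => exact (Nat.card_fin 1).trans c0.symm
      | 2 => exact (Nat.card_fin 1).trans c1.symm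
    have h5 := epi_of_unit h h4 h10 h01 PaB.two (fun i => (B i).comp (D i)) M
    exact isIso_of_epi_of_isSplitMono _
  exact Strong2.of hs.strong c0 c1

variable (P) in
/-- Strength of all compositions, from that of the grafting of a standard tree at the second letter
of `12`, and of the erasure of a letter of `1`, `12` or `1(23)`. -/
theorem strong_of_generators (h2 : ∀ n, P.Strong2 1 (n + 2)) (h101 : P.Strong3 1 0 1)
    (h011 : P.Strong3 0 1 1) (h10 : P.Strong1 0) (h01 : P.Strong2 0 1)
    {I : Type} (J : I → Type) : P.Strong J := by
  have h12 := h2 0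
  have h11 := strong2_one_one h12 h101 h011 h10 h01
  -- `ν_{1; B}` is detected by `U ⊗ ν_{1; B}`
  have hu : ∀ b, P.Strong2 0 b → P.Strong1 b := by
    intro b hb
    have h4 : P.Strong (joint (fun _ : Unit => Empty) fun _ : Unit => Fin b) := by
      refine Strong.congr hb PaB.sigmaUnits.symm fun i => ?_
      match i with
      | 0 => exact (Nat.card_fin 0).trans (Nat.card_of_isEmpty (α := Empty)).symm
      | 1 => rfl
    refine strong_of_strong2_zero (I := Unit) (K := fun _ => Fin b)
      (h11.strong (Nat.card_unique (α := Unit)) (Nat.card_unique (α := Unit))) h4 h10 h01 ?_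
    rwa [card_sigma_unit, Nat.card_fin]
  have hone1 : P.Strong1 1 := hu 1 h01
  have h02 : P.Strong2 0 2 := (Strong2.three_right h12 h10 h11).1 h011
  have hone2 : P.Strong1 2 := hu 2 h02
  have h1r : ∀ b, P.Strong2 1 b
    | 0 => h01.symm
    | 1 => h11
    | b + 2 => h2 b
  -- For `b ≥ 3`, a tree with `b` letters is `12 ∘ (1, B)`, so `1 ∘ (12 ∘ (1, B))` can be
  -- re-associated.
  have hone : ∀ b, P.Strong1 b
    | 0 => h10
    | 1 => hone1
    | 2 => hone2
    | b + 3 => by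
      let J : Fin 2 → Type := PaB.pairIdx Unit (Fin (b + 2))
      have h3 : P.Strong fun p : Σ _ : Unit, Fin 2 => J p.2 :=
        Strong.congr (h2 b) PaB.sigmaUnitTwo.symm fun i => match i with
          | 0 => (Nat.card_fin 1).trans (Nat.card_unique (α := Unit)).symm
          | 1 => rfl
      have h4 : P.Strong J := (h2 b).strong (Nat.card_unique (α := Unit)) (Nat.card_fin _)
      have h5 := StrongAt.assoc_right (K := fun _ => J) (hone2 PaB.unary fun _ => PaB.two)
        (fun _ => h4 PaB.two (someTrees J)) (h3 _ _)
      refine Strong1.of h5.strong ((card_sigma_fin_two J).trans ?_)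
      simp [J, PaB.pairIdx]; omega
  -- `12 ∘ (∅, 1 ∘ B)` is re-associated to `(12 ∘ (∅, 1)) ∘ B`, and `12 ∘ (∅, 1)` is `1`.
  have h0b : ∀ b, P.Strong2 0 b := by
    intro b
    have h3 : P.Strong (joint (Empty.elim : Empty → Type) fun _ : Unit => Fin b) :=
      have : ∀ j, Finite ((Empty.elim : Empty → Type) j) := fun j => j.elim
      Strong.congr (hone b) PaB.sigmaEmptyL.symm fun _ => rfl
    have h4 : P.Strong (PaB.pairIdx Empty Unit) :=
      h01.strong (Nat.card_of_isEmpty (α := Empty)) (Nat.card_unique (α := Unit))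
    have : ∀ j, Finite ((Empty.elim : Empty → Type) j) := fun j => j.elim
    refine (h4.joint_right strong_of_isEmpty (hone b) h3).congr (Equiv.refl _) fun i => ?_
    match i with
    | 0 => exact (Nat.card_of_isEmpty (α := Σ j, Empty.elim j)).trans (Nat.card_fin 0).symm
    | 1 => exact card_sigma_unit fun _ => Fin b
  -- Induction on `a`, where `(1 + a, b)` is reached from `(1, a + b)` by re-bracketing.
  have hab : ∀ a b, P.Strong2 a b := by
    intro a
    induction a with
    | zero => exact h0b
    | succ a ih =>
      intro b
      have h3 : P.Strong3 1 a b := (Strong2.three_right h12 hone1 (ih b)).2 (h1r (a + b))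
      rw [Nat.add_comm]
      exact (Strong2.three_left h12.symm (h1r a) (hone b)).1 h3
  -- Induction on the number of letters of `A`, which may be taken to be `12 ∘ (1, A')`.
  have key : ∀ n : ℕ, ∀ {I : Type} [Finite I] (J : I → Type) [∀ i, Finite (J i)],
      Nat.card I = n → P.Strong J := by
    intro n
    induction n with
    | zero =>
      intro I _ J _ hI
      have : IsEmpty I := Finite.card_eq_zero_iff.1 hI
      exact strong_of_isEmpty
    | succ n ih =>
      intro I _ J _ hI
      rcases n with _ | m
      · obtain ⟨e⟩ := Finite.card_eq.1 ((Nat.card_unique (α := Unit)).trans hI.symm)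
        have : Unique I := e.symm.unique
        exact (hone _).strong rfl
      · have hc : Nat.card (Σ i, PaB.pairIdx Unit (Fin (m + 1)) i) = Nat.card I := by
          rw [card_sigma_fin_two, hI]
          simp [PaB.pairIdx]; omega
        obtain ⟨e⟩ := Finite.card_eq.1 hc
        let K : Unit → Type := fun j => J (e ⟨0, j⟩)
        let K' : Fin (m + 1) → Type := fun j => J (e ⟨1, j⟩)
        have h0 : P.Strong (PaB.pairIdx Unit (Fin (m + 1))) :=
          (h1r (m + 1)).strong (Nat.card_unique (α := Unit)) (Nat.card_fin _)
        have h3 : P.Strong (joint K K') :=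
          h0.joint_left ((hone _).strong rfl) (ih K' (Nat.card_fin _)) ((hab _ _).strong rfl rfl)
        refine h3.congr' e fun p => ?_
        match p with
        | ⟨0, j⟩ => exact Equiv.refl _
        | ⟨1, j⟩ => exact Equiv.refl _
  intro A B
  have := A.finite
  have := fun i => (B i).finite
  exact key _ J rfl A B

end PreRepresents
end
end PaBOp

namespace PaBOp

universe u

/-! ### The induced strong 2-morphism -/

section
variable {D : Type*} [Category D] {X Y X' Y' Z Z' : D}

theorem iso_inv_square {a : X ≅ Y} {b : X' ≅ Y'} {f : X ⟶ X'} {g : Y ⟶ Y'}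
    (h : f ≫ b.hom = a.hom ≫ g) : g ≫ b.inv = a.inv ≫ f := by
  rw [Iso.comp_inv_eq, Category.assoc, h, Iso.inv_hom_id_assoc]

theorem iso_inv_pentagon {a : X ≅ Y} {b : Y ≅ Z} {t : X ⟶ X'} {c : X' ≅ Y'} {d : Y' ≅ Z}
    (h : a.hom ≫ b.hom = t ≫ c.hom ≫ d.hom) : b.inv ≫ a.inv ≫ t = d.inv ≫ c.inv := by
  have h' : a.inv ≫ t ≫ c.hom ≫ d.hom = b.hom := by rw [← h, Iso.inv_hom_id_assoc]
  rw [Iso.inv_comp_eq, ← h']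
  simp

theorem iso_inv_relabel {a : X ≅ Y} {f : Y ⟶ Y'} {s : Y' ⟶ Z'} {b : Z ≅ Z'} {t : X ⟶ Z}
    (h : t ≫ b.hom = a.hom ≫ f ≫ s) : a.inv ≫ t = f ≫ s ≫ b.inv := by
  rw [Iso.inv_comp_eq, ← Category.assoc f, ← Category.assoc, Iso.eq_comp_inv, h]

/-- Isomorphisms of families, componentwise. -/
def familyIso {ι : Type*} {M N : ι → D} (φ : ∀ i, M i ≅ N i) : M ≅ N where
  hom i := (φ i).hom
  inv i := (φ i).inv
  hom_inv_id := funext fun i => (φ i).hom_inv_id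
  inv_hom_id := funext fun i => (φ i).inv_hom_id

theorem iso_inv_empty {a : X ≅ Y} {t : Z ≅ X} {f : Y ⟶ Z} (h : t.hom ≫ a.hom ≫ f = 𝟙 _) :
    a.inv = f ≫ t.hom := by
  have h1 : f = a.inv ≫ t.inv := by
    rw [Iso.eq_inv_comp, ← cancel_epi t.hom, h, Iso.hom_inv_id]
  rw [h1, Category.assoc, Iso.inv_hom_id, Category.comp_id]

end

section
variable {C : Type u} [SmallCategory C] [Preadditive C] [Linear ℂ C]

namespace PreRepresents

variable {ρ : LaxAction C} {T : PreEndMorphism C} (P : PreRepresents ρ T)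

theorem card_puncture_self {I : Type} (p : I) : Nat.card (PaB.puncture p p) = 0 :=
  have : IsEmpty (PaB.puncture p p) := ⟨fun x => x.down rfl⟩
  Nat.card_of_isEmpty

theorem card_puncture_of_ne {I : Type} {p q : I} (h : q ≠ p) : Nat.card (PaB.puncture p q) = 1 :=
  have : Unique (PaB.puncture p q) := ⟨⟨⟨h⟩⟩, fun _ => rfl⟩
  Nat.card_unique

theorem finite_puncture {I : Type} (p q : I) : Finite (PaB.puncture p q) := (PaB.erase p q).finite

/-- The hypotheses on `μ` for standard trees imply that all `μ` are isomorphisms. -/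
theorem strong_of_std (h₃ : ∀ n : ℕ, IsIso (ρ.stdMap (n + 1)))
    (h₄ : ∀ (r : ℕ) (p : PaB.stdIdx r), 1 ≤ r → IsIso (ρ.μ (PaB.std r) (PaB.erase p)))
    {I : Type} (J : I → Type) : P.Strong J := by
  have h₅ : ∀ (r : ℕ) (p : PaB.stdIdx r), 1 ≤ r → P.Strong fun q => PaB.puncture p q :=
    fun r p hr => StrongAt.strong ((P.isIso_μ_iff _ _).1 (h₄ r p hr))
  have f3 : ∀ p q : PaB.stdIdx 3, Finite (PaB.puncture p q) := finite_puncture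
  have f1 : ∀ p q : Unit, Finite (PaB.puncture p q) := finite_puncture
  have f2 : ∀ p q : Fin 2, Finite (PaB.puncture p q) := finite_puncture
  refine P.strong_of_generators (fun n => ?_) ?_ ?_ ?_ ?_ J
  · have h1 := StrongAt.strong ((P.isIso_μ_iff _ _).1 (ρ.isIso_μ_two_unary_std h₃ n))
    have := PaB.finite_stdIdx (n + 2)
    exact Strong2.of h1 (Nat.card_unique (α := Unit)) (PaB.card_stdIdx (n + 2))
  · have := f3 ⟨1, (0 : Fin 2)⟩
    refine (h₅ 3 ⟨1, (0 : Fin 2)⟩ (by omega)).congr PaB.sigmaR fun q => ?_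
    match q with
    | ⟨0, ()⟩ =>
      refine (card_puncture_of_ne fun h => ?_).trans (Nat.card_fin 1).symm
      exact absurd (congrArg PaB.sigmaR h) (by decide)
    | ⟨1, (0 : Fin 2)⟩ => exact (card_puncture_self _).trans (Nat.card_fin 0).symm
    | ⟨1, (1 : Fin 2)⟩ =>
      refine (card_puncture_of_ne ?_).trans (Nat.card_fin 1).symm
      intro h
      exact absurd (congrArg PaB.sigmaR h) (by decide)
  · have := f3 ⟨0, ()⟩
    refine (h₅ 3 ⟨0, ()⟩ (by omega)).congr PaB.sigmaR fun q => ?_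
    match q with
    | ⟨0, _⟩ => exact (card_puncture_self _).trans (Nat.card_fin 0).symm
    | ⟨1, (0 : Fin 2)⟩ =>
      refine (card_puncture_of_ne fun h => ?_).trans (Nat.card_fin 1).symm
      exact absurd (congrArg PaB.sigmaR h) (by decide)
    | ⟨1, (1 : Fin 2)⟩ =>
      refine (card_puncture_of_ne fun h => ?_).trans (Nat.card_fin 1).symm
      exact absurd (congrArg PaB.sigmaR h) (by decide)
  · have := fun q => f1 () q
    exact Strong1.of (I := Unit) (J := fun q => PaB.puncture () q) (h₅ 1 () le_rfl)
      (card_puncture_self _)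
  · have := fun q => f2 0 q
    refine Strong2.of (J := fun q => PaB.puncture 0 q) (h₅ 2 (0 : Fin 2) (by omega))
      (card_puncture_self _)
      (card_puncture_of_ne (p := (0 : Fin 2)) (q := (1 : Fin 2)) (by decide))

variable {P} (hP : ∀ {I : Type} (J : I → Type), P.Strong J)

/-- The composition maps of the induced 2-morphism are inverse to `ν`. -/
noncomputable def νIso {I : Type} {J : I → Type} (A : PaB I) (B : ∀ i, PaB (J i))
    (M : (Σ i, J i) → C) : (T.V (A.comp B)).obj M ≅ (T.V A).obj (inner T B M) :=
  @asIso _ _ _ _ (P.νApp A B M) (hP J A B M)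

/-- The strong 2-morphism induced by a strong representative lax action: the functors `T(A)` with
the maps `μ = ν⁻¹`. -/
noncomputable def endMorphism : LaxEndMorphism C where
  toPreEndMorphism := T
  μ A B :=
    { app := fun M => (νIso hP A B M).inv
      naturality := fun M M' φ => iso_inv_square (a := νIso hP A B M) (b := νIso hP A B M')
        (P.νApp_naturality A B φ) }
  μ_natural {I J A A' B B'} f g := by
    ext M
    exact iso_inv_square (a := νIso hP A B M) (b := νIso hP A' B' M) (P.ν_natural f g M).symm
  μ_empty A B M := iso_inv_empty (a := νIso hP A B M) (P.ν_empty A B M)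
  μ_assoc A B D M := iso_inv_pentagon
    (a := νIso hP (A.comp B) (fun p => D p.1 p.2) (fun q => M (Equiv.sigmaAssoc _ q)))
    (b := νIso hP A B (fun p => (T.V (D p.1 p.2)).obj fun k => M ⟨p.1, p.2, k⟩))
    (c := νIso hP A (fun i => (B i).comp (D i)) M)
    (d := (T.V A).mapIso (familyIso fun i => νIso hP (B i) (D i) fun q => M ⟨i, q⟩))
    (P.ν_assoc A B D M)
  μ_relabel A B B' e h hB M := iso_inv_relabel
    (a := νIso hP A B (fun p => M (Equiv.sigmaCongr e h p)))
    (b := νIso hP ((PaB.relabel e).obj A) B' M)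
    (P.ν_relabel A B B' e h hB M)

theorem endMorphism_isStrong : (endMorphism hP).IsStrong := by
  intro I J A B
  have : ∀ M, IsIso (((endMorphism hP).μ A B).app M) := fun M => (νIso hP A B M).isIso_inv
  exact NatIso.isIso_of_isIso_app _

theorem action_isStrong (P : PreRepresents ρ T)
    (hP : ∀ {I : Type} (J : I → Type), P.Strong J) : ρ.IsStrong :=
  fun A B => (P.isIso_μ_iff A B).2 fun M => hP _ A B M

/-- The induced 2-morphism represents the lax action. -/
noncomputable def represents : Represents C ρ (endMorphism hP) where
  θ := P.θ
  θ_natural := P.θ_natural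
  θ_unit := P.θ_unit
  θ_relabel := P.θ_relabel
  θ_μ {I J} A B M L N f g k hk := by
    have hk' : k = P.νApp A B M ≫ (T.V A).map g ≫ f :=
      (Iso.inv_comp_eq (νIso hP A B M)).1 hk
    refine Eq.trans ?_ ((P.mul_map_map f g).trans ?_)
    · exact congrArg₂ (fun x y => ρ.mul A B N x y) (P.θ_apply f) (funext fun i => P.θ_apply (g i))
    · rw [← hk']
      exact (P.θ_apply k).symm

end PreRepresents
end
end PaBOp

namespace PaBOp

universe u

/-! ### Labelled parenthesized words -/

namespace PaB

variable {I J : Type}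

/-- The trivial braid between equal trees. -/
def homOfEq {A B : PaB I} (h : A = B) : A ⟶ B := Hom.mk 1 (one_mem _) fun j => by subst h; simp

@[simp] theorem homOfEq_braid {A B : PaB I} (h : A = B) : Hom.braid (homOfEq h) = 1 := rfl

@[simp] theorem relabel_map_braid {A B : PaB I} (e : I ≃ J) (f : A ⟶ B) :
    Hom.braid ((relabel e).map f) = Hom.braid f := rfl

end PaB

/-- A parenthesized word whose letters are labelled by objects of `C`: a set `I` of letters, a tree
`A` with these letters, and their labels `M`. -/
structure Word (C : Type u) where
  I : Type
  A : PaB I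
  M : I → C

namespace Word

variable {C : Type u} [SmallCategory C]

/-- A morphism of labelled words: a braid, which joins each letter `i` to the letter `e i`, together
with morphisms between the labels at the two ends of each strand. -/
structure Hom (v w : Word C) where
  e : v.I ≃ w.I
  hom : (PaB.relabel e).obj v.A ⟶ w.A
  φ : ∀ i, v.M i ⟶ w.M (e i)

/-- The braid of a morphism of labelled words. -/
abbrev Hom.braid {v w : Word C} (f : Hom v w) : BraidInf := PaB.Hom.braid f.hom

theorem Hom.ext' {v w : Word C} {f g : Hom v w} (h : ∀ i, f.e i = g.e i)
    (hb : f.braid = g.braid) (hφ : ∀ i, f.φ i ≫ eqToHom (congrArg w.M (h i)) = g.φ i) : f = g := by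
  obtain ⟨e, hom, φ⟩ := f
  obtain ⟨e', hom', φ'⟩ := g
  obtain rfl : e = e' := Equiv.ext h
  obtain rfl := PaB.hom_ext hb
  obtain rfl : φ = φ' := funext fun i => by simpa using hφ i
  rfl

instance : Category (Word C) where
  Hom := Hom
  id w := ⟨Equiv.refl _, PaB.homOfEq (PaB.relabel_refl _), fun _ => 𝟙 _⟩
  comp f g := ⟨f.e.trans g.e, PaB.homOfEq (PaB.relabel_relabel _ _ _).symm ≫
    (PaB.relabel g.e).map f.hom ≫ g.hom, fun i => f.φ i ≫ g.φ (f.e i)⟩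
  id_comp f := Hom.ext' (fun _ => rfl) (by simp [Hom.braid]) (fun i => by simp)
  comp_id f := Hom.ext' (fun _ => rfl) (by simp [Hom.braid]) (fun i => by simp)
  assoc f g h := Hom.ext' (fun _ => rfl) (by simp [Hom.braid]) (fun i => by simp)

variable {v w x : Word C}

theorem hom_ext {f g : v ⟶ w} (h : ∀ i, Hom.e f i = Hom.e g i)
    (hb : Hom.braid f = Hom.braid g)
    (hφ : ∀ i, Hom.φ f i ≫ eqToHom (congrArg w.M (h i)) = Hom.φ g i) : f = g := Hom.ext' h hb hφ

@[simp] theorem id_braid : Hom.braid (𝟙 w) = 1 := rfl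
@[simp] theorem comp_braid (f : v ⟶ w) (g : w ⟶ x) :
    Hom.braid (f ≫ g) = Hom.braid f * Hom.braid g := by
  change 1 * (_ * _) = _
  rw [one_mul]; rfl

end Word

/-- The diagram chase for `evMap_comp`. -/
theorem comp_paste {D : Type*} [Category D] {V V₁ V₂ V₃ V₄ V₅ V₆ X X₁ X₂ Y : D} {a : V ⟶ V₁}
    {p : V₁ ⟶ V₂} {q : V₂ ⟶ V₃} {a' : V₃ ⟶ V₄} {p' : V₄ ⟶ V₅} {q' : V₅ ⟶ V₆} {a'' : V ⟶ X}
    {b : V₁ ⟶ X} {b₂ : V₂ ⟶ X₁} {q₂ : X₁ ⟶ V₄} {p₂ : X ⟶ X₁} {p₃ : X₁ ⟶ X₂} {q₃ : X₂ ⟶ V₅}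
    {t₀ : X ⟶ X₂} {t : X ⟶ Y} {k : Y ⟶ V₆} (h₆ : a'' = a ≫ b) (h₂ : b ≫ p₂ = p ≫ b₂)
    (h₁ : b₂ ≫ q₂ = q ≫ a') (h₃ : q₂ ≫ p' = p₃ ≫ q₃) (h₄ : p₂ ≫ p₃ = t₀)
    (h₇ : t ≫ k = t₀ ≫ q₃ ≫ q') : a'' ≫ t ≫ k = (a ≫ p ≫ q) ≫ a' ≫ p' ≫ q' := by
  simp only [Category.assoc]
  rw [h₇, ← h₄, h₆, ← reassoc_of% h₁, reassoc_of% h₃, ← reassoc_of% h₂]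
  simp only [Category.assoc]

section
variable {C : Type u} [SmallCategory C] [Preadditive C] [Linear ℂ C]

namespace PreEndMorphism

variable (T : PreEndMorphism C) {I J K : Type}

theorem transport_braid {A A' : PaB I} (e : I ≃ J) (f : A ⟶ A') (M : J → C) :
    ((T.F I).map f).app (fun i => M (e i)) ≫ (T.transport (e := e) rfl M).hom =
      (T.transport (e := e) rfl M).hom ≫ ((T.F J).map ((PaB.relabel e).map f)).app M := by
  have h : (EndC.relabel e).map ((T.F I).map f) ≫ eqToHom (T.relabel_obj (e := e) rfl) =
      eqToHom (T.relabel_obj (e := e) rfl) ≫ (T.F J).map ((PaB.relabel e).map f) := by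
    have h := Functor.congr_hom (T.relabel_eq e) f
    dsimp only [Functor.comp_map] at h
    rw [h, eqToHom_trans_assoc, eqToHom_refl, Category.id_comp]
  exact congrArg (fun t => NatTrans.app t M) h

theorem transport_trans {A : PaB I} {B : PaB J} {D : PaB K} {e : I ≃ J} {e' : J ≃ K}
    (h : (PaB.relabel e).obj A = B) (h' : (PaB.relabel e').obj B = D)
    (h'' : (PaB.relabel (e.trans e')).obj A = D) (M : K → C) :
    (T.transport h fun j => M (e' j)).hom ≫ (T.transport h' M).hom = (T.transport h'' M).hom := by
  have h1 : (EndC.relabel e').map (eqToHom (T.relabel_obj h)) ≫ eqToHom (T.relabel_obj h') =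
      eqToHom (T.relabel_obj h'') := by
    rw [eqToHom_map]
    exact eqToHom_trans _ _
  exact congrArg (fun t => NatTrans.app t M) h1

theorem transport_eqToHom {A : PaB I} {B : PaB J} {e : I ≃ J} (h : (PaB.relabel e).obj A = B)
    (M : J → C) (f : (PaB.relabel e).obj A ⟶ B) (hf : PaB.Hom.braid f = 1) :
    (T.transport (e := e) rfl M).hom ≫ ((T.F J).map f).app M = (T.transport h M).hom := by
  subst h
  obtain rfl : f = 𝟙 _ := PaB.hom_ext hf
  simp

/-- The object of `C` that `T` assigns to a labelled word. -/
def ev (w : Word C) : C := (T.V w.A).obj w.M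

/-- The morphism of `C` that `T` assigns to a morphism of labelled words. -/
def evMap {v w : Word C} (f : v ⟶ w) : T.ev v ⟶ T.ev w :=
  (T.V v.A).map (Y := fun i => w.M (f.e i)) f.φ ≫ (T.transport (e := f.e) rfl w.M).hom ≫
    ((T.F w.I).map f.hom).app w.M

/-- For the trivial braid, `T(f)` is computed by the identification of equal trees. -/
theorem evMap_of_braid_one {v w : Word C} (f : v ⟶ w) (hf : f.braid = 1)
    (h : (PaB.relabel f.e).obj v.A = w.A) :
    T.evMap f = (T.V v.A).map (Y := fun i => w.M (f.e i)) f.φ ≫ (T.transport h w.M).hom :=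
  congrArg _ (T.transport_eqToHom h w.M f.hom hf)

theorem evMap_id (w : Word C) : T.evMap (𝟙 w) = 𝟙 _ := by
  rw [evMap_of_braid_one T (𝟙 w) rfl (PaB.relabel_refl _)]
  exact (Category.comp_id _).trans ((T.V w.A).map_id _)

theorem evMap_comp {v w x : Word C} (f : v ⟶ w) (g : w ⟶ x) :
    T.evMap (f ≫ g) = T.evMap f ≫ T.evMap g := by
  have h1 := ((T.F w.I).map f.hom).naturality (X := w.M) (Y := fun i => x.M (g.e i)) g.φ
  have h2 := T.transport_naturality (e := f.e) (A := v.A) rfl (M := w.M)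
    (N := fun i => x.M (g.e i)) g.φ
  have h3 := T.transport_braid g.e f.hom x.M
  have h4 := T.transport_trans (e := f.e) (e' := g.e) rfl rfl (PaB.relabel_relabel f.e g.e v.A).symm
    x.M
  have h5 := T.transport_eqToHom (e := f.e.trans g.e) (PaB.relabel_relabel f.e g.e v.A).symm
    x.M (PaB.homOfEq (PaB.relabel_relabel _ _ _).symm) rfl
  have h6 : (T.V v.A).map (X := v.M) (Y := fun i => x.M (g.e (f.e i)))
      (fun i => f.φ i ≫ g.φ (f.e i)) =
      (T.V v.A).map (Y := fun i => w.M (f.e i)) f.φ ≫ (T.V v.A).map (X := fun i => w.M (f.e i))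
        (Y := fun i => x.M (g.e (f.e i))) fun i => g.φ (f.e i) := (T.V v.A).map_comp _ _
  have h7 : (T.transport (e := f.e.trans g.e) rfl x.M).hom ≫
      ((T.F x.I).map (PaB.homOfEq (PaB.relabel_relabel f.e g.e v.A).symm ≫
        (PaB.relabel g.e).map f.hom ≫ g.hom)).app x.M =
      (T.transport (e := f.e.trans g.e) (PaB.relabel_relabel f.e g.e v.A).symm x.M).hom ≫
        ((T.F x.I).map ((PaB.relabel g.e).map f.hom)).app x.M ≫ ((T.F x.I).map g.hom).app x.M := by
    rw [Functor.map_comp, Functor.map_comp, NatTrans.comp_app, NatTrans.comp_app, reassoc_of% h5]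
  exact comp_paste h6 h2 h1 h3 h4 h7

end PreEndMorphism
end
end PaBOp

namespace PaBOp

universe u

/-! ### Substitution of labelled words -/

namespace PaB

variable {I : Type} {J J' : I → Type}

theorem relabel_comp_right (A : PaB I) (B : ∀ i, PaB (J i)) (B' : ∀ i, PaB (J' i))
    (h : ∀ i, J i ≃ J' i) (hB : ∀ i, (relabel (h i)).obj (B i) = B' i) :
    (relabel (Equiv.sigmaCongr (Equiv.refl I) h)).obj (A.comp B) = A.comp B' := by
  rw [relabel_comp A B B' (Equiv.refl I) h hB, relabel_refl]

/-- The sum of one copy of `J`. -/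
def sigmaOne (J : Type) : (Σ _ : Unit, J) ≃ J where
  toFun p := p.2
  invFun j := ⟨(), j⟩
  left_inv _ := rfl
  right_inv _ := rfl

theorem relabel_sigmaOne {J : Type} (A : PaB J) :
    (relabel (sigmaOne J)).obj (unary.comp fun _ => A) = A := by
  ext : 1
  change Tree.subst _ (Tree.subst _ A.tree) = _
  rw [Tree.subst_subst]
  exact congrArg PaB.tree (relabel_refl A)

end PaB

namespace Word

variable {C : Type u} [SmallCategory C] {I : Type}

/-- The word that arises from the tree `A` by replacing each letter `i` by the word `W i`. -/
def subst (A : PaB I) (W : I → Word C) : Word C :=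
  ⟨Σ i, (W i).I, A.comp fun i => (W i).A, fun p => (W p.1).M p.2⟩

/-- Substitution is functorial in the words. -/
def substMap (A : PaB I) {W W' : I → Word C} (g : ∀ i, W i ⟶ W' i) : subst A W ⟶ subst A W' :=
  Hom.mk (v := subst A W) (w := subst A W') (Equiv.sigmaCongr (Equiv.refl I) fun i => (g i).e)
    (PaB.homOfEq (PaB.relabel_comp_right A _ _ _ fun _ => rfl) ≫
      PaB.compMap (𝟙 A) fun i => (g i).hom) fun p => (g p.1).φ p.2

/-- Substitution is functorial in the tree. -/
def substTree {I' : Type} {A : PaB I} {A' : PaB I'} (e : I ≃ I') (f : (PaB.relabel e).obj A ⟶ A')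
    (W : I' → Word C) : subst A (fun i => W (e i)) ⟶ subst A' W :=
  Hom.mk (v := subst A fun i => W (e i)) (w := subst A' W)
    (Equiv.sigmaCongr e fun _ => Equiv.refl _)
    (PaB.homOfEq (PaB.relabel_comp A _ (fun i => (W i).A) e (fun _ => Equiv.refl _)
      fun _ => PaB.relabel_refl _) ≫ PaB.compMap f fun i => 𝟙 (W i).A)
    fun _ => 𝟙 _

/-- Substitution is associative. -/
def substAssoc {J : I → Type} (A : PaB I) (B : ∀ i, PaB (J i)) (W : ∀ i, J i → Word C) :
    subst (A.comp B) (fun p => W p.1 p.2) ⟶ subst A fun i => subst (B i) (W i) :=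
  Hom.mk (v := subst (A.comp B) fun p => W p.1 p.2) (w := subst A fun i => subst (B i) (W i))
    (Equiv.sigmaAssoc fun i j => (W i j).I)
    (PaB.homOfEq (PaB.comp_assoc A B fun i j => (W i j).A)) fun _ => 𝟙 _

/-- Substitution into the tree with one leaf. -/
def substUnary (w : Word C) : subst PaB.unary (fun _ => w) ⟶ w :=
  Hom.mk (v := subst PaB.unary fun _ => w) (PaB.sigmaOne w.I)
    (PaB.homOfEq (PaB.relabel_sigmaOne w.A)) fun _ => 𝟙 _

/-- Substitution into the empty tree. -/
def substEmpty [IsEmpty I] (A : PaB I) (M : I → C) (W : I → Word C) :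
    (⟨I, A, M⟩ : Word C) ⟶ subst A W :=
  Hom.mk (v := ⟨I, A, M⟩) (w := subst A W) (Equiv.equivOfIsEmpty I (Σ i, (W i).I))
    (PaB.homOfEq (PaB.relabel_empty_comp A _)) fun i => isEmptyElim i

end Word

section
variable {C : Type u} [SmallCategory C] [Preadditive C] [Linear ℂ C]

/-- The diagram chase for `LaxEndMorphism.sub_map`. -/
theorem sub_paste {D : Type*} [Category D] {X X₁ X₂ X₃ Y Y₁ Y₂ Y₃ Y₄ : D} {x : X ⟶ X₃}
    {a : X ⟶ X₁} {b : X₁ ⟶ X₂} {c : X₂ ⟶ X₃} {n : X ⟶ Y} {n₁ : X₁ ⟶ Y₁} {n₂ : X₂ ⟶ Y₂}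
    {n₃ : X₃ ⟶ Y₃} {a' : Y ⟶ Y₁} {b' : Y₁ ⟶ Y₂} {c' : Y₂ ⟶ Y₃} {p : Y₁ ⟶ Y₄} {q : Y₄ ⟶ Y₃}
    (h₅ : x = a ≫ b ≫ c) (h₁ : a ≫ n₁ = n ≫ a') (h₂ : n₁ ≫ b' = b ≫ n₂) (h₃ : c ≫ n₃ = n₂ ≫ c')
    (h₆ : p ≫ q = b' ≫ c') : x ≫ n₃ = n ≫ a' ≫ p ≫ q := by
  rw [h₅, h₆, ← reassoc_of% h₁, reassoc_of% h₂, ← h₃]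
  simp only [Category.assoc]

/-- The diagram chase for `LaxEndMorphism.sub_tree`. -/
theorem subTree_paste {D : Type*} [Category D] {X X₁ X₂ Y Y₁ Y₂ Y₃ : D} {a : Y ⟶ Y}
    {b : X ⟶ X₁} {c : X₁ ⟶ X₂} {n : X ⟶ Y} {n₁ : X₁ ⟶ Y₁} {n₂ : X₂ ⟶ Y₂}
    {b' : Y ⟶ Y₁} {c' : Y₁ ⟶ Y₂} {p : Y ⟶ Y₃} {q : Y₃ ⟶ Y₂}
    (h₁ : a = 𝟙 Y) (h₂ : n ≫ b' = b ≫ n₁) (h₃ : c ≫ n₂ = n₁ ≫ c')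
    (h₆ : p ≫ q = b' ≫ c') : n ≫ a ≫ p ≫ q = b ≫ c ≫ n₂ := by
  rw [h₆, h₁, Category.id_comp, reassoc_of% h₂, ← h₃]

theorem map_comp₃ {D E : Type*} [Category D] [Category E] {I : Type} (F : (I → D) ⥤ E)
    {X Y Z V : I → D} (f : ∀ i, X i ⟶ Y i) (g : ∀ i, Y i ⟶ Z i) (h : ∀ i, Z i ⟶ V i) :
    F.map (X := X) (Y := V) (fun i => f i ≫ g i ≫ h i) =
      F.map (X := X) (Y := Y) f ≫ F.map (X := Y) (Y := Z) g ≫ F.map (X := Z) (Y := V) h := by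
  rw [← F.map_comp, ← F.map_comp]; rfl

theorem PreEndMorphism.transport_homOfEq (T : PreEndMorphism C) {I J : Type} {A : PaB I}
    {B B' : PaB J} {e : I ≃ J} (h : (PaB.relabel e).obj A = B) (f : B ⟶ B') (M : J → C) :
    (T.transport (e := e) rfl M).hom ≫ ((T.F J).map (PaB.homOfEq h ≫ f)).app M =
      (T.transport h M).hom ≫ ((T.F J).map f).app M := by
  subst h
  rw [show PaB.homOfEq rfl ≫ f = f from PaB.hom_ext (one_mul _)]

namespace LaxEndMorphism

variable (T : LaxEndMorphism C) {I : Type} {J : I → Type}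

/-- The component of `μ` at `M`. -/
def μApp (A : PaB I) (B : ∀ i, PaB (J i)) (M : (Σ i, J i) → C) :
    (T.V A).obj (fun i => (T.V (B i)).obj fun j => M ⟨i, j⟩) ⟶ (T.V (A.comp B)).obj M :=
  (T.μ A B).app M

theorem μApp_naturality (A : PaB I) (B : ∀ i, PaB (J i)) {M M' : (Σ i, J i) → C} (φ : M ⟶ M') :
    (T.V A).map (X := fun i => (T.V (B i)).obj fun j => M ⟨i, j⟩)
        (Y := fun i => (T.V (B i)).obj fun j => M' ⟨i, j⟩)
        (fun i => (T.V (B i)).map fun j => φ ⟨i, j⟩) ≫ T.μApp A B M' =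
      T.μApp A B M ≫ (T.V (A.comp B)).map φ :=
  (T.μ A B).naturality φ

theorem μApp_natural {A A' : PaB I} {B B' : ∀ i, PaB (J i)} (f : A ⟶ A') (g : ∀ i, B i ⟶ B' i)
    (M : (Σ i, J i) → C) :
    (T.V A).map (X := fun i => (T.V (B i)).obj fun j => M ⟨i, j⟩)
        (Y := fun i => (T.V (B' i)).obj fun j => M ⟨i, j⟩)
        (fun i => ((T.F (J i)).map (g i)).app fun j => M ⟨i, j⟩) ≫
        ((T.F I).map f).app (fun i => (T.V (B' i)).obj fun j => M ⟨i, j⟩) ≫ T.μApp A' B' M =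
      T.μApp A B M ≫ ((T.F _).map (PaB.compMap f g)).app M :=
  (Category.assoc _ _ _).symm.trans (congrArg (fun t => NatTrans.app t M) (T.μ_natural f g))

/-- `μ` is equivariant. The relabelled trees are allowed to be equal to given ones only
propositionally, so that relabelling by an identity can be used. -/
theorem μApp_relabel {I' : Type} {J' : I' → Type} {A : PaB I} {A' : PaB I'} (B : ∀ i, PaB (J i))
    (B' : ∀ i, PaB (J' i)) (e : I ≃ I') (h : ∀ i, J i ≃ J' (e i)) (hA : (PaB.relabel e).obj A = A')
    (hB : ∀ i, (PaB.relabel (h i)).obj (B i) = B' (e i))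
    (h' : (PaB.relabel (Equiv.sigmaCongr e h)).obj (A.comp B) = A'.comp B') (M : (Σ i, J' i) → C) :
    T.μApp A B (fun p => M (Equiv.sigmaCongr e h p)) ≫ (T.transport h' M).hom =
      (T.V A).map (X := fun i => (T.V (B i)).obj fun j => M ⟨e i, h i j⟩)
        (Y := fun i => (T.V (B' (e i))).obj fun j => M ⟨e i, j⟩)
        (fun i => (T.transport (hB i) fun j => M ⟨e i, j⟩).hom) ≫
      (T.transport hA fun i => (T.V (B' i)).obj fun j => M ⟨i, j⟩).hom ≫ T.μApp A' B' M := by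
  subst hA
  exact T.μ_relabel A B B' e h hB M

variable {T}

theorem IsStrong.isIso_μApp (hT : T.IsStrong) (A : PaB I) (B : ∀ i, PaB (J i))
    (M : (Σ i, J i) → C) : IsIso (T.μApp A B M) := by
  have := hT A B
  exact inferInstanceAs (IsIso ((T.μ A B).app M))

variable (T) in
/-- The map `μ` for a substitution of words. -/
def sub (A : PaB I) (W : I → Word C) :
    (T.V A).obj (fun i => T.ev (W i)) ⟶ T.ev (Word.subst A W) :=
  T.μApp A (fun i => (W i).A) fun p => (W p.1).M p.2

theorem IsStrong.isIso_sub (hT : T.IsStrong) (A : PaB I) (W : I → Word C) : IsIso (T.sub A W) :=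
  hT.isIso_μApp _ _ _

variable (T)

/-- `μ` is natural with respect to morphisms of words. -/
theorem sub_map (A : PaB I) {W W' : I → Word C} (g : ∀ i, W i ⟶ W' i) :
    (T.V A).map (fun i => T.evMap (g i)) ≫ T.sub A W' =
      T.sub A W ≫ T.evMap (Word.substMap A g) := by
  have h0 : (PaB.relabel (Equiv.sigmaCongr (Equiv.refl I) fun i => (g i).e)).obj
      (A.comp fun i => (W i).A) = A.comp fun i => (PaB.relabel (g i).e).obj (W i).A :=
    PaB.relabel_comp_right A _ _ _ fun _ => rfl
  have h1 := T.μApp_naturality A (fun i => (W i).A) (M := fun p => (W p.1).M p.2)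
    (M' := fun p => (W' p.1).M ((g p.1).e p.2)) fun p => (g p.1).φ p.2
  have h2 := T.μApp_relabel (fun i => (W i).A) (fun i => (PaB.relabel (g i).e).obj (W i).A)
    (Equiv.refl I) (fun i => (g i).e) (PaB.relabel_refl A) (fun _ => rfl)
    h0 fun p : Σ i, (W' i).I => (W' p.1).M p.2
  have h3 := T.μApp_natural (𝟙 A) (fun i => (g i).hom) fun p : Σ i, (W' i).I => (W' p.1).M p.2
  rw [CategoryTheory.Functor.map_id] at h3
  have h5 : (T.V A).map (fun i => T.evMap (g i)) =
      (T.V A).map (X := fun i => T.ev (W i))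
          (Y := fun i => (T.V (W i).A).obj fun j => (W' i).M ((g i).e j))
          (fun i => (T.V (W i).A).map (g i).φ) ≫
        (T.V A).map (X := fun i => (T.V (W i).A).obj fun j => (W' i).M ((g i).e j))
          (Y := fun i => (T.V ((PaB.relabel (g i).e).obj (W i).A)).obj (W' i).M)
          (fun i => (T.transport (e := (g i).e) rfl (W' i).M).hom) ≫
        (T.V A).map (X := fun i => (T.V ((PaB.relabel (g i).e).obj (W i).A)).obj (W' i).M)
          (Y := fun i => T.ev (W' i)) (fun i => ((T.F _).map (g i).hom).app (W' i).M) := by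
    exact map_comp₃ (T.V A) (X := fun i => T.ev (W i))
      (Y := fun i => (T.V (W i).A).obj fun j => (W' i).M ((g i).e j))
      (Z := fun i => (T.V ((PaB.relabel (g i).e).obj (W i).A)).obj (W' i).M)
      (V := fun i => T.ev (W' i)) _ _ _
  have h6 := T.transport_homOfEq h0 (PaB.compMap (𝟙 A) fun i => (g i).hom)
    fun p : Σ i, (W' i).I => (W' p.1).M p.2
  exact sub_paste h5 h1 ((h2.trans (congrArg (fun t => _ ≫ t) (Category.id_comp _))))
    ((congrArg (fun t => _ ≫ t) (Category.id_comp _)).symm.trans h3) h6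

/-- `μ` is natural with respect to morphisms of the tree in which words are substituted. -/
theorem sub_tree {I' : Type} {A : PaB I} {A' : PaB I'} (e : I ≃ I')
    (f : (PaB.relabel e).obj A ⟶ A') (W : I' → Word C) :
    T.sub A (fun i => W (e i)) ≫ T.evMap (Word.substTree e f W) =
      (T.transport (e := e) rfl fun i => T.ev (W i)).hom ≫
        ((T.F I').map f).app (fun i => T.ev (W i)) ≫ T.sub A' W := by
  have h2 := T.μApp_relabel (A := A) (fun i => (W (e i)).A) (fun i => (W i).A)
    e (fun _ => Equiv.refl _) rfl (fun _ => PaB.relabel_refl _)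
    (PaB.relabel_comp A _ _ e _ fun _ => PaB.relabel_refl _) fun p : Σ i, (W i).I => (W p.1).M p.2
  have h2' : (T.V A).map (X := fun i => T.ev (W (e i))) (Y := fun i => T.ev (W (e i)))
      (fun i => (T.transport (PaB.relabel_refl (W (e i)).A) (W (e i)).M).hom) = 𝟙 _ :=
    (T.V A).map_id _
  have h3 := T.μApp_natural f (fun i => 𝟙 (W i).A) fun p : Σ i, (W i).I => (W p.1).M p.2
  have h3' : (T.V ((PaB.relabel e).obj A)).map (X := fun i => T.ev (W i))
      (Y := fun i => T.ev (W i)) (fun i => ((T.F _).map (𝟙 (W i).A)).app (W i).M) = 𝟙 _ := by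
    exact (congrArg (T.V ((PaB.relabel e).obj A)).map (funext fun i =>
      congrArg (fun t => NatTrans.app t (W i).M) ((T.F _).map_id _))).trans ((T.V _).map_id _)
  have h6 : (T.transport (e := Equiv.sigmaCongr e fun _ => Equiv.refl _) rfl
      fun p : Σ i, (W i).I => (W p.1).M p.2).hom ≫
        ((T.F _).map (Word.substTree e f W).hom).app (fun p : Σ i, (W i).I => (W p.1).M p.2) =
      (T.transport (PaB.relabel_comp A (fun i => (W (e i)).A) _ e _ fun _ => PaB.relabel_refl _)
        fun p : Σ i, (W i).I => (W p.1).M p.2).hom ≫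
        ((T.F _).map (PaB.compMap f fun i => 𝟙 (W i).A)).app
          fun p : Σ i, (W i).I => (W p.1).M p.2 := by
    exact T.transport_homOfEq _ _ _
  have h7 : (T.V (Word.subst A fun i => W (e i)).A).map (Word.substTree e f W).φ = 𝟙 _ :=
    (T.V _).map_id _
  exact subTree_paste h7 ((h2.trans (congrArg (fun t => t ≫ _) h2')).trans (Category.id_comp _))
    ((Category.id_comp _).symm.trans ((congrArg (fun t => t ≫ _) h3').symm.trans h3)) h6

/-- The associativity of `μ` becomes the associativity of substitution. -/
theorem sub_assoc (A : PaB I) (B : ∀ i, PaB (J i)) (W : ∀ i, J i → Word C) :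
    (T.V A).map (X := fun i => (T.V (B i)).obj fun j => T.ev (W i j))
        (Y := fun i => T.ev (Word.subst (B i) (W i))) (fun i => T.sub (B i) (W i)) ≫
        T.sub A (fun i => Word.subst (B i) (W i)) =
      T.μApp A B (fun p => T.ev (W p.1 p.2)) ≫ T.sub (A.comp B) (fun p => W p.1 p.2) ≫
        T.evMap (Word.substAssoc A B W) := by
  rw [T.evMap_of_braid_one (Word.substAssoc A B W) rfl (PaB.comp_assoc A B fun i j => (W i j).A)]
  have h := T.μ_assoc A B (fun i j => (W i j).A) fun q => (W q.1 q.2.1).M q.2.2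
  refine h.symm.trans ?_
  have h1 : (T.V (Word.subst (A.comp B) fun p => W p.1 p.2).A).map
    (Word.substAssoc A B W).φ = 𝟙 _ := (T.V _).map_id _
  exact congrArg (fun t => _ ≫ _ ≫ t)
    (((congrArg (fun t => t ≫ _) h1).trans (Category.id_comp _)).symm)

theorem sub_empty [IsEmpty I] (A : PaB I) (W : I → Word C) :
    T.sub A W = T.evMap (Word.substEmpty A (fun i => T.ev (W i)) W) := by
  rw [T.evMap_of_braid_one (Word.substEmpty A (fun i => T.ev (W i)) W) rfl
    (PaB.relabel_empty_comp A fun i => (W i).A)]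
  exact T.μ_empty A _ _

end LaxEndMorphism
end
end PaBOp

namespace PaBOp

universe u

/-! ### Normalization -/

namespace BraidInf

theorem shift_zero (β : BraidInf) : shift 0 β = β := by
  have : shift 0 = MonoidHom.id BraidInf := by
    apply PresentedGroup.ext
    intro i
    change shift 0 (gen i) = gen i
    rw [shift_gen, Nat.zero_add]
  exact DFunLike.congr_fun this β

theorem blocks_one {I : Type} (w : I → ℕ) (o : ℕ) (l : List I) :
    blocks (fun _ => 1) w o l = 1 := by
  induction l generalizing o with
  | nil => rfl
  | cons i l ih => rw [blocks, ih, map_one, mul_one]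

end BraidInf

namespace Word

variable {C : Type u} [SmallCategory C] {I : Type}

/-- The number of letters. -/
noncomputable def length (w : Word C) : ℕ := w.A.leaves.length

theorem substMap_braid (A : PaB I) {W W' : I → Word C} (g : ∀ i, W i ⟶ W' i) :
    Hom.braid (substMap A g) =
      BraidInf.blocks (fun i => Hom.braid (g i)) (fun i => (W i).length) 0 A.leaves := by
  change 1 * (BraidInf.cable 1 _ * _) = _
  rw [BraidInf.cable_one, one_mul, one_mul]
  congr 1
  funext i
  exact (congrArg List.length (PaB.relabel_obj_leaves _ _)).trans (List.length_map _)

theorem substTree_braid {I' : Type} {A : PaB I} {A' : PaB I'} (e : I ≃ I')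
    (f : (PaB.relabel e).obj A ⟶ A') (W : I' → Word C) :
    Hom.braid (substTree e f W) = BraidInf.cable (PaB.Hom.braid f)
      (BraidInf.width (fun i => (W i).length) (A.leaves.map e)) := by
  change 1 * (BraidInf.cable _ _ * BraidInf.blocks (fun _ => 1) _ _ _) = _
  rw [BraidInf.blocks_one, one_mul, mul_one, PaB.relabel_obj_leaves]
  rfl

@[simp] theorem substAssoc_braid {J : I → Type} (A : PaB I) (B : ∀ i, PaB (J i))
    (W : ∀ i, J i → Word C) : Hom.braid (substAssoc A B W) = 1 := rfl

@[simp] theorem substUnary_braid (w : Word C) : Hom.braid (substUnary w) = 1 := rfl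

theorem substUnary_naturality {v w : Word C} (f : v ⟶ w) :
    substMap PaB.unary (fun _ => f) ≫ substUnary w = substUnary v ≫ f := by
  refine hom_ext (fun p => rfl) ?_ fun p => ?_
  · rw [comp_braid, comp_braid, substMap_braid]
    simp [BraidInf.blocks, BraidInf.shift_zero]
  · exact (Category.comp_id _).trans ((Category.comp_id _).trans (Category.id_comp _).symm)

end Word

section
variable {C : Type u} [SmallCategory C] [Preadditive C] [Linear ℂ C]

/-- The diagram chase for `IsNormalized.unitMap_eq`. -/
theorem normalized_paste {D : Type*} [Category D] {X X₁ X₂ X₃ X₄ X₅ X₆ X₇ Y : D} {t : X ⟶ X₁}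
    {n : X₁ ⟶ X₂} {a : X₂ ⟶ X₃} {b : X₃ ⟶ Y} {d' : X₁ ⟶ X₃} (hd : d' = n ≫ a)
    {m : X ⟶ X₄} {n' : X₄ ⟶ X₅} {c : X₅ ⟶ X₂} (h₁ : t ≫ n = m ≫ n' ≫ c) {c' : X₅ ⟶ X₆}
    {b' : X₆ ⟶ Y} (h₃ : c ≫ a ≫ b = c' ≫ b') {r : X₄ ⟶ X₇} {n₇ : X₇ ⟶ X₆}
    (h₂ : n' ≫ c' = r ≫ n₇) {u : X ⟶ X₇} (h₇ : m ≫ r = u) : t ≫ d' ≫ b = u ≫ n₇ ≫ b' := by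
  rw [hd, Category.assoc, reassoc_of% h₁, h₃, reassoc_of% h₂, ← h₇]
  simp only [Category.assoc]

namespace LaxEndMorphism

variable (T : LaxEndMorphism C) {I : Type} {J : I → Type}

theorem isIso_evMap {v w : Word C} (f : v ⟶ w) (h : ∀ i, IsIso (f.φ i)) : IsIso (T.evMap f) := by
  have h1 : IsIso ((T.V v.A).map (Y := fun i => w.M (f.e i)) f.φ) :=
    isIso_map_of _ _ (isIso_family h)
  have h2 := PaB.isIso_hom f.hom
  have h3 := isIso_map_of (T.F w.I) f.hom h2
  exact isIso_comp_of _ _ h1 (isIso_comp_of _ _ (Iso.isIso_hom _) (NatIso.isIso_app_of_isIso _ _))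

/-- The map `T(1)(T(w)) ⟶ T(w)` induced by `μ`. -/
def unitMap (w : Word C) : (T.V PaB.unary).obj (fun _ => T.ev w) ⟶ T.ev w :=
  T.sub PaB.unary (fun _ => w) ≫ T.evMap (Word.substUnary w)

theorem unitMap_naturality {v w : Word C} (f : v ⟶ w) :
    (T.V PaB.unary).map (fun _ => T.evMap f) ≫ T.unitMap w = T.unitMap v ≫ T.evMap f := by
  rw [unitMap, unitMap, reassoc_of% T.sub_map PaB.unary fun _ => f, ← T.evMap_comp,
    Word.substUnary_naturality, T.evMap_comp, Category.assoc]

/-- A word with one letter. -/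
def _root_.PaBOp.Word.single (X : C) : Word C := ⟨Unit, PaB.unary, fun _ => X⟩

theorem sub_tree_of_eq {I' : Type} {A : PaB I} {A' : PaB I'} {e : I ≃ I'}
    (h : (PaB.relabel e).obj A = A') (W : I' → Word C) :
    T.sub A (fun i => W (e i)) ≫ T.evMap (Word.substTree e (PaB.homOfEq h) W) =
      (T.transport h fun i => T.ev (W i)).hom ≫ T.sub A' W := by
  rw [T.sub_tree, ← Category.assoc, T.transport_eqToHom h _ _ rfl]

variable {T}

theorem IsStrong.isIso_unitMap (hT : T.IsStrong) (w : Word C) : IsIso (T.unitMap w) :=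
  isIso_comp_of _ _ (hT.isIso_sub _ _) (T.isIso_evMap _ fun _ => inferInstanceAs (IsIso (𝟙 _)))

/-- If `T` is normalized, then `μ` is canonical for the grafting of a word at the tree `1`. -/
theorem IsNormalized.unitMap_eq (hN : T.IsNormalized) (hT : T.IsStrong) (w : Word C) :
    T.unitMap w = (T.unitIso fun _ => T.ev w).hom := by
  have h1 := T.sub_assoc PaB.unary (fun _ => PaB.unary) fun _ _ => w
  have h2 := T.sub_tree_of_eq PaB.relabel_sigmaUnit fun _ => w
  have h3 : Word.substAssoc PaB.unary (fun _ => PaB.unary) (fun _ _ => w) ≫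
      Word.substUnary (Word.subst PaB.unary fun _ => w) ≫ Word.substUnary w =
      Word.substTree PaB.sigmaUnit (PaB.homOfEq PaB.relabel_sigmaUnit) (fun _ => w) ≫
        Word.substUnary w := by
    refine Word.hom_ext (fun p => rfl) ?_ fun p => ?_
    · simp [Word.substTree_braid]
    · change (𝟙 (w.M p.2) ≫ 𝟙 (w.M p.2) ≫ 𝟙 (w.M p.2)) ≫ 𝟙 (w.M p.2) = 𝟙 (w.M p.2) ≫ 𝟙 (w.M p.2)
      simp
  -- Associativity for `1 ∘ (1 ∘ w)`; by normalization, `μ_{1; 1}` is canonical.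
  have h4 : (T.V PaB.unary).map (fun _ => T.unitMap w) ≫ T.unitMap w =
      (T.V PaB.unary).map (fun _ => (T.unitIso fun _ => T.ev w).hom) ≫ T.unitMap w := by
    have h5 : (T.V PaB.unary).map (fun _ => T.unitMap w) =
        (T.V PaB.unary).map (X := fun _ => (T.V PaB.unary).obj fun _ => T.ev w)
            (Y := fun _ => T.ev (Word.subst PaB.unary fun _ => w))
            (fun _ => T.sub PaB.unary fun _ => w) ≫
          (T.V PaB.unary).map fun _ => T.evMap (Word.substUnary w) :=
      (T.V PaB.unary).map_comp (X := fun _ => (T.V PaB.unary).obj fun _ => T.ev w)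
        (Y := fun _ => T.ev (Word.subst PaB.unary fun _ => w)) (Z := fun _ => T.ev w)
        (fun _ => T.sub PaB.unary fun _ => w) fun _ => T.evMap (Word.substUnary w)
    have h6 := congrArg T.evMap h3
    rw [T.evMap_comp, T.evMap_comp, T.evMap_comp] at h6
    have h7 : T.μApp PaB.unary (fun _ => PaB.unary) (fun _ => T.ev w) ≫
        (T.transport PaB.relabel_sigmaUnit fun _ => T.ev w).hom =
        (T.V PaB.unary).map fun _ => (T.unitIso fun _ => T.ev w).hom := hN fun _ => T.ev w
    rw [h5, Category.assoc, T.unitMap_naturality]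
    exact normalized_paste rfl h1 h6 h2 h7
  have := hT.isIso_unitMap w
  -- Hence `T(1)` takes `unitMap w` and the canonical map to the same morphism, and `T(1)` is
  -- faithful.
  have h5 := (cancel_mono _).1 h4
  have h6 := T.unitIso_naturality (M := fun _ => (T.V PaB.unary).obj fun _ => T.ev w)
    (N := fun _ => T.ev w) fun _ => T.unitMap w
  have h7 := T.unitIso_naturality (M := fun _ => (T.V PaB.unary).obj fun _ => T.ev w)
    (N := fun _ => T.ev w) fun _ => (T.unitIso fun _ => T.ev w).hom
  rw [h5, h7] at h6
  exact ((cancel_epi _).1 h6).symm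

end LaxEndMorphism
end
end PaBOp

namespace PaBOp

universe u

/-! ### Twisting by the centre -/

section
variable {D : Type*} [Category D] {X X₁ X₂ X₃ X₄ X₅ : D}

theorem twist_paste₁ {t : X ⟶ X₁} {k' : X₁ ⟶ X₁} {k : X ⟶ X} {m' : X₁ ⟶ X₂} {m : X ⟶ X₃}
    {s : X₃ ⟶ X₂} (h₁ : t ≫ k' = k ≫ t) (h₂ : t ≫ m' = m ≫ s) : t ≫ k' ≫ m' = (k ≫ m) ≫ s := by
  rw [reassoc_of% h₁, h₂, Category.assoc]

theorem twist_paste₂ {t : X ⟶ X₁} {f : X₁ ⟶ X₂} {k : X ⟶ X} {k₁ : X₁ ⟶ X₁} {k₂ : X₂ ⟶ X₂}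
    {m' : X₂ ⟶ X₃} {m : X ⟶ X₄} {s : X₄ ⟶ X₃} (h₁ : t ≫ k₁ = k ≫ t) (h₂ : k₁ ≫ f = f ≫ k₂)
    (h₃ : t ≫ f ≫ m' = m ≫ s) : (t ≫ f) ≫ k₂ ≫ m' = (k ≫ m) ≫ s := by
  rw [Category.assoc, ← reassoc_of% h₂, reassoc_of% h₁, h₃, Category.assoc]

theorem twist_paste₃ {k : X ⟶ X} {m : X ⟶ X₁} {k₁ : X₁ ⟶ X₁} {m₁ : X₁ ⟶ X₂} {r : X₂ ⟶ X₃}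
    {x : X ⟶ X₄} {k₂ : X₄ ⟶ X₄} {m₂ : X₄ ⟶ X₃} {k₃ : X ⟶ X} {y : X ⟶ X₄} (h₁ : x ≫ k₂ = k ≫ x)
    (h₂ : x = k₃ ≫ y) (h₃ : k₃ ≫ m = m ≫ k₁) (h₄ : m ≫ m₁ ≫ r = y ≫ m₂) :
    (k ≫ m) ≫ (k₁ ≫ m₁) ≫ r = x ≫ k₂ ≫ m₂ := by
  rw [reassoc_of% h₁, h₂]
  simp only [Category.assoc]
  rw [← h₄, reassoc_of% h₃]

theorem unitEnd_paste {Y Y₁ Y₂ : D} {f : X ⟶ Y} {f₁ : X₁ ⟶ Y₁} {f₂ : X₂ ⟶ Y₂}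
    {a : X ⟶ X₁} {b : X₁ ⟶ X₂} {m : X₂ ⟶ X₁} {d : X₁ ⟶ X} {a' : Y ⟶ Y₁} {b' : Y₁ ⟶ Y₂}
    {m' : Y₂ ⟶ Y₁} {d' : Y₁ ⟶ Y} (h₁ : f ≫ a' = a ≫ f₁) (h₂ : f₁ ≫ b' = b ≫ f₂)
    (h₃ : f₂ ≫ m' = m ≫ f₁) (h₄ : f₁ ≫ d' = d ≫ f) :
    f ≫ a' ≫ b' ≫ m' ≫ d' = (a ≫ b ≫ m ≫ d) ≫ f := by
  simp only [Category.assoc]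
  rw [reassoc_of% h₁, reassoc_of% h₂, reassoc_of% h₃, h₄]

theorem mul_paste {t : X ⟶ X₁} {m' : X₁ ⟶ X₂} {r' : X₂ ⟶ X₃} {m : X ⟶ X₄} {s : X₄ ⟶ X₂}
    {r : X₄ ⟶ X₅} {s' : X₅ ⟶ X₃} (h₁ : t ≫ m' = m ≫ s) (h₂ : s ≫ r' = r ≫ s') :
    t ≫ m' ≫ r' = (m ≫ r) ≫ s' := by
  rw [reassoc_of% h₁, h₂, Category.assoc]

theorem normalized_paste' {k : X₂ ⟶ X₂} {u' : X₂ ≅ X₁} {u : X₁ ≅ X} {c' : X₁ ⟶ X₁}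
    {c z : X ⟶ X} {m : X₂ ⟶ X₁} (h₁ : k ≫ u'.hom = u'.hom ≫ c') (h₂ : u.hom ≫ c = c' ≫ u.hom)
    (h₃ : c ≫ z = 𝟙 X) (hz : z = u.inv ≫ u'.inv ≫ m ≫ u.hom) : k ≫ m = u'.hom := by
  have h₄ : m = u'.hom ≫ u.hom ≫ z ≫ u.inv := by simp [hz]
  rw [h₄, reassoc_of% h₁, ← reassoc_of% h₂, reassoc_of% h₃]
  simp

end

theorem center_naturality {D : Type*} [Category D] (c : 𝟭 D ⟶ 𝟭 D) {X Y : D} (f : X ⟶ Y) :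
    f ≫ c.app Y = c.app X ≫ f :=
  c.naturality f

theorem map_comp_family {D E : Type*} [Category D] [Category E] {I : Type} (F : (I → D) ⥤ E)
    {X Y Z : I → D} (f : ∀ i, X i ⟶ Y i) (g : ∀ i, Y i ⟶ Z i) :
    F.map (X := X) (Y := Y) f ≫ F.map (X := Y) (Y := Z) g =
      F.map (X := X) (Y := Z) fun i => f i ≫ g i :=
  (F.map_comp _ _).symm

section
variable {C : Type u} [SmallCategory C] [Preadditive C] [Linear ℂ C]

namespace LaxEndMorphism

variable (T : LaxEndMorphism C) {I : Type} {J : I → Type}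

/-- The map `μ` twisted by an endomorphism of the identity functor. -/
def twistApp (c : 𝟭 C ⟶ 𝟭 C) (A : PaB I) (B : ∀ i, PaB (J i)) (M : (Σ i, J i) → C) :
    (T.V A).obj (fun i => (T.V (B i)).obj fun j => M ⟨i, j⟩) ⟶ (T.V (A.comp B)).obj M :=
  (T.V A).map (X := fun i => (T.V (B i)).obj fun j => M ⟨i, j⟩)
    (Y := fun i => (T.V (B i)).obj fun j => M ⟨i, j⟩) (fun _ => c.app _) ≫ T.μApp A B M

/-- The image of a family of morphisms under `T(A)` commutes with the image of the components of
`c`. -/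
theorem map_center (c : 𝟭 C ⟶ 𝟭 C) (A : PaB I) {N N' : I → C} (φ : ∀ i, N i ⟶ N' i) :
    (T.V A).map (X := N) (Y := N') φ ≫ (T.V A).map (X := N') (Y := N') (fun i => c.app (N' i)) =
      (T.V A).map (X := N) (Y := N) (fun i => c.app (N i)) ≫ (T.V A).map (X := N) (Y := N') φ := by
  rw [map_comp_family, map_comp_family]
  exact congrArg (T.V A).map (funext fun i => center_naturality c (φ i))

/-- The 2-morphism `T`, with each `μ_{A; B}` precomposed with `c` at every letter of `A`. Since `c`
is central, all laws are preserved: both sides of associativity acquire one factor `c` for each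
letter of `A` and one for each letter of the trees `B`. -/
def twist (c : 𝟭 C ⟶ 𝟭 C) : LaxEndMorphism C where
  toPreEndMorphism := T.toPreEndMorphism
  μ {I J} A B :=
    { app := fun M => T.twistApp c A B M
      naturality := fun M M' φ => by
        have h1 := T.map_center c A fun i => (T.V (B i)).map (X := fun j => M ⟨i, j⟩)
          (Y := fun j => M' ⟨i, j⟩) fun j => φ ⟨i, j⟩
        have h2 := T.μApp_naturality A B φ
        exact twist_paste₁ h1 h2 }
  μ_natural {I J A A' B B'} f g := by
    ext M
    have h1 := T.map_center c A fun i => ((T.F (J i)).map (g i)).app fun j => M ⟨i, j⟩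
    have h2 := T.μApp_natural f g M
    have h3 := ((T.F I).map f).naturality (X := fun i => (T.V (B' i)).obj fun j => M ⟨i, j⟩)
      (Y := fun i => (T.V (B' i)).obj fun j => M ⟨i, j⟩) fun i => c.app _
    exact twist_paste₂ h1 h3 h2
  μ_empty {I _ J} A B M := by
    have h1 : (T.V A).map (X := fun i => (T.V (B i)).obj fun j => M ⟨i, j⟩)
        (Y := fun i => (T.V (B i)).obj fun j => M ⟨i, j⟩) (fun i => c.app _) = 𝟙 _ :=
      (congrArg (T.V A).map (funext fun i => isEmptyElim i)).trans ((T.V A).map_id _)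
    exact (congrArg (fun t => t ≫ T.μApp A B M) h1).trans
      ((Category.id_comp _).trans (T.μ_empty A B M))
  μ_assoc A B D M := by
    have h1 := T.map_center c A fun i => T.twistApp c (B i) (D i) fun q => M ⟨i, q⟩
    have h2 := map_comp_family (T.V A)
      (X := fun i => (T.V (B i)).obj fun j => (T.V (D i j)).obj fun k => M ⟨i, j, k⟩)
      (Y := fun i => (T.V (B i)).obj fun j => (T.V (D i j)).obj fun k => M ⟨i, j, k⟩)
      (Z := fun i => (T.V ((B i).comp (D i))).obj fun q => M ⟨i, q⟩)
      (fun i => (T.V (B i)).map fun j => c.app _)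
      (fun i => T.μApp (B i) (D i) fun q => M ⟨i, q⟩)
    have h3 := T.μApp_naturality A B
      (M := fun p => (T.V (D p.1 p.2)).obj fun k => M ⟨p.1, p.2, k⟩)
      (M' := fun p => (T.V (D p.1 p.2)).obj fun k => M ⟨p.1, p.2, k⟩) fun p => c.app _
    exact twist_paste₃ h1 h2.symm h3 (T.μ_assoc A B D M)
  μ_relabel {I I' J J'} A B B' e h hB M := by
    have h1 := T.map_center c A (N := fun i => (T.V (B i)).obj fun j => M ⟨e i, h i j⟩)
      (N' := fun i => (T.V (B' (e i))).obj fun j => M ⟨e i, j⟩)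
      fun i => (T.transport (hB i) fun j => M ⟨e i, j⟩).hom
    have h2 := T.transport_naturality (e := e) (A := A) rfl
      (M := fun i => (T.V (B' i)).obj fun j => M ⟨i, j⟩)
      (N := fun i => (T.V (B' i)).obj fun j => M ⟨i, j⟩) fun i => c.app _
    exact (twist_paste₂ h1 h2 ((T.μ_relabel A B B' e h hB M).symm)).symm.trans
      (Category.assoc _ _ _)

theorem twist_isStrong {T : LaxEndMorphism C} (hT : T.IsStrong) (c : 𝟭 C ⟶ 𝟭 C)
    (hc : ∀ X, IsIso (c.app X)) : (T.twist c).IsStrong := by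
  intro I J A B
  have : ∀ M, IsIso (((T.twist c).μ A B).app M) := fun M =>
    isIso_comp_of _ _ (isIso_map_of _ _ (isIso_family fun i => hc _)) (hT.isIso_μApp A B M)
  exact NatIso.isIso_of_isIso_app _

/-- The map `T(1)(T(1)(X)) ⟶ T(1)(X)` induced by `μ`. -/
def unitMul (X : C) : (T.V PaB.unary).obj (fun _ => (T.V PaB.unary).obj fun _ => X) ⟶
    (T.V PaB.unary).obj fun _ => X :=
  T.μApp PaB.unary (fun _ => PaB.unary) (fun _ => X) ≫
    (T.transport PaB.relabel_sigmaUnit fun _ => X).hom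

theorem unitMul_naturality {X Y : C} (f : X ⟶ Y) :
    (T.V PaB.unary).map (X := fun _ => (T.V PaB.unary).obj fun _ => X)
        (Y := fun _ => (T.V PaB.unary).obj fun _ => Y)
        (fun _ => (T.V PaB.unary).map (X := fun _ => X) (Y := fun _ => Y) fun _ => f) ≫
        T.unitMul Y =
      T.unitMul X ≫ (T.V PaB.unary).map (X := fun _ => X) (Y := fun _ => Y) fun _ => f := by
  have h1 := T.μApp_naturality PaB.unary (fun _ => PaB.unary) (M := fun _ => X) (M' := fun _ => Y)
    fun _ => f
  have h2 := T.transport_naturality PaB.relabel_sigmaUnit (M := fun _ => X) (N := fun _ => Y)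
    fun _ => f
  exact (mul_paste h1 h2)

theorem map_unitIso (X : C) :
    (T.V PaB.unary).map (X := fun _ => (T.V PaB.unary).obj fun _ => X) (Y := fun _ => X)
      (fun _ => (T.unitIso fun _ => X).hom) =
      (T.unitIso fun _ => (T.V PaB.unary).obj fun _ => X).hom :=
  (cancel_mono _).1 (T.unitIso_naturality (M := fun _ => (T.V PaB.unary).obj fun _ => X)
    (N := fun _ => X) fun _ => (T.unitIso fun _ => X).hom)

/-- The map `μ_{1; 1}`, under the identification of `T(1)` with the identity functor. -/
def unitEnd : 𝟭 C ⟶ 𝟭 C where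
  app X := (T.unitIso fun _ => X).inv ≫ (T.unitIso fun _ => (T.V PaB.unary).obj fun _ => X).inv ≫
    T.unitMul X ≫ (T.unitIso fun _ => X).hom
  naturality X Y f := by
    have h1 := iso_inv_square (T.unitIso_naturality (M := fun _ => X) (N := fun _ => Y) fun _ => f)
    have h2 := iso_inv_square (T.unitIso_naturality
      (M := fun _ => (T.V PaB.unary).obj fun _ => X) (N := fun _ => (T.V PaB.unary).obj fun _ => Y)
      fun _ => (T.V PaB.unary).map (X := fun _ => X) (Y := fun _ => Y) fun _ => f)
    have h3 := T.unitMul_naturality f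
    have h4 := T.unitIso_naturality (M := fun _ => X) (N := fun _ => Y) fun _ => f
    exact unitEnd_paste h1 h2 h3 h4

theorem isIso_unitEnd {T : LaxEndMorphism C} (hT : T.IsStrong) (X : C) :
    IsIso (T.unitEnd.app X) := by
  have := hT.isIso_μApp PaB.unary (fun _ => PaB.unary) fun _ => X
  dsimp only [unitEnd, unitMul]
  infer_instance

/-- The twist by an inverse of `μ_{1; 1}` is normalized. -/
theorem twist_isNormalized {T : LaxEndMorphism C} {c : 𝟭 C ⟶ 𝟭 C}
    (hc : ∀ X, c.app X ≫ T.unitEnd.app X = 𝟙 X) : (T.twist c).IsNormalized := by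
  intro M
  have h1 := T.unitIso_naturality (M := fun _ => (T.V PaB.unary).obj fun _ => M ())
    (N := fun _ => (T.V PaB.unary).obj fun _ => M ()) fun _ => c.app _
  have h2 := center_naturality c (T.unitIso fun _ => M ()).hom
  refine Eq.trans ?_ (T.map_unitIso (M ())).symm
  exact (Category.assoc _ _ _).trans (normalized_paste' h1 h2 (hc (M ())) rfl)

/-- A strong 2-morphism becomes normalized after a change of its maps `μ` only. -/
theorem exists_normalized (hT : T.IsStrong) : ∃ T' : LaxEndMorphism C,
    T'.toPreEndMorphism = T.toPreEndMorphism ∧ T'.IsStrong ∧ T'.IsNormalized := by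
  have := isIso_unitEnd hT
  have : IsIso T.unitEnd := NatIso.isIso_of_isIso_app _
  refine ⟨T.twist (inv T.unitEnd), rfl, twist_isStrong hT _ fun X => inferInstance,
    twist_isNormalized fun X => ?_⟩
  rw [← NatTrans.comp_app, IsIso.inv_hom_id]
  rfl

end LaxEndMorphism
end
end PaBOp

namespace PaBOp

universe u

/-! ### The tensor product -/

section
variable {D : Type*}

/-- The family with the two members `a` and `b`. -/
def cons (a b : D) : Fin 2 → D
  | 0 => a
  | 1 => b

variable [Category D]

/-- The family with the two members `f` and `g`. -/
def consHom {a b a' b' : D} (f : a ⟶ a') (g : b ⟶ b') : ∀ i, cons a b i ⟶ cons a' b' i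
  | 0 => f
  | 1 => g

theorem consHom_id (a b : D) : consHom (𝟙 a) (𝟙 b) = fun i => 𝟙 (cons a b i) := by
  funext i
  match i with
  | 0 => rfl
  | 1 => rfl

theorem consHom_comp {a b a' b' a'' b'' : D} (f : a ⟶ a') (g : b ⟶ b') (f' : a' ⟶ a'')
    (g' : b' ⟶ b'') : (fun i => consHom f g i ≫ consHom f' g' i) = consHom (f ≫ f') (g ≫ g') := by
  funext i
  match i with
  | 0 => rfl
  | 1 => rfl

/-- A family indexed by `{0, 1}` is determined by its two members. The identification is a morphism
rather than an equality because it does not hold definitionally for a variable index. -/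
def consSelf (N : Fin 2 → D) : ∀ i, cons (N 0) (N 1) i ⟶ N i
  | 0 => 𝟙 _
  | 1 => 𝟙 _

theorem consSelf_naturality {N N' : Fin 2 → D} (f : ∀ i, N i ⟶ N' i) :
    (fun i => consHom (f 0) (f 1) i ≫ consSelf N' i) = fun i => consSelf N i ≫ f i := by
  funext i
  match i with
  | 0 => exact (Category.comp_id _).trans (Category.id_comp _).symm
  | 1 => exact (Category.comp_id _).trans (Category.id_comp _).symm

theorem isIso_consSelf (N : Fin 2 → D) : ∀ i, IsIso (consSelf N i)
  | 0 => inferInstanceAs (IsIso (𝟙 _))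
  | 1 => inferInstanceAs (IsIso (𝟙 _))

end

section
variable {C : Type u} [SmallCategory C]

/-- Concatenation of words. -/
def Word.mul (v w : Word C) : Word C := Word.subst PaB.two (cons v w)

/-- Concatenation is functorial. -/
def Word.mulMap {v w v' w' : Word C} (f : v ⟶ v') (g : w ⟶ w') : v.mul w ⟶ v'.mul w' :=
  Word.substMap PaB.two (consHom f g)

end

section
variable {D : Type*} [Category D]

theorem braid_paste {X X₁ X₂ X₃ Y Y₁ Z : D} {k : X ⟶ Y} {s' : Y ⟶ Y₁} {s : X ⟶ X₁} {k' : X₁ ⟶ Y₁}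
    {t : X₂ ≅ X₁} {k'' : X₂ ⟶ Z} {t' : Z ⟶ Y₁} {τ : X₃ ≅ X₂} {a : X₃ ⟶ X₃} {τ' : X₃ ⟶ Z}
    (h₁ : k ≫ s' = s ≫ k') (h₂ : k'' ≫ t' = t.hom ≫ k') (h₃ : a ≫ τ' = τ.hom ≫ k'')
    (h₄ : a = 𝟙 _) : (s ≫ t.inv ≫ τ.inv) ≫ τ' ≫ t' = k ≫ s' := by
  subst h₄
  rw [Category.id_comp] at h₃
  simp [h₁, h₂, h₃]

theorem braid_paste' {X X₁ X₂ X₃ Y Y₁ Y₂ Y₃ : D} {k : X ⟶ Y} {k₁ : X₁ ⟶ Y₁} {k₂ : X₂ ⟶ Y₂}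
    {k₃ : X₃ ⟶ Y₃} {s : X ⟶ X₁} {t : X₁ ⟶ X₂} {r : X₂ ⟶ X₃} {s' : Y ⟶ Y₁} {t' : Y₁ ⟶ Y₂}
    {r' : Y₂ ⟶ Y₃} (h₁ : k ≫ s' = s ≫ k₁) (h₂ : k₁ ≫ t' = t ≫ k₂) (h₃ : k₂ ≫ r' = r ≫ k₃) :
    k ≫ s' ≫ t' ≫ r' = (s ≫ t ≫ r) ≫ k₃ := by
  simp only [Category.assoc]
  rw [reassoc_of% h₁, reassoc_of% h₂, h₃]

end

section
variable {C : Type u} [SmallCategory C] [Preadditive C] [Linear ℂ C]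

namespace LaxEndMorphism

variable (T : LaxEndMorphism C)

/-- The tensor product `T(12)(X, Y)`. -/
def ten (X Y : C) : C := (T.V PaB.two).obj (cons X Y)

/-- The tensor product of morphisms. -/
def tenHom {X Y X' Y' : C} (f : X ⟶ X') (g : Y ⟶ Y') : T.ten X Y ⟶ T.ten X' Y' :=
  (T.V PaB.two).map (X := cons X Y) (Y := cons X' Y') (consHom f g)

theorem tenHom_id (X Y : C) : T.tenHom (𝟙 X) (𝟙 Y) = 𝟙 _ :=
  (congrArg (T.V PaB.two).map (consHom_id X Y)).trans ((T.V PaB.two).map_id _)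

theorem tenHom_comp {X Y X' Y' X'' Y'' : C} (f : X ⟶ X') (g : Y ⟶ Y') (f' : X' ⟶ X'')
    (g' : Y' ⟶ Y'') : T.tenHom f g ≫ T.tenHom f' g' = T.tenHom (f ≫ f') (g ≫ g') :=
  (map_comp_family _ _ _).trans (congrArg (T.V PaB.two).map (consHom_comp f g f' g'))

/-- The tensor product of isomorphisms. -/
def tenIso {X Y X' Y' : C} (f : X ≅ X') (g : Y ≅ Y') : T.ten X Y ≅ T.ten X' Y' where
  hom := T.tenHom f.hom g.hom
  inv := T.tenHom f.inv g.inv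
  hom_inv_id := by rw [tenHom_comp, f.hom_inv_id, g.hom_inv_id, tenHom_id]
  inv_hom_id := by rw [tenHom_comp, f.inv_hom_id, g.inv_hom_id, tenHom_id]

/-- The value of `T(12)` at a family indexed by `{0, 1}` is the tensor product of its two members.
-/
noncomputable def τ (N : Fin 2 → C) : T.ten (N 0) (N 1) ≅ (T.V PaB.two).obj N :=
  (T.V PaB.two).mapIso (familyIso fun i => @asIso _ _ _ _ (consSelf N i) (isIso_consSelf N i))

theorem τ_hom (N : Fin 2 → C) : (T.τ N).hom = (T.V PaB.two).map (consSelf N) := rfl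

theorem τ_naturality {N N' : Fin 2 → C} (f : ∀ i, N i ⟶ N' i) :
    T.tenHom (f 0) (f 1) ≫ (T.τ N').hom = (T.τ N).hom ≫ (T.V PaB.two).map (X := N) (Y := N') f := by
  rw [τ_hom, τ_hom]
  exact (map_comp_family (T.V PaB.two) _ _).trans ((congrArg (T.V PaB.two).map
    (consSelf_naturality f)).trans (map_comp_family (T.V PaB.two) _ _).symm)

/-- The map `μ` as a morphism from the tensor product of two words to their concatenation. -/
noncomputable def m (v w : Word C) : T.ten (T.ev v) (T.ev w) ⟶ T.ev (v.mul w) :=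
  (T.τ fun i => T.ev (cons v w i)).hom ≫ T.sub PaB.two (cons v w)

variable {T} in
theorem IsStrong.isIso_m (hT : T.IsStrong) (v w : Word C) : IsIso (T.m v w) :=
  isIso_comp_of _ _ (Iso.isIso_hom _) (hT.isIso_sub _ _)

theorem m_naturality {v w v' w' : Word C} (f : v ⟶ v') (g : w ⟶ w') :
    T.tenHom (T.evMap f) (T.evMap g) ≫ T.m v' w' = T.m v w ≫ T.evMap (Word.mulMap f g) := by
  have h1 := T.τ_naturality (N := fun i => T.ev (cons v w i)) (N' := fun i => T.ev (cons v' w' i))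
    fun i => T.evMap (consHom f g i)
  have h2 := T.sub_map PaB.two (consHom f g)
  exact mul_paste h1 h2

/-- The braiding `T(σ)`. -/
noncomputable def braid (X Y : C) : T.ten X Y ⟶ T.ten Y X :=
  ((T.F (Fin 2)).map PaB.σ).app (cons X Y) ≫
    (T.transport (e := Equiv.swap 0 1) rfl (cons X Y)).inv ≫
      (T.τ fun i => cons X Y (Equiv.swap 0 1 i)).inv

/-- The braiding is `T(σ)` on every family indexed by `{0, 1}`. -/
theorem braid_spec (N : Fin 2 → C) :
    T.braid (N 0) (N 1) ≫ (T.τ fun i => N (Equiv.swap 0 1 i)).hom ≫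
        (T.transport (e := Equiv.swap 0 1) rfl N).hom =
      (T.τ N).hom ≫ ((T.F (Fin 2)).map PaB.σ).app N := by
  have h1 := ((T.F (Fin 2)).map PaB.σ).naturality (X := cons (N 0) (N 1)) (Y := N) (consSelf N)
  have h2 := T.transport_naturality (e := Equiv.swap 0 1) (A := PaB.two) rfl (M := cons (N 0) (N 1))
    (N := N) (consSelf N)
  have h3 := T.τ_naturality (N := fun i => cons (N 0) (N 1) (Equiv.swap 0 1 i))
    (N' := fun i => N (Equiv.swap 0 1 i)) fun i => consSelf N (Equiv.swap 0 1 i)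
  have h4 : T.tenHom (consSelf N (Equiv.swap 0 1 0)) (consSelf N (Equiv.swap 0 1 1)) = 𝟙 _ :=
    T.tenHom_id _ _
  exact braid_paste h1 h2 h3 h4

theorem braid_naturality {X Y X' Y' : C} (f : X ⟶ X') (g : Y ⟶ Y') :
    T.tenHom f g ≫ T.braid X' Y' = T.braid X Y ≫ T.tenHom g f := by
  have h1 := ((T.F (Fin 2)).map PaB.σ).naturality (X := cons X Y) (Y := cons X' Y') (consHom f g)
  have h2 := T.transport_naturality (e := Equiv.swap 0 1) (A := PaB.two) rfl (M := cons X Y)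
    (N := cons X' Y') (consHom f g)
  have h3 := T.τ_naturality (N := fun i => cons X Y (Equiv.swap 0 1 i))
    (N' := fun i => cons X' Y' (Equiv.swap 0 1 i)) fun i => consHom f g (Equiv.swap 0 1 i)
  exact braid_paste' h1 (iso_inv_square h2) (iso_inv_square h3)

end LaxEndMorphism
end
end PaBOp

namespace PaBOp

universe u

/-! ### The braiding on words -/

theorem BraidInf.getElem?_cross {X : Type} (l l' : List X) (j : ℕ) :
    (l ++ l')[perm (cross 0 l.length l'.length) j]? = (l' ++ l)[j]? := by
  rw [perm_cross]
  split_ifs with h h'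
  · rw [List.getElem?_append_right (by omega), List.getElem?_append_left (by omega)]
    congr 1; omega
  · rw [List.getElem?_append_left (by omega), List.getElem?_append_right (by omega)]
  · rw [List.getElem?_eq_none, List.getElem?_eq_none] <;> simp <;> omega

namespace Word

variable {C : Type u} [SmallCategory C] {I : Type}

omit [SmallCategory C] in
theorem leaves_mul (v w : Word C) :
    (v.mul w).A.leaves = v.A.leaves.map (Sigma.mk (β := fun i => (cons v w i).I) 0) ++
      w.A.leaves.map (Sigma.mk (β := fun i => (cons v w i).I) 1) := by
  refine (PaB.leaves_comp _ _).trans ?_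
  rw [PaB.leaves_two, List.flatMap_cons, List.flatMap_cons, List.flatMap_nil, List.append_nil]
  rfl

omit [SmallCategory C] in
@[simp] theorem length_mul (v w : Word C) : (v.mul w).length = v.length + w.length :=
  (congrArg List.length (leaves_mul v w)).trans (List.length_append.trans
    (congrArg₂ (· + ·) (List.length_map _) (List.length_map _)))

theorem substMap_two_braid {v w : Fin 2 → Word C} (g : ∀ i, v i ⟶ w i) :
    Hom.braid (substMap PaB.two g) =
      Hom.braid (g 0) * BraidInf.shift (v 0).length (Hom.braid (g 1)) := by
  rw [substMap_braid]
  simp [BraidInf.blocks, BraidInf.shift_zero]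

@[simp] theorem mulMap_braid {v w v' w' : Word C} (f : v ⟶ v') (g : w ⟶ w') :
    Hom.braid (mulMap f g) = Hom.braid f * BraidInf.shift v.length (Hom.braid g) :=
  substMap_two_braid _

/-- Exchange of the two words of a concatenation. -/
def swapEquiv (v w : Word C) : (v.mul w).I ≃ (w.mul v).I where
  toFun p := match p with
    | ⟨0, x⟩ => ⟨1, x⟩
    | ⟨1, x⟩ => ⟨0, x⟩
  invFun p := match p with
    | ⟨0, x⟩ => ⟨1, x⟩
    | ⟨1, x⟩ => ⟨0, x⟩
  left_inv p := match p with
    | ⟨0, _⟩ => rfl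
    | ⟨1, _⟩ => rfl
  right_inv p := match p with
    | ⟨0, _⟩ => rfl
    | ⟨1, _⟩ => rfl

/-- The braiding of words: the letters of the first word cross those of the second one. -/
noncomputable def crossHom (v w : Word C) : v.mul w ⟶ w.mul v :=
  Hom.mk (v := v.mul w) (w := w.mul v) (swapEquiv v w)
    { braid := BraidInf.cross 0 v.length w.length
      mem := by
        have h : ((PaB.relabel (swapEquiv v w)).obj (v.mul w).A).leaves.length =
            0 + v.length + w.length := by
          rw [PaB.relabel_obj_leaves, List.length_map, Nat.zero_add]
          exact length_mul v w
        rw [h]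
        exact BraidInf.cross_mem _ _ _
      perm_leaves := fun j => by
        have h := BraidInf.getElem?_cross
          (v.A.leaves.map (Sigma.mk (β := fun i => (cons w v i).I) 1))
          (w.A.leaves.map (Sigma.mk (β := fun i => (cons w v i).I) 0)) j
        have h1 : ((PaB.relabel (swapEquiv v w)).obj (v.mul w).A).leaves =
            v.A.leaves.map (Sigma.mk (β := fun i => (cons w v i).I) 1) ++
              w.A.leaves.map (Sigma.mk (β := fun i => (cons w v i).I) 0) :=
          (PaB.relabel_obj_leaves _ _).trans ((congrArg (List.map _) (leaves_mul v w)).trans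
            (List.map_append.trans (congrArg₂ (· ++ ·) List.map_map List.map_map)))
        have h2 : BraidInf.cross 0
            (v.A.leaves.map (Sigma.mk (β := fun i => (cons w v i).I) 1)).length
            (w.A.leaves.map (Sigma.mk (β := fun i => (cons w v i).I) 0)).length =
            BraidInf.cross 0 v.length w.length :=
          congrArg₂ (BraidInf.cross 0) (List.length_map _) (List.length_map _)
        have h := (congrArg (fun b => (_ : List _)[BraidInf.perm b j]?) h2.symm).trans h
        exact (congrArg (fun l => l[_]?) h1).trans
          (h.trans (congrArg (fun l => l[j]?) (leaves_mul w v).symm)) }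
    fun p => match p with
      | ⟨0, _⟩ => 𝟙 _
      | ⟨1, _⟩ => 𝟙 _

@[simp] theorem crossHom_braid (v w : Word C) :
    Hom.braid (crossHom v w) = BraidInf.cross 0 v.length w.length := rfl

/-- The family `cons w v` is the family `cons v w` in the opposite order. -/
def consSwap {D : Type*} [Category D] (v w : D) : ∀ i, cons w v i ⟶ cons v w (Equiv.swap 0 1 i)
  | 0 => 𝟙 _
  | 1 => 𝟙 _

/-- The braiding of words is the substitution of words in `σ`. -/
theorem crossHom_comp (v w : Word C) :
    crossHom v w ≫ substMap PaB.two (consSwap v w) ≫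
        substTree (A := PaB.two) (A' := PaB.twoOp) (Equiv.swap 0 1) (𝟙 _) (cons v w) =
      substTree (A := PaB.two) (A' := PaB.twoOp) (Equiv.refl _) PaB.σ (cons v w) := by
  refine hom_ext (fun p => ?_) ?_ fun p => ?_
  · match p with
    | ⟨0, x⟩ => rfl
    | ⟨1, x⟩ => rfl
  · refine (comp_braid _ _).trans ?_
    refine (congrArg (_ * ·) (comp_braid _ _)).trans ?_
    have h : Hom.braid (substMap PaB.two (consSwap v w)) = 1 := by
      rw [substMap_two_braid]
      change 1 * BraidInf.shift _ 1 = _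
      rw [map_one, mul_one]
    have h₁ : Hom.braid (substTree (A := PaB.two) (A' := PaB.twoOp) (Equiv.swap 0 1) (𝟙 _)
        (cons v w)) = 1 := (substTree_braid _ _ _).trans (BraidInf.cable_one _)
    have h₂ : Hom.braid (substTree (A := PaB.two) (A' := PaB.twoOp) (Equiv.refl _) PaB.σ
        (cons v w)) = BraidInf.cross 0 v.length w.length :=
      (substTree_braid _ _ _).trans (BraidInf.cable_gen 0 _)
    exact (congrArg (_ * ·) ((congrArg₂ (· * ·) h h₁).trans (one_mul 1))).trans
      ((mul_one _).trans h₂.symm)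
  · match p with
    | ⟨0, x⟩ =>
      change (𝟙 (v.M x) ≫ 𝟙 (v.M x) ≫ 𝟙 (v.M x)) ≫ 𝟙 (v.M x) = 𝟙 (v.M x)
      simp
    | ⟨1, x⟩ =>
      change (𝟙 (w.M x) ≫ 𝟙 (w.M x) ≫ 𝟙 (w.M x)) ≫ 𝟙 (w.M x) = 𝟙 (w.M x)
      simp

end Word

section
variable {D : Type*} [Category D]

/-- The diagram chase for `LaxEndMorphism.braid_ev`. -/
theorem braid_ev_paste {X X₁ X₂ X₃ X₄ Y₁ Y₂ Y₃ Y₄ Y₅ : D} {b : X ⟶ X₁} {r' : X₁ ⟶ X₂} {t : X₂ ⟶ X₃}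
    {r : X ⟶ X₄} {s : X₄ ⟶ X₃} {q : X₁ ⟶ Y₁} {k : Y₁ ⟶ X₂} {n₁ : X₂ ⟶ Y₂} {n' : Y₁ ⟶ Y₃}
    {a : Y₃ ⟶ Y₂} {c : Y₂ ⟶ Y₄} {n₂ : X₃ ⟶ Y₄} {n : X₄ ⟶ Y₅} {d : Y₅ ⟶ Y₄} {x : Y₅ ⟶ Y₃}
    (h₁ : b ≫ r' ≫ t = r ≫ s) (h₂ : q ≫ k = r') (h₃ : k ≫ n₁ = n' ≫ a) (h₄ : n₁ ≫ c = t ≫ n₂)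
    (h₅ : n ≫ d = s ≫ n₂) (h₆ : x ≫ a ≫ c = d) (ha : IsIso a) (hc : IsIso c) :
    b ≫ q ≫ n' = (r ≫ n) ≫ x := by
  rw [← cancel_mono a, ← cancel_mono c]
  simp only [Category.assoc]
  rw [h₆, h₅, ← reassoc_of% h₁, ← h₂]
  simp only [Category.assoc]
  rw [← h₄, reassoc_of% h₃]

end

section
variable {C : Type u} [SmallCategory C] [Preadditive C] [Linear ℂ C]

namespace LaxEndMorphism

variable (T : LaxEndMorphism C)

theorem evMap_comp₃ {v w x y : Word C} (f : v ⟶ w) (g : w ⟶ x) (h : x ⟶ y) :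
    T.evMap f ≫ T.evMap g ≫ T.evMap h = T.evMap (f ≫ g ≫ h) := by
  rw [T.evMap_comp, T.evMap_comp]

/-- The braiding corresponds to the braiding of words. -/
theorem braid_ev (v w : Word C) :
    T.braid (T.ev v) (T.ev w) ≫ T.m w v = T.m v w ≫ T.evMap (Word.crossHom v w) := by
  have h1 := T.braid_spec fun i => T.ev (cons v w i)
  have h2 := T.sub_tree (A := PaB.two) (A' := PaB.twoOp) (Equiv.swap 0 1) (𝟙 _) (cons v w)
  have h3 := T.sub_tree (A := PaB.two) (A' := PaB.twoOp) (Equiv.refl _) PaB.σ (cons v w)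
  have h4 := T.sub_map PaB.two (Word.consSwap v w)
  have h5 := (T.evMap_comp₃ _ _ _).trans (congrArg T.evMap (Word.crossHom_comp v w))
  have h6 := T.τ_naturality (N := fun i => T.ev (cons w v i))
    (N' := fun i => T.ev (cons v w (Equiv.swap 0 1 i))) fun i => T.evMap (Word.consSwap v w i)
  have h7 : T.tenHom (T.evMap (Word.consSwap v w 0)) (T.evMap (Word.consSwap v w 1)) = 𝟙 _ := by
    have h : ∀ x : Word C, T.evMap (𝟙 x) = 𝟙 (T.ev x) := T.evMap_id
    exact (congrArg₂ (fun f g => T.tenHom f g) (h w) (h v)).trans (T.tenHom_id _ _)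
  have h8 : IsIso (T.evMap (Word.substMap PaB.two (Word.consSwap v w))) := by
    refine T.isIso_evMap _ fun p => ?_
    match p with
    | ⟨0, x⟩ => exact inferInstanceAs (IsIso (𝟙 (w.M x)))
    | ⟨1, x⟩ => exact inferInstanceAs (IsIso (𝟙 (v.M x)))
  have h9 : IsIso (T.evMap (Word.substTree (A := PaB.two) (A' := PaB.twoOp) (Equiv.swap 0 1) (𝟙 _)
      (cons v w))) := T.isIso_evMap _ fun p => inferInstanceAs (IsIso (𝟙 _))
  have h10 : (((T.F (Fin 2)).map (𝟙 ((PaB.relabel (Equiv.swap 0 1)).obj PaB.two))).app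
      fun i => T.ev (cons v w i)) = 𝟙 _ := by
    rw [CategoryTheory.Functor.map_id]; rfl
  exact braid_ev_paste h1
    (h6.symm.trans ((congrArg (fun t => t ≫ _) h7).trans (Category.id_comp _)))
    h4 (h2.trans (congrArg (fun t => _ ≫ t) ((congrArg (fun t => t ≫ _) h10).trans
      (Category.id_comp _)))) (h3.trans (Category.id_comp _)) h5 h8 h9

end LaxEndMorphism
end
end PaBOp

namespace PaBOp

universe u

/-! ### Grafting two trees at the letters of `12` -/

section
variable {D : Type*} [Category D]

/-- The diagram chase for `LaxEndMorphism.graft_sub`. -/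
theorem graft_paste {X X₁ X₂ X₃ X₄ Y Y₁ Y₂ Y₃ Y₄ Z : D} {τ : X ⟶ X₁} {μ : X₁ ⟶ X₂} {t : X₂ ⟶ X₃}
    {s : X₃ ⟶ X₄} {q : X₄ ⟶ Z} {s₂ : X₂ ⟶ Y} {d : Y ⟶ X₄} (h₁ : s₂ ≫ d = t ≫ s)
    {n : X₁ ⟶ Y₁} {s₁ : Y₁ ⟶ Y₂} {a : Y ⟶ Y₂} (h₂ : n ≫ s₁ = μ ≫ s₂ ≫ a)
    {g : Y₂ ⟶ Y₃} {p : Y₃ ⟶ Z} (h₃ : a ≫ g ≫ p = d ≫ q) {g' : Y₁ ⟶ Y₄} {s₃ : Y₄ ⟶ Y₃}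
    (h₄ : g' ≫ s₃ = s₁ ≫ g) {x : X₁ ⟶ Y₄} (h₅ : x = n ≫ g') {V : D} {x' : X ⟶ V} {τ' : V ⟶ Y₄}
    (h₆ : x' ≫ τ' = τ ≫ x) :
    (τ ≫ μ ≫ t) ≫ s ≫ q = x' ≫ (τ' ≫ s₃) ≫ p := by
  simp only [Category.assoc]
  rw [← reassoc_of% h₁, ← h₃, ← reassoc_of% h₂, ← reassoc_of% h₄, reassoc_of% h₆, h₅]
  simp only [Category.assoc]

theorem graft_natural_paste {X X₁ X₂ X₃ Y Y₁ Y₂ Y₃ : D} {f : X ⟶ Y} {f₁ : X₁ ⟶ Y₁} {f₂ : X₂ ⟶ Y₂}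
    {f₃ : X₃ ⟶ Y₃} {a : X ⟶ X₁} {b : X₁ ⟶ X₂} {c : X₂ ⟶ X₃} {a' : Y ⟶ Y₁} {b' : Y₁ ⟶ Y₂}
    {c' : Y₂ ⟶ Y₃} (h₁ : f ≫ a' = a ≫ f₁) (h₂ : f₁ ≫ b' = b ≫ f₂) (h₃ : f₂ ≫ c' = c ≫ f₃) :
    f ≫ a' ≫ b' ≫ c' = (a ≫ b ≫ c) ≫ f₃ := by
  simp only [Category.assoc]
  rw [reassoc_of% h₁, reassoc_of% h₂, h₃]

end

section
variable {C : Type u} [SmallCategory C] [Preadditive C] [Linear ℂ C]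

namespace LaxEndMorphism

variable (T : LaxEndMorphism C) {a b K : Type}

/-- The map `μ` for the tree `D` that arises by grafting `A` and `B` at the letters of `12`. -/
noncomputable def graft (A : PaB a) (B : PaB b) (e : (Σ i, PaB.pairIdx a b i) ≃ K) {D : PaB K}
    (h : (PaB.relabel e).obj (PaB.two.comp (PaB.pair A B)) = D) (X : K → C) :
    T.ten ((T.V A).obj fun j => X (e ⟨0, j⟩)) ((T.V B).obj fun j => X (e ⟨1, j⟩)) ⟶
      (T.V D).obj X :=
  (T.τ fun i => (T.V (PaB.pair A B i)).obj fun j => X (e ⟨i, j⟩)).hom ≫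
    T.μApp PaB.two (PaB.pair A B) (fun p => X (e p)) ≫ (T.transport h X).hom

variable {T} in
theorem IsStrong.isIso_graft (hT : T.IsStrong) (A : PaB a) (B : PaB b)
    (e : (Σ i, PaB.pairIdx a b i) ≃ K) {D : PaB K}
    (h : (PaB.relabel e).obj (PaB.two.comp (PaB.pair A B)) = D) (X : K → C) :
    IsIso (T.graft A B e h X) :=
  isIso_comp_of _ _ (Iso.isIso_hom _)
    (isIso_comp_of _ _ (hT.isIso_μApp _ _ _) (Iso.isIso_hom _))

theorem graft_naturality (A : PaB a) (B : PaB b) (e : (Σ i, PaB.pairIdx a b i) ≃ K) {D : PaB K}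
    (h : (PaB.relabel e).obj (PaB.two.comp (PaB.pair A B)) = D) {X Y : K → C} (f : ∀ k, X k ⟶ Y k) :
    T.tenHom
        ((T.V A).map (X := fun j => X (e ⟨0, j⟩)) (Y := fun j => Y (e ⟨0, j⟩))
          fun j => f (e ⟨0, j⟩))
        ((T.V B).map (X := fun j => X (e ⟨1, j⟩)) (Y := fun j => Y (e ⟨1, j⟩))
          fun j => f (e ⟨1, j⟩)) ≫
      T.graft A B e h Y = T.graft A B e h X ≫ (T.V D).map (X := X) (Y := Y) f := by
  have h1 := T.τ_naturality (N := fun i => (T.V (PaB.pair A B i)).obj fun j => X (e ⟨i, j⟩))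
    (N' := fun i => (T.V (PaB.pair A B i)).obj fun j => Y (e ⟨i, j⟩))
    fun i => (T.V (PaB.pair A B i)).map (X := fun j => X (e ⟨i, j⟩)) (Y := fun j => Y (e ⟨i, j⟩))
      fun j => f (e ⟨i, j⟩)
  have h2 := T.μApp_naturality PaB.two (PaB.pair A B) (M := fun p => X (e p))
    (M' := fun p => Y (e p)) fun p => f (e p)
  have h3 := T.transport_naturality h (M := X) (N := Y) f
  exact graft_natural_paste h1 h2 h3

/-- If words are substituted in a tree obtained by grafting at `12`, then `μ` can be computed in two
steps; the morphisms of words `g`, `p`, `q` bring the iterated substitution into a given form. -/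
theorem graft_sub (A : PaB a) (B : PaB b) (e : (Σ i, PaB.pairIdx a b i) ≃ K) {D : PaB K}
    (h : (PaB.relabel e).obj (PaB.two.comp (PaB.pair A B)) = D) (W : K → Word C) {v w z : Word C}
    (g : ∀ i, Word.subst (PaB.pair A B i) (fun j => W (e ⟨i, j⟩)) ⟶ cons v w i)
    (p : v.mul w ⟶ z) (q : Word.subst D W ⟶ z)
    (hpq : Word.substAssoc PaB.two (PaB.pair A B) (fun i j => W (e ⟨i, j⟩)) ≫
      Word.substMap PaB.two g ≫ p = Word.substTree e (PaB.homOfEq h) W ≫ q) :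
    T.graft A B e h (fun k => T.ev (W k)) ≫ T.sub D W ≫ T.evMap q =
      T.tenHom (T.sub A (fun j => W (e ⟨0, j⟩)) ≫ T.evMap (g 0))
        (T.sub B (fun j => W (e ⟨1, j⟩)) ≫ T.evMap (g 1)) ≫ T.m v w ≫ T.evMap p := by
  have h1 := T.sub_tree_of_eq h W
  have h2 := T.sub_assoc PaB.two (PaB.pair A B) fun i j => W (e ⟨i, j⟩)
  have h3 := (T.evMap_comp₃ _ _ _).trans ((congrArg T.evMap hpq).trans (T.evMap_comp _ _))
  have h4 := T.sub_map PaB.two g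
  have h6 := T.τ_naturality
    (N := fun i => (T.V (PaB.pair A B i)).obj fun j => T.ev (W (e ⟨i, j⟩)))
    (N' := fun i => T.ev (cons v w i))
    fun i => T.sub (PaB.pair A B i) (fun j => W (e ⟨i, j⟩)) ≫ T.evMap (g i)
  have h5 : (T.V PaB.two).map
      (X := fun i => (T.V (PaB.pair A B i)).obj fun j => T.ev (W (e ⟨i, j⟩)))
      (Y := fun i => T.ev (cons v w i))
      (fun i => T.sub (PaB.pair A B i) (fun j => W (e ⟨i, j⟩)) ≫ T.evMap (g i)) =
    (T.V PaB.two).map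
      (X := fun i => (T.V (PaB.pair A B i)).obj fun j => T.ev (W (e ⟨i, j⟩)))
      (Y := fun i => T.ev (Word.subst (PaB.pair A B i) fun j => W (e ⟨i, j⟩)))
      (fun i => T.sub (PaB.pair A B i) (fun j => W (e ⟨i, j⟩))) ≫
    (T.V PaB.two).map (X := fun i => T.ev (Word.subst (PaB.pair A B i) fun j => W (e ⟨i, j⟩)))
      (Y := fun i => T.ev (cons v w i)) fun i => T.evMap (g i) :=
    (map_comp_family (T.V PaB.two) _ _).symm
  exact graft_paste h1 h2 h3 h4 h5 h6

/-- A family of two words is isomorphic to the family given by its two members. -/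
def _root_.PaBOp.Word.toCons (W : Fin 2 → Word C) : ∀ i, W i ⟶ cons (W 0) (W 1) i
  | 0 => 𝟙 _
  | 1 => 𝟙 _

/-- The map `m` in terms of a family of two words. -/
theorem τ_sub (W : Fin 2 → Word C) :
    (T.τ fun i => T.ev (W i)).hom ≫ T.sub PaB.two W ≫
      T.evMap (Word.substMap PaB.two (Word.toCons W)) = T.m (W 0) (W 1) := by
  have h1 := T.τ_naturality (N := fun i => T.ev (W i)) (N' := fun i => T.ev (cons (W 0) (W 1) i))
    fun i => T.evMap (Word.toCons W i)
  have h2 := T.sub_map PaB.two (Word.toCons W)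
  have h3 : T.tenHom (T.evMap (Word.toCons W 0)) (T.evMap (Word.toCons W 1)) = 𝟙 _ := by
    have h : ∀ x : Word C, T.evMap (𝟙 x) = 𝟙 (T.ev x) := T.evMap_id
    exact (congrArg₂ (fun f g => T.tenHom f g) (h (W 0)) (h (W 1))).trans (T.tenHom_id _ _)
  refine (congrArg (fun t => _ ≫ t) h2.symm).trans ((Category.assoc _ _ _).symm.trans
    ((congrArg (fun t => t ≫ _) h1.symm).trans ((congrArg (fun t => (t ≫ _) ≫ _) h3).trans
      (congrArg (fun t => t ≫ _) (Category.id_comp _)))))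

end LaxEndMorphism
end
end PaBOp

namespace PaBOp

universe u

/-! ### Associativity and units for words -/

namespace Word

section
variable {C : Type u} [SmallCategory C]

/-- A morphism of words with trivial braid. -/
def ofLeaves {v w : Word C} (e : v.I ≃ w.I) (h : v.A.leaves.map e = w.A.leaves)
    (φ : ∀ i, v.M i ⟶ w.M (e i)) : v ⟶ w :=
  Hom.mk e
    { braid := 1
      mem := one_mem _
      perm_leaves := fun j => by rw [PaB.relabel_obj_leaves, h, map_one]; rfl } φ

@[simp] theorem ofLeaves_braid {v w : Word C} (e : v.I ≃ w.I) (h : v.A.leaves.map e = w.A.leaves)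
    (φ : ∀ i, v.M i ⟶ w.M (e i)) : Hom.braid (ofLeaves e h φ) = 1 := rfl

omit [SmallCategory C] in
theorem map_leaves_mul {K : Type} (v w : Word C) (f : (v.mul w).I → K) :
    (v.mul w).A.leaves.map f =
      v.A.leaves.map (fun x => f ⟨0, x⟩) ++ w.A.leaves.map fun x => f ⟨1, x⟩ :=
  (congrArg (List.map f) (leaves_mul v w)).trans
    (List.map_append.trans (congrArg₂ (· ++ ·) List.map_map List.map_map))

/-- Re-bracketing of the letters of three words. -/
def assocEquiv (u v w : Word C) : ((u.mul v).mul w).I ≃ (u.mul (v.mul w)).I where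
  toFun p := match p with
    | ⟨0, ⟨0, x⟩⟩ => ⟨0, x⟩
    | ⟨0, ⟨1, x⟩⟩ => ⟨1, ⟨0, x⟩⟩
    | ⟨1, x⟩ => ⟨1, ⟨1, x⟩⟩
  invFun p := match p with
    | ⟨0, x⟩ => ⟨0, ⟨0, x⟩⟩
    | ⟨1, ⟨0, x⟩⟩ => ⟨0, ⟨1, x⟩⟩
    | ⟨1, ⟨1, x⟩⟩ => ⟨1, x⟩
  left_inv p := match p with
    | ⟨0, ⟨0, _⟩⟩ => rfl
    | ⟨0, ⟨1, _⟩⟩ => rfl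
    | ⟨1, _⟩ => rfl
  right_inv p := match p with
    | ⟨0, _⟩ => rfl
    | ⟨1, ⟨0, _⟩⟩ => rfl
    | ⟨1, ⟨1, _⟩⟩ => rfl

omit [SmallCategory C] in
theorem leaves_assoc (u v w : Word C) : ((u.mul v).mul w).A.leaves.map (assocEquiv u v w) =
    (u.mul (v.mul w)).A.leaves := by
  refine (map_leaves_mul (u.mul v) w _).trans ?_
  refine (congrArg (· ++ _) (map_leaves_mul u v _)).trans ?_
  refine List.append_assoc _ _ _ |>.trans ?_
  have h := map_leaves_mul u (v.mul w) id
  rw [List.map_id] at h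
  refine Eq.trans ?_ h.symm
  exact congrArg (_ ++ ·) (map_leaves_mul v w _).symm

/-- Concatenation of words is associative. -/
def assoc (u v w : Word C) : (u.mul v).mul w ⟶ u.mul (v.mul w) :=
  ofLeaves (v := (u.mul v).mul w) (assocEquiv u v w) (leaves_assoc u v w) fun p => match p with
    | ⟨0, ⟨0, _⟩⟩ => 𝟙 _
    | ⟨0, ⟨1, _⟩⟩ => 𝟙 _
    | ⟨1, _⟩ => 𝟙 _

/-- The empty word. -/
def one : Word C := ⟨Empty, PaB.empty Empty, Empty.elim⟩

/-- The letters of a word, with those of the empty word on the left. -/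
def oneMulEquiv (w : Word C) : (one.mul w).I ≃ w.I where
  toFun p := match p with
    | ⟨0, x⟩ => Empty.elim x
    | ⟨1, x⟩ => x
  invFun x := ⟨1, x⟩
  left_inv p := match p with
    | ⟨0, x⟩ => Empty.elim x
    | ⟨1, _⟩ => rfl
  right_inv _ := rfl

/-- The letters of a word, with those of the empty word on the right. -/
def mulOneEquiv (w : Word C) : (w.mul one).I ≃ w.I where
  toFun p := match p with
    | ⟨0, x⟩ => x
    | ⟨1, x⟩ => Empty.elim x
  invFun x := ⟨0, x⟩
  left_inv p := match p with
    | ⟨0, _⟩ => rfl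
    | ⟨1, x⟩ => Empty.elim x
  right_inv _ := rfl

omit [SmallCategory C] in
theorem leaves_one_mul (w : Word C) : (one.mul w).A.leaves.map (oneMulEquiv w) = w.A.leaves :=
  (map_leaves_mul one w _).trans (List.map_id _)

omit [SmallCategory C] in
theorem leaves_mul_one (w : Word C) : (w.mul one).A.leaves.map (mulOneEquiv w) = w.A.leaves :=
  (map_leaves_mul w one _).trans ((List.append_nil _).trans (List.map_id _))

/-- The empty word is a left unit. -/
def oneMul (w : Word C) : one.mul w ⟶ w :=
  ofLeaves (v := one.mul w) (oneMulEquiv w) (leaves_one_mul w) fun p => match p with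
    | ⟨0, x⟩ => Empty.elim x
    | ⟨1, _⟩ => 𝟙 _

/-- The empty word is a right unit. -/
def mulOne (w : Word C) : w.mul one ⟶ w :=
  ofLeaves (v := w.mul one) (mulOneEquiv w) (leaves_mul_one w) fun p => match p with
    | ⟨0, _⟩ => 𝟙 _
    | ⟨1, x⟩ => Empty.elim x

/-- The pentagon holds for words because both sides have trivial braid and the same effect on
letters. -/
theorem pentagon (t u v w : Word C) :
    mulMap (assoc t u v) (𝟙 w) ≫ assoc t (u.mul v) w ≫ mulMap (𝟙 t) (assoc u v w) =
      assoc (t.mul u) v w ≫ assoc t u (v.mul w) := by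
  refine hom_ext (fun p => ?_) ?_ fun p => ?_
  · match p with
    | ⟨0, ⟨0, ⟨0, x⟩⟩⟩ => rfl
    | ⟨0, ⟨0, ⟨1, x⟩⟩⟩ => rfl
    | ⟨0, ⟨1, x⟩⟩ => rfl
    | ⟨1, x⟩ => rfl
  · simp [assoc]
  · match p with
    | ⟨0, ⟨0, ⟨0, x⟩⟩⟩ =>
      change (𝟙 (t.M x) ≫ 𝟙 (t.M x) ≫ 𝟙 (t.M x)) ≫ 𝟙 (t.M x) = 𝟙 (t.M x) ≫ 𝟙 (t.M x)
      simp
    | ⟨0, ⟨0, ⟨1, x⟩⟩⟩ =>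
      change (𝟙 (u.M x) ≫ 𝟙 (u.M x) ≫ 𝟙 (u.M x)) ≫ 𝟙 (u.M x) = 𝟙 (u.M x) ≫ 𝟙 (u.M x)
      simp
    | ⟨0, ⟨1, x⟩⟩ =>
      change (𝟙 (v.M x) ≫ 𝟙 (v.M x) ≫ 𝟙 (v.M x)) ≫ 𝟙 (v.M x) = 𝟙 (v.M x) ≫ 𝟙 (v.M x)
      simp
    | ⟨1, x⟩ =>
      change (𝟙 (w.M x) ≫ 𝟙 (w.M x) ≫ 𝟙 (w.M x)) ≫ 𝟙 (w.M x) = 𝟙 (w.M x) ≫ 𝟙 (w.M x)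
      simp

theorem triangle (v w : Word C) :
    assoc v one w ≫ mulMap (𝟙 v) (oneMul w) = mulMap (mulOne v) (𝟙 w) := by
  refine hom_ext (fun p => ?_) ?_ fun p => ?_
  · match p with
    | ⟨0, ⟨0, x⟩⟩ => rfl
    | ⟨0, ⟨1, x⟩⟩ => exact Empty.elim x
    | ⟨1, x⟩ => rfl
  · simp [assoc, oneMul, mulOne]
  · match p with
    | ⟨0, ⟨0, x⟩⟩ =>
      change (𝟙 (v.M x) ≫ 𝟙 (v.M x)) ≫ 𝟙 (v.M x) = 𝟙 (v.M x)
      simp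
    | ⟨0, ⟨1, x⟩⟩ => exact Empty.elim x
    | ⟨1, x⟩ =>
      change (𝟙 (w.M x) ≫ 𝟙 (w.M x)) ≫ 𝟙 (w.M x) = 𝟙 (w.M x)
      simp

end
end Word
end PaBOp

namespace PaBOp

universe u

/-! ### The hexagons for words -/

namespace BraidInf

theorem shift_row (n o b : ℕ) : shift n (row o b) = row (n + o) b := by
  induction b with
  | zero => exact map_one _
  | succ b ih => rw [row, row, map_mul, ih, shift_gen, Nat.add_assoc]

theorem shift_cross (n o a b : ℕ) : shift n (cross o a b) = cross (n + o) a b := by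
  induction a with
  | zero => exact map_one _
  | succ a ih => rw [cross, cross, map_mul, ih, shift_row, Nat.add_assoc]

/-- Crossing `a + b` strands with `c` strands: first the right `b` strands, then the left `a`
strands. -/
theorem cross_add_left (o a b c : ℕ) : cross o (a + b) c = cross (o + a) b c * cross o a c := by
  induction b with
  | zero => exact (one_mul _).symm
  | succ b ih => rw [← Nat.add_assoc, cross, ih, cross, mul_assoc, Nat.add_assoc]

end BraidInf

namespace Word

section
variable {C : Type u} [SmallCategory C]

/-- The inverse of `assoc`. -/
def assocInv (u v w : Word C) : u.mul (v.mul w) ⟶ (u.mul v).mul w :=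
  ofLeaves (w := (u.mul v).mul w) (assocEquiv u v w).symm
    (by rw [← leaves_assoc, List.map_map, Equiv.symm_comp_self, List.map_id])
    fun p => match p with
    | ⟨0, _⟩ => 𝟙 _
    | ⟨1, ⟨0, _⟩⟩ => 𝟙 _
    | ⟨1, ⟨1, _⟩⟩ => 𝟙 _

theorem assoc_assocInv (u v w : Word C) : assoc u v w ≫ assocInv u v w = 𝟙 _ := by
  refine hom_ext (fun p => ?_) ?_ fun p => ?_
  · match p with
    | ⟨0, ⟨0, x⟩⟩ => rfl
    | ⟨0, ⟨1, x⟩⟩ => rfl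
    | ⟨1, x⟩ => rfl
  · simp [assoc, assocInv]
  · match p with
    | ⟨0, ⟨0, x⟩⟩ =>
      change (𝟙 (u.M x) ≫ 𝟙 (u.M x)) ≫ 𝟙 (u.M x) = 𝟙 (u.M x)
      simp
    | ⟨0, ⟨1, x⟩⟩ =>
      change (𝟙 (v.M x) ≫ 𝟙 (v.M x)) ≫ 𝟙 (v.M x) = 𝟙 (v.M x)
      simp
    | ⟨1, x⟩ =>
      change (𝟙 (w.M x) ≫ 𝟙 (w.M x)) ≫ 𝟙 (w.M x) = 𝟙 (w.M x)
      simp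

/-- The hexagon holds for words because `u` crosses `v w` by crossing `v` and then `w`. -/
theorem hexagon (u v w : Word C) :
    assoc u v w ≫ crossHom u (v.mul w) ≫ assoc v w u =
      mulMap (crossHom u v) (𝟙 w) ≫ assoc v u w ≫ mulMap (𝟙 v) (crossHom u w) := by
  refine hom_ext (fun p => ?_) ?_ fun p => ?_
  · match p with
    | ⟨0, ⟨0, x⟩⟩ => rfl
    | ⟨0, ⟨1, x⟩⟩ => rfl
    | ⟨1, x⟩ => rfl
  · simp [assoc, BraidInf.cross_add, BraidInf.shift_cross]
  · match p with
    | ⟨0, ⟨0, x⟩⟩ =>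
      change (𝟙 (u.M x) ≫ 𝟙 (u.M x) ≫ 𝟙 (u.M x)) ≫ 𝟙 (u.M x) = 𝟙 (u.M x) ≫ 𝟙 (u.M x) ≫ 𝟙 (u.M x)
      simp
    | ⟨0, ⟨1, x⟩⟩ =>
      change (𝟙 (v.M x) ≫ 𝟙 (v.M x) ≫ 𝟙 (v.M x)) ≫ 𝟙 (v.M x) = 𝟙 (v.M x) ≫ 𝟙 (v.M x) ≫ 𝟙 (v.M x)
      simp
    | ⟨1, x⟩ =>
      change (𝟙 (w.M x) ≫ 𝟙 (w.M x) ≫ 𝟙 (w.M x)) ≫ 𝟙 (w.M x) = 𝟙 (w.M x) ≫ 𝟙 (w.M x) ≫ 𝟙 (w.M x)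
      simp

/-- The second hexagon, solved for the braiding of `u v` with `w`. -/
theorem hexagon' (u v w : Word C) : crossHom (u.mul v) w =
    assoc u v w ≫ mulMap (𝟙 u) (crossHom v w) ≫ assocInv u w v ≫ mulMap (crossHom u w) (𝟙 v) ≫
      assoc w u v := by
  refine hom_ext (fun p => ?_) ?_ fun p => ?_
  · match p with
    | ⟨0, ⟨0, x⟩⟩ => rfl
    | ⟨0, ⟨1, x⟩⟩ => rfl
    | ⟨1, x⟩ => rfl
  · simp [assoc, assocInv, BraidInf.cross_add_left, BraidInf.shift_cross]
  · match p with
    | ⟨0, ⟨0, x⟩⟩ =>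
      change 𝟙 (u.M x) ≫ 𝟙 (u.M x) =
        𝟙 (u.M x) ≫ 𝟙 (u.M x) ≫ 𝟙 (u.M x) ≫ 𝟙 (u.M x) ≫ 𝟙 (u.M x)
      simp
    | ⟨0, ⟨1, x⟩⟩ =>
      change 𝟙 (v.M x) ≫ 𝟙 (v.M x) =
        𝟙 (v.M x) ≫ 𝟙 (v.M x) ≫ 𝟙 (v.M x) ≫ 𝟙 (v.M x) ≫ 𝟙 (v.M x)
      simp
    | ⟨1, x⟩ =>
      change 𝟙 (w.M x) ≫ 𝟙 (w.M x) =
        𝟙 (w.M x) ≫ 𝟙 (w.M x) ≫ 𝟙 (w.M x) ≫ 𝟙 (w.M x) ≫ 𝟙 (w.M x)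
      simp

/-! ### Grafting of words -/

omit [SmallCategory C] in
theorem map_leaves_threeR {K : Type} (W : Fin 3 → Word C) (f : (Σ i, (W i).I) → K) :
    (PaB.threeR.comp fun i => (W i).A).leaves.map f =
      (W 0).A.leaves.map (fun x => f ⟨0, x⟩) ++
        ((W 1).A.leaves.map (fun x => f ⟨1, x⟩) ++ (W 2).A.leaves.map fun x => f ⟨2, x⟩) := by
  have h : (PaB.threeR.comp fun i => (W i).A).leaves =
      (W 0).A.leaves.map (Sigma.mk (β := fun i => (W i).I) 0) ++
        ((W 1).A.leaves.map (Sigma.mk (β := fun i => (W i).I) 1) ++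
          ((W 2).A.leaves.map (Sigma.mk (β := fun i => (W i).I) 2) ++ [])) :=
    PaB.leaves_comp _ _
  rw [h, List.append_nil, List.map_append, List.map_append, List.map_map, List.map_map,
    List.map_map]
  rfl

/-- The words grafted at `1(23)`, as an iterated concatenation. -/
def ofThree (W : Fin 3 → Word C) : subst PaB.threeR W ⟶ (W 0).mul ((W 1).mul (W 2)) :=
  ofLeaves (v := subst PaB.threeR W) (w := (W 0).mul ((W 1).mul (W 2)))
    { toFun := fun p => match p with
        | ⟨0, x⟩ => ⟨0, x⟩
        | ⟨1, x⟩ => ⟨1, ⟨0, x⟩⟩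
        | ⟨2, x⟩ => ⟨1, ⟨1, x⟩⟩
      invFun := fun p => match p with
        | ⟨0, x⟩ => ⟨0, x⟩
        | ⟨1, ⟨0, x⟩⟩ => ⟨1, x⟩
        | ⟨1, ⟨1, x⟩⟩ => ⟨2, x⟩
      left_inv := fun p => match p with
        | ⟨0, _⟩ => rfl
        | ⟨1, _⟩ => rfl
        | ⟨2, _⟩ => rfl
      right_inv := fun p => match p with
        | ⟨0, _⟩ => rfl
        | ⟨1, ⟨0, _⟩⟩ => rfl
        | ⟨1, ⟨1, _⟩⟩ => rfl }
    ((map_leaves_threeR W _).trans ((congrArg (_ ++ ·) (map_leaves_mul (W 1) (W 2) _).symm).trans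
      ((map_leaves_mul (W 0) ((W 1).mul (W 2)) id).symm.trans (List.map_id _))))
    fun p => match p with
      | ⟨0, _⟩ => 𝟙 _
      | ⟨1, _⟩ => 𝟙 _
      | ⟨2, _⟩ => 𝟙 _

/-- The words grafted at the trees `12` and `1`. -/
def graftL (W : Fin 3 → Word C) :
    ∀ i, subst (PaB.pair PaB.two PaB.unary i) (fun j => W (PaB.sigmaL ⟨i, j⟩)) ⟶
      cons ((W 0).mul (W 1)) (W 2) i
  | 0 => substMap PaB.two (toCons fun j : Fin 2 => W (PaB.sigmaL ⟨0, j⟩))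
  | 1 => substUnary (W 2)

/-- The words grafted at the trees `1` and `12`. -/
def graftR (W : Fin 3 → Word C) :
    ∀ i, subst (PaB.pair PaB.unary PaB.two i) (fun j => W (PaB.sigmaR ⟨i, j⟩)) ⟶
      cons (W 0) ((W 1).mul (W 2)) i
  | 0 => substUnary (W 0)
  | 1 => substMap PaB.two (toCons fun j : Fin 2 => W (PaB.sigmaR ⟨1, j⟩))

theorem toCons_braid (W : Fin 2 → Word C) : ∀ i, Hom.braid (toCons W i) = 1
  | 0 => rfl
  | 1 => rfl

theorem substMap_braid_of_one {I : Type} (A : PaB I) {W W' : I → Word C} (g : ∀ i, W i ⟶ W' i)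
    (h : ∀ i, Hom.braid (g i) = 1) : Hom.braid (substMap A g) = 1 := by
  rw [substMap_braid, funext h, BraidInf.blocks_one]

theorem graftL_braid (W : Fin 3 → Word C) : ∀ i, Hom.braid (graftL W i) = 1
  | 0 => substMap_braid_of_one _ _ (toCons_braid _)
  | 1 => rfl

theorem graftR_braid (W : Fin 3 → Word C) : ∀ i, Hom.braid (graftR W i) = 1
  | 0 => rfl
  | 1 => substMap_braid_of_one _ _ (toCons_braid _)

theorem substTree_braid_of_one {I I' : Type} {A : PaB I} {A' : PaB I'} (e : I ≃ I')
    (f : (PaB.relabel e).obj A ⟶ A') (W : I' → Word C) (h : PaB.Hom.braid f = 1) :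
    Hom.braid (substTree e f W) = 1 := by
  rw [substTree_braid, h, BraidInf.cable_one]

theorem comp_braid_of_one {v w x : Word C} {f : v ⟶ w} {g : w ⟶ x} (hf : Hom.braid f = 1)
    (hg : Hom.braid g = 1) : Hom.braid (f ≫ g) = 1 := by
  rw [comp_braid, hf, hg, one_mul]

/-- Substitution in `(12)3 = 12 ∘ (12, 1)`, followed by re-bracketing, is substitution in `α`. -/
theorem graftL_comp (W : Fin 3 → Word C) :
    substAssoc PaB.two (PaB.pair PaB.two PaB.unary) (fun i j => W (PaB.sigmaL ⟨i, j⟩)) ≫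
      substMap PaB.two (graftL W) ≫ assoc (W 0) (W 1) (W 2) =
    substTree PaB.sigmaL (PaB.homOfEq PaB.relabel_sigmaL) W ≫
      substTree (A := PaB.threeL) (Equiv.refl _) PaB.α W ≫ ofThree W := by
  refine hom_ext (fun p => ?_) ?_ fun p => ?_
  · match p with
    | ⟨⟨0, (0 : Fin 2)⟩, x⟩ => rfl
    | ⟨⟨0, (1 : Fin 2)⟩, x⟩ => rfl
    | ⟨⟨1, _⟩, x⟩ => rfl
  · exact (comp_braid_of_one rfl (comp_braid_of_one (substMap_braid_of_one _ _ (graftL_braid W))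
      rfl)).trans (comp_braid_of_one (substTree_braid_of_one _ _ _ rfl)
        (comp_braid_of_one (substTree_braid_of_one _ _ _ rfl) rfl)).symm
  · match p with
    | ⟨⟨0, (0 : Fin 2)⟩, x⟩ =>
      change (𝟙 ((W 0).M x) ≫ 𝟙 ((W 0).M x) ≫ 𝟙 ((W 0).M x)) ≫ 𝟙 ((W 0).M x) =
        𝟙 ((W 0).M x) ≫ 𝟙 ((W 0).M x) ≫ 𝟙 ((W 0).M x)
      simp
    | ⟨⟨0, (1 : Fin 2)⟩, x⟩ =>
      change (𝟙 ((W 1).M x) ≫ 𝟙 ((W 1).M x) ≫ 𝟙 ((W 1).M x)) ≫ 𝟙 ((W 1).M x) =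
        𝟙 ((W 1).M x) ≫ 𝟙 ((W 1).M x) ≫ 𝟙 ((W 1).M x)
      simp
    | ⟨⟨1, _⟩, x⟩ =>
      change (𝟙 ((W 2).M x) ≫ 𝟙 ((W 2).M x) ≫ 𝟙 ((W 2).M x)) ≫ 𝟙 ((W 2).M x) =
        𝟙 ((W 2).M x) ≫ 𝟙 ((W 2).M x) ≫ 𝟙 ((W 2).M x)
      simp

/-- Substitution in `1(23) = 12 ∘ (1, 12)` is iterated concatenation. -/
theorem graftR_comp (W : Fin 3 → Word C) :
    substAssoc PaB.two (PaB.pair PaB.unary PaB.two) (fun i j => W (PaB.sigmaR ⟨i, j⟩)) ≫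
      substMap PaB.two (graftR W) ≫ 𝟙 ((W 0).mul ((W 1).mul (W 2))) =
    substTree PaB.sigmaR (PaB.homOfEq PaB.relabel_sigmaR) W ≫ ofThree W := by
  refine hom_ext (fun p => ?_) ?_ fun p => ?_
  · match p with
    | ⟨⟨0, _⟩, x⟩ => rfl
    | ⟨⟨1, (0 : Fin 2)⟩, x⟩ => rfl
    | ⟨⟨1, (1 : Fin 2)⟩, x⟩ => rfl
  · exact (comp_braid_of_one rfl (comp_braid_of_one (substMap_braid_of_one _ _ (graftR_braid W))
      rfl)).trans (comp_braid_of_one (substTree_braid_of_one _ _ _ rfl) rfl).symm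
  · match p with
    | ⟨⟨0, _⟩, x⟩ =>
      change (𝟙 ((W 0).M x) ≫ 𝟙 ((W 0).M x) ≫ 𝟙 ((W 0).M x)) ≫ 𝟙 ((W 0).M x) =
        𝟙 ((W 0).M x) ≫ 𝟙 ((W 0).M x)
      simp
    | ⟨⟨1, (0 : Fin 2)⟩, x⟩ =>
      change (𝟙 ((W 1).M x) ≫ 𝟙 ((W 1).M x) ≫ 𝟙 ((W 1).M x)) ≫ 𝟙 ((W 1).M x) =
        𝟙 ((W 1).M x) ≫ 𝟙 ((W 1).M x)
      simp
    | ⟨⟨1, (1 : Fin 2)⟩, x⟩ =>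
      change (𝟙 ((W 2).M x) ≫ 𝟙 ((W 2).M x) ≫ 𝟙 ((W 2).M x)) ≫ 𝟙 ((W 2).M x) =
        𝟙 ((W 2).M x) ≫ 𝟙 ((W 2).M x)
      simp

/-- Grafting at the empty tree gives the empty word. -/
def substEmptyOne (W : Empty → Word C) : subst (PaB.empty Empty) W ⟶ one :=
  ofLeaves (v := subst (PaB.empty Empty) W) (w := one)
    (Equiv.equivOfIsEmpty (Σ i : Empty, (W i).I) Empty) rfl fun p => p.1.elim

/-- The word `w`, grafted at the trees `∅` and `1`. -/
def graftEmptyL (w : Word C) :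
    ∀ i, subst (PaB.pair (PaB.empty Empty) PaB.unary i) (fun _ => w) ⟶ cons one w i
  | 0 => substEmptyOne fun _ => w
  | 1 => substUnary w

/-- The word `w`, grafted at the trees `1` and `∅`. -/
def graftEmptyR (w : Word C) :
    ∀ i, subst (PaB.pair PaB.unary (PaB.empty Empty) i) (fun _ => w) ⟶ cons w one i
  | 0 => substUnary w
  | 1 => substEmptyOne fun _ => w

theorem graftEmptyL_braid (w : Word C) : ∀ i, Hom.braid (graftEmptyL w i) = 1
  | 0 => rfl
  | 1 => rfl

theorem graftEmptyR_braid (w : Word C) : ∀ i, Hom.braid (graftEmptyR w i) = 1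
  | 0 => rfl
  | 1 => rfl

/-- Substitution in `1 = 12 ∘ (∅, 1)` erases the empty word. -/
theorem graftEmptyL_comp (w : Word C) :
    substAssoc PaB.two (PaB.pair (PaB.empty Empty) PaB.unary) (fun _ _ => w) ≫
      substMap PaB.two (graftEmptyL w) ≫ oneMul w =
    substTree PaB.sigmaEmptyL (PaB.homOfEq PaB.relabel_sigmaEmptyL) (fun _ => w) ≫
      substUnary w := by
  refine hom_ext (fun p => ?_) ?_ fun p => ?_
  · match p with
    | ⟨⟨0, y⟩, x⟩ => exact Empty.elim y
    | ⟨⟨1, _⟩, x⟩ => rfl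
  · exact (comp_braid_of_one rfl (comp_braid_of_one (substMap_braid_of_one _ _
      (graftEmptyL_braid w)) rfl)).trans
        (comp_braid_of_one (substTree_braid_of_one _ _ _ rfl) rfl).symm
  · match p with
    | ⟨⟨0, y⟩, x⟩ => exact Empty.elim y
    | ⟨⟨1, _⟩, x⟩ =>
      change (𝟙 (w.M x) ≫ 𝟙 (w.M x) ≫ 𝟙 (w.M x)) ≫ 𝟙 (w.M x) = 𝟙 (w.M x) ≫ 𝟙 (w.M x)
      simp

/-- Substitution in `1 = 12 ∘ (1, ∅)` erases the empty word. -/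
theorem graftEmptyR_comp (w : Word C) :
    substAssoc PaB.two (PaB.pair PaB.unary (PaB.empty Empty)) (fun _ _ => w) ≫
      substMap PaB.two (graftEmptyR w) ≫ mulOne w =
    substTree PaB.sigmaEmptyR (PaB.homOfEq PaB.relabel_sigmaEmptyR) (fun _ => w) ≫
      substUnary w := by
  refine hom_ext (fun p => ?_) ?_ fun p => ?_
  · match p with
    | ⟨⟨0, _⟩, x⟩ => rfl
    | ⟨⟨1, y⟩, x⟩ => exact Empty.elim y
  · exact (comp_braid_of_one rfl (comp_braid_of_one (substMap_braid_of_one _ _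
      (graftEmptyR_braid w)) rfl)).trans
        (comp_braid_of_one (substTree_braid_of_one _ _ _ rfl) rfl).symm
  · match p with
    | ⟨⟨0, _⟩, x⟩ =>
      change (𝟙 (w.M x) ≫ 𝟙 (w.M x) ≫ 𝟙 (w.M x)) ≫ 𝟙 (w.M x) = 𝟙 (w.M x) ≫ 𝟙 (w.M x)
      simp
    | ⟨⟨1, y⟩, x⟩ => exact Empty.elim y

end
end Word
end PaBOp

namespace PaBOp

universe u

/-! ### The associator -/

section
variable {D : Type*}

/-- The family with the three members `a`, `b` and `c`. -/
def tri (a b c : D) : Fin 3 → D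
  | 0 => a
  | 1 => b
  | 2 => c

variable [Category D]

/-- The family with the three members `f`, `g` and `h`. -/
def triHom {a b c a' b' c' : D} (f : a ⟶ a') (g : b ⟶ b') (h : c ⟶ c') :
    ∀ i, tri a b c i ⟶ tri a' b' c' i
  | 0 => f
  | 1 => g
  | 2 => h

/-- A family indexed by `{0, 1, 2}` is isomorphic to the family given by its three members. -/
def triSelf (X : Fin 3 → D) : ∀ i, tri (X 0) (X 1) (X 2) i ⟶ X i
  | 0 => 𝟙 _
  | 1 => 𝟙 _
  | 2 => 𝟙 _

/-- The diagram chase for `LaxEndMorphism.leftHom_sub`. -/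
theorem left_paste {X X₁ X₂ X₃ X₄ X₅ Y Y₁ Z : D} {d : X ⟶ X₁} {g : X₁ ⟶ X₂} {α : X₂ ⟶ X₃}
    {s : X₃ ⟶ X₄} {o : X₄ ⟶ Z} {s' : X₂ ⟶ X₅} {t : X₅ ⟶ X₄} {i : X₂ ⟶ X₂}
    (h₁ : s' ≫ t = i ≫ α ≫ s) (hi : i = 𝟙 _)
    {q : X₅ ⟶ Z} (hq : q = t ≫ o) {b : X₁ ⟶ Y} {n : Y ⟶ Y₁} {p : Y₁ ⟶ Z}
    (h₂ : g ≫ s' ≫ q = b ≫ n ≫ p) {c : X ⟶ Y} (h₃ : d ≫ b = c) :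
    (d ≫ g) ≫ α ≫ s ≫ o = c ≫ n ≫ p := by
  rw [hi, Category.id_comp] at h₁
  rw [← h₃, Category.assoc, Category.assoc, ← h₂, hq, reassoc_of% h₁]

/-- The diagram chase for `LaxEndMorphism.rightHom_sub`. -/
theorem right_paste {X X₁ X₂ X₃ Y Z : D} {d : X ⟶ X₁} {g : X₁ ⟶ X₂} {s : X₂ ⟶ X₃}
    {o : X₃ ⟶ Z} {b : X₁ ⟶ Y} {n : Y ⟶ Z} {p : Z ⟶ Z} (hp : p = 𝟙 _)
    (h₂ : g ≫ s ≫ o = b ≫ n ≫ p) {c : X ⟶ Y} (h₃ : d ≫ b = c) :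
    (d ≫ g) ≫ s ≫ o = c ≫ n := by
  rw [hp, Category.comp_id] at h₂
  rw [← h₃, Category.assoc, Category.assoc, ← h₂]

theorem assoc_paste {X X₁ X₂ Y Y₁ Y₂ : D} {f : X ⟶ Y} {l : X ⟶ X₁} {l' : Y ⟶ Y₁} {f₁ : X₁ ⟶ Y₁}
    {a : X₁ ⟶ X₂} {a' : Y₁ ⟶ Y₂} {f₂ : X₂ ⟶ Y₂} {Z Z' : D} {r : Z ⟶ X₂} {r' : Z' ⟶ Y₂}
    {f₃ : Z ⟶ Z'} [IsIso r] [IsIso r'] (h₁ : f ≫ l' = l ≫ f₁) (h₂ : f₁ ≫ a' = a ≫ f₂)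
    (h₃ : f₃ ≫ r' = r ≫ f₂) : f ≫ l' ≫ a' ≫ inv r' = (l ≫ a ≫ inv r) ≫ f₃ := by
  rw [← cancel_mono r']
  simp only [Category.assoc, IsIso.inv_hom_id, Category.comp_id, h₃, IsIso.inv_hom_id_assoc]
  rw [reassoc_of% h₁, h₂]

theorem tail_paste {X X₁ X₂ X₃ Y Y₁ : D} {f : X ⟶ Y} {a : X ⟶ X₁} {b : X₁ ⟶ X₂} {a' : Y ⟶ X₃}
    {b' : X₃ ⟶ Y₁} {c : X₂ ⟶ Y₁} {f₁ : X₁ ⟶ X₃} (h₁ : f ≫ a' = a ≫ f₁) (h₂ : f₁ ≫ b' = b ≫ c) :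
    f ≫ a' ≫ b' = (a ≫ b) ≫ c := by
  rw [reassoc_of% h₁, h₂, Category.assoc]

end

section
variable {C : Type u} [SmallCategory C] [Preadditive C] [Linear ℂ C]

namespace LaxEndMorphism

variable (T : LaxEndMorphism C)

/-- The identification of the iterated tensor product with `T((12)3)`. -/
noncomputable def leftHom (X : Fin 3 → C) :
    T.ten (T.ten (X 0) (X 1)) (X 2) ⟶ (T.V PaB.threeL).obj X :=
  T.tenHom (T.τ fun j => X (PaB.sigmaL ⟨0, j⟩)).hom (T.unitIso fun _ => X 2).inv ≫
    T.graft PaB.two PaB.unary PaB.sigmaL PaB.relabel_sigmaL X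

/-- The identification of the iterated tensor product with `T(1(23))`. -/
noncomputable def rightHom (X : Fin 3 → C) :
    T.ten (X 0) (T.ten (X 1) (X 2)) ⟶ (T.V PaB.threeR).obj X :=
  T.tenHom (T.unitIso fun _ => X 0).inv (T.τ fun j => X (PaB.sigmaR ⟨1, j⟩)).hom ≫
    T.graft PaB.unary PaB.two PaB.sigmaR PaB.relabel_sigmaR X

theorem leftHom_naturality {X Y : Fin 3 → C} (f : ∀ k, X k ⟶ Y k) :
    T.tenHom (T.tenHom (f 0) (f 1)) (f 2) ≫ T.leftHom Y =
      T.leftHom X ≫ (T.V PaB.threeL).map (X := X) (Y := Y) f := by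
  have h1 := T.τ_naturality (N := fun j => X (PaB.sigmaL ⟨0, j⟩))
    (N' := fun j => Y (PaB.sigmaL ⟨0, j⟩)) fun j => f (PaB.sigmaL ⟨0, j⟩)
  have h2 := T.unitIso_naturality (M := fun _ => X 2) (N := fun _ => Y 2) fun _ => f 2
  have h3 := T.graft_naturality PaB.two PaB.unary PaB.sigmaL PaB.relabel_sigmaL f
  exact tail_paste ((T.tenHom_comp _ _ _ _).trans ((congrArg₂ (fun s t => T.tenHom s t) h1
    (iso_inv_square h2)).trans (T.tenHom_comp _ _ _ _).symm)) h3

theorem rightHom_naturality {X Y : Fin 3 → C} (f : ∀ k, X k ⟶ Y k) :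
    T.tenHom (f 0) (T.tenHom (f 1) (f 2)) ≫ T.rightHom Y =
      T.rightHom X ≫ (T.V PaB.threeR).map (X := X) (Y := Y) f := by
  have h1 := T.τ_naturality (N := fun j => X (PaB.sigmaR ⟨1, j⟩))
    (N' := fun j => Y (PaB.sigmaR ⟨1, j⟩)) fun j => f (PaB.sigmaR ⟨1, j⟩)
  have h2 := T.unitIso_naturality (M := fun _ => X 0) (N := fun _ => Y 0) fun _ => f 0
  have h3 := T.graft_naturality PaB.unary PaB.two PaB.sigmaR PaB.relabel_sigmaR f
  exact tail_paste ((T.tenHom_comp _ _ _ _).trans ((congrArg₂ (fun s t => T.tenHom s t)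
    (iso_inv_square h2) h1).trans (T.tenHom_comp _ _ _ _).symm)) h3

theorem isIso_tenHom {X Y X' Y' : C} (f : X ≅ X') (g : Y ≅ Y') : IsIso (T.tenHom f.hom g.hom) :=
  Iso.isIso_hom (T.tenIso f g)

variable {T}

theorem IsStrong.isIso_leftHom (hT : T.IsStrong) (X : Fin 3 → C) : IsIso (T.leftHom X) :=
  isIso_comp_of _ _ (T.isIso_tenHom (T.τ _) (T.unitIso _).symm) (hT.isIso_graft _ _ _ _ _)

theorem IsStrong.isIso_rightHom (hT : T.IsStrong) (X : Fin 3 → C) : IsIso (T.rightHom X) :=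
  isIso_comp_of _ _ (T.isIso_tenHom (T.unitIso _).symm (T.τ _)) (hT.isIso_graft _ _ _ _ _)

/-- The associator, for a family of three objects. -/
noncomputable def IsStrong.assocHom (hT : T.IsStrong) (X : Fin 3 → C) :
    T.ten (T.ten (X 0) (X 1)) (X 2) ⟶ T.ten (X 0) (T.ten (X 1) (X 2)) :=
  haveI := hT.isIso_rightHom X
  T.leftHom X ≫ ((T.F (Fin 3)).map PaB.α).app X ≫ inv (T.rightHom X)

theorem IsStrong.isIso_assocHom (hT : T.IsStrong) (X : Fin 3 → C) : IsIso (hT.assocHom X) := by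
  have h2 := PaB.isIso_hom PaB.α
  have h3 := isIso_map_of (T.F (Fin 3)) PaB.α h2
  have := hT.isIso_rightHom X
  exact isIso_comp_of _ _ (hT.isIso_leftHom X) (isIso_comp_of _ _
    (NatIso.isIso_app_of_isIso _ _) inferInstance)

theorem IsStrong.assocHom_spec (hT : T.IsStrong) (X : Fin 3 → C) :
    hT.assocHom X ≫ T.rightHom X = T.leftHom X ≫ ((T.F (Fin 3)).map PaB.α).app X := by
  simp [IsStrong.assocHom]

theorem IsStrong.assocHom_naturality (hT : T.IsStrong) {X Y : Fin 3 → C} (f : ∀ k, X k ⟶ Y k) :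
    T.tenHom (T.tenHom (f 0) (f 1)) (f 2) ≫ hT.assocHom Y =
      hT.assocHom X ≫ T.tenHom (f 0) (T.tenHom (f 1) (f 2)) := by
  have := hT.isIso_rightHom X
  have := hT.isIso_rightHom Y
  exact assoc_paste (T.leftHom_naturality f)
    (((T.F (Fin 3)).map PaB.α).naturality (X := X) (Y := Y) f) (T.rightHom_naturality f)

variable (T)

/-- For the values of three words, `leftHom` followed by `T(α)` is two applications of `m`, followed
by re-bracketing. Normalization takes care of the third letter of `(12)3 = 12 ∘ (12, 1)`, at which
`1` is grafted. -/
theorem leftHom_sub (hT : T.IsStrong) (hN : T.IsNormalized) (W : Fin 3 → Word C) :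
    T.leftHom (fun k => T.ev (W k)) ≫ ((T.F (Fin 3)).map PaB.α).app (fun k => T.ev (W k)) ≫
      T.sub PaB.threeR W ≫ T.evMap (Word.ofThree W) =
    T.tenHom (T.m (W 0) (W 1)) (𝟙 (T.ev (W 2))) ≫ T.m ((W 0).mul (W 1)) (W 2) ≫
      T.evMap (Word.assoc (W 0) (W 1) (W 2)) := by
  have h1 := T.sub_tree (A := PaB.threeL) (Equiv.refl _) PaB.α W
  have h2 := T.graft_sub PaB.two PaB.unary PaB.sigmaL PaB.relabel_sigmaL W (Word.graftL W) _ _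
    (Word.graftL_comp W)
  have h3 := T.τ_sub fun j => W (PaB.sigmaL ⟨0, j⟩)
  have h4 : (T.unitIso fun _ => T.ev (W 2)).inv ≫ T.unitMap (W 2) = 𝟙 _ := by
    rw [hN.unitMap_eq hT, Iso.inv_hom_id]
  exact left_paste h1 rfl (T.evMap_comp _ _) h2 ((T.tenHom_comp _ _ _ _).trans
    (congrArg₂ (fun s t => T.tenHom s t) h3 h4))

/-- For the values of three words, `rightHom` is two applications of `m`. -/
theorem rightHom_sub (hT : T.IsStrong) (hN : T.IsNormalized) (W : Fin 3 → Word C) :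
    T.rightHom (fun k => T.ev (W k)) ≫ T.sub PaB.threeR W ≫ T.evMap (Word.ofThree W) =
    T.tenHom (𝟙 (T.ev (W 0))) (T.m (W 1) (W 2)) ≫ T.m (W 0) ((W 1).mul (W 2)) := by
  have h2 := T.graft_sub PaB.unary PaB.two PaB.sigmaR PaB.relabel_sigmaR W (Word.graftR W) _ _
    (Word.graftR_comp W)
  have h3 := T.τ_sub fun j => W (PaB.sigmaR ⟨1, j⟩)
  have h4 : (T.unitIso fun _ => T.ev (W 0)).inv ≫ T.unitMap (W 0) = 𝟙 _ := by
    rw [hN.unitMap_eq hT, Iso.inv_hom_id]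
  exact right_paste (T.evMap_id _) h2 ((T.tenHom_comp _ _ _ _).trans
    (congrArg₂ (fun s t => T.tenHom s t) h4 h3))

variable {T}

/-- The associator of `C`. -/
noncomputable def IsStrong.assoc (hT : T.IsStrong) (X Y Z : C) :
    T.ten (T.ten X Y) Z ≅ T.ten X (T.ten Y Z) :=
  @asIso _ _ _ _ _ (hT.isIso_assocHom (tri X Y Z))

theorem IsStrong.assoc_naturality (hT : T.IsStrong) {X Y Z X' Y' Z' : C} (f : X ⟶ X') (g : Y ⟶ Y')
    (h : Z ⟶ Z') : T.tenHom (T.tenHom f g) h ≫ (hT.assoc X' Y' Z').hom =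
      (hT.assoc X Y Z).hom ≫ T.tenHom f (T.tenHom g h) :=
  hT.assocHom_naturality (X := tri X Y Z) (Y := tri X' Y' Z') (triHom f g h)

/-- The associator of a family depends only on its three members. -/
theorem IsStrong.assocHom_eq (hT : T.IsStrong) (X : Fin 3 → C) :
    hT.assocHom X = (hT.assoc (X 0) (X 1) (X 2)).hom := by
  have h := hT.assocHom_naturality (triSelf X)
  have h1 : T.tenHom (T.tenHom (triSelf X 0) (triSelf X 1)) (triSelf X 2) = 𝟙 _ :=
    (congrArg (fun t => T.tenHom t _) (T.tenHom_id _ _)).trans (T.tenHom_id _ _)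
  have h2 : T.tenHom (triSelf X 0) (T.tenHom (triSelf X 1) (triSelf X 2)) = 𝟙 _ :=
    (congrArg (fun t => T.tenHom _ t) (T.tenHom_id _ _)).trans (T.tenHom_id _ _)
  exact (Category.id_comp _).symm.trans ((congrArg (fun t => t ≫ _) h1.symm).trans (h.trans
    ((congrArg (fun t => _ ≫ t) h2).trans (Category.comp_id _))))

theorem IsStrong.assoc_spec (hT : T.IsStrong) (X : Fin 3 → C) :
    (hT.assoc (X 0) (X 1) (X 2)).hom ≫ T.rightHom X =
      T.leftHom X ≫ ((T.F (Fin 3)).map PaB.α).app X := by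
  rw [← hT.assocHom_eq, hT.assocHom_spec]

/-- The associator corresponds to the re-bracketing of words. -/
theorem IsStrong.assoc_ev (hT : T.IsStrong) (hN : T.IsNormalized) (u v w : Word C) :
    (hT.assoc (T.ev u) (T.ev v) (T.ev w)).hom ≫ T.tenHom (𝟙 _) (T.m v w) ≫ T.m u (v.mul w) =
      T.tenHom (T.m u v) (𝟙 _) ≫ T.m (u.mul v) w ≫ T.evMap (Word.assoc u v w) := by
  have h1 := T.leftHom_sub hT hN (tri u v w)
  have h2 := T.rightHom_sub hT hN (tri u v w)
  have h3 := hT.assoc_spec fun k => T.ev (tri u v w k)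
  have h4 := (congrArg (fun t => _ ≫ t) h2.symm).trans ((Category.assoc _ _ _).symm.trans
    ((congrArg (fun t => t ≫ _) h3).trans (Category.assoc _ _ _)))
  exact h4.trans h1

end LaxEndMorphism
end
end PaBOp

namespace PaBOp

universe u

/-! ### The unit object -/

section
variable {D : Type*} [Category D]

theorem unitor_paste {X X₁ X₂ X₃ X₄ Y Z : D} {d : X ⟶ X₁} {g : X₁ ⟶ X₂} {u : X₂ ⟶ X₄} {s : X₂ ⟶ X₃}
    {o : X₃ ⟶ X₄} (h₁ : u = s ≫ o) {b : X₁ ⟶ Y} {n : Y ⟶ Z} {p : Z ⟶ X₄} {i : X ⟶ Y}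
    (h₂ : g ≫ s ≫ o = b ≫ n ≫ p) (h₃ : d ≫ b = i) : d ≫ g ≫ u = i ≫ n ≫ p := by
  rw [h₁, h₂, reassoc_of% h₃]

end

section
variable {C : Type u} [SmallCategory C] [Preadditive C] [Linear ℂ C]

namespace LaxEndMorphism

variable (T : LaxEndMorphism C)

/-- The unit object `T(∅)`. -/
abbrev unitObj : C := T.ev Word.one

/-- The value of `T(∅)` does not depend on the empty family. -/
noncomputable def η (M : Empty → C) : T.unitObj ≅ (T.V (PaB.empty Empty)).obj M :=
  (T.V (PaB.empty Empty)).mapIso (X := Empty.elim) (Y := M) (familyIso fun i => i.elim)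

theorem η_naturality {M N : Empty → C} (f : M ⟶ N) :
    (T.η M).hom ≫ (T.V (PaB.empty Empty)).map f = (T.η N).hom :=
  ((T.V (PaB.empty Empty)).map_comp (X := Empty.elim) _ _).symm.trans
    (congrArg (T.V (PaB.empty Empty)).map (funext fun i => i.elim))

/-- Grafting nothing at the empty tree does nothing to the unit object. -/
theorem η_sub (W : Empty → Word C) :
    (T.η fun i => T.ev (W i)).hom ≫ T.sub (PaB.empty Empty) W ≫ T.evMap (Word.substEmptyOne W) =
      𝟙 T.unitObj := by
  have h1 : T.sub (PaB.empty Empty) W ≫ T.evMap (Word.substEmptyOne W) =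
      T.evMap (v := ⟨Empty, PaB.empty Empty, fun i => T.ev (W i)⟩) (w := Word.one)
        (Word.ofLeaves (v := ⟨Empty, PaB.empty Empty, fun i => T.ev (W i)⟩) (w := Word.one)
          (Equiv.refl Empty) rfl fun i => i.elim) := by
    refine (congrArg (fun t => t ≫ _) (T.sub_empty (PaB.empty Empty) W)).trans ?_
    refine (T.evMap_comp _ _).symm.trans (congrArg T.evMap ?_)
    exact Word.hom_ext (fun i => i.elim) (Word.comp_braid_of_one rfl rfl) fun i => i.elim
  rw [h1, T.evMap_of_braid_one _ rfl (PaB.relabel_refl _)]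
  refine (congrArg (fun t => _ ≫ t) (Category.comp_id _)).trans ?_
  refine ((T.V (PaB.empty Empty)).map_comp (X := Empty.elim) (Z := Empty.elim) _ _).symm.trans ?_
  refine Eq.trans ?_ ((T.V (PaB.empty Empty)).map_id Empty.elim)
  exact congrArg (T.V (PaB.empty Empty)).map (funext fun i => i.elim)

/-- The left unit isomorphism. -/
noncomputable def leftUnitorHom (X : C) : T.ten T.unitObj X ⟶ X :=
  T.tenHom (T.η _).hom (T.unitIso fun _ => X).inv ≫
    T.graft (PaB.empty Empty) PaB.unary PaB.sigmaEmptyL PaB.relabel_sigmaEmptyL (fun _ => X) ≫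
      (T.unitIso fun _ => X).hom

/-- The right unit isomorphism. -/
noncomputable def rightUnitorHom (X : C) : T.ten X T.unitObj ⟶ X :=
  T.tenHom (T.unitIso fun _ => X).inv (T.η _).hom ≫
    T.graft PaB.unary (PaB.empty Empty) PaB.sigmaEmptyR PaB.relabel_sigmaEmptyR (fun _ => X) ≫
      (T.unitIso fun _ => X).hom

theorem leftUnitorHom_naturality {X Y : C} (f : X ⟶ Y) :
    T.tenHom (𝟙 T.unitObj) f ≫ T.leftUnitorHom Y = T.leftUnitorHom X ≫ f := by
  have h1 := T.η_naturality (M := fun _ => X) (N := fun _ => Y) fun _ => f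
  have h2 := T.unitIso_naturality (M := fun _ => X) (N := fun _ => Y) fun _ => f
  have h3 := T.graft_naturality (PaB.empty Empty) PaB.unary PaB.sigmaEmptyL PaB.relabel_sigmaEmptyL
    (X := fun _ => X) (Y := fun _ => Y) fun _ => f
  exact graft_natural_paste ((T.tenHom_comp _ _ _ _).trans ((congrArg₂ (fun s t => T.tenHom s t)
    ((Category.id_comp _).trans h1.symm) (iso_inv_square h2)).trans
      (T.tenHom_comp _ _ _ _).symm)) h3 h2

theorem rightUnitorHom_naturality {X Y : C} (f : X ⟶ Y) :
    T.tenHom f (𝟙 T.unitObj) ≫ T.rightUnitorHom Y = T.rightUnitorHom X ≫ f := by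
  have h1 := T.η_naturality (M := fun _ => X) (N := fun _ => Y) fun _ => f
  have h2 := T.unitIso_naturality (M := fun _ => X) (N := fun _ => Y) fun _ => f
  have h3 := T.graft_naturality PaB.unary (PaB.empty Empty) PaB.sigmaEmptyR PaB.relabel_sigmaEmptyR
    (X := fun _ => X) (Y := fun _ => Y) fun _ => f
  exact graft_natural_paste ((T.tenHom_comp _ _ _ _).trans ((congrArg₂ (fun s t => T.tenHom s t)
    (iso_inv_square h2) ((Category.id_comp _).trans h1.symm)).trans
      (T.tenHom_comp _ _ _ _).symm)) h3 h2

theorem isIso_braid (X Y : C) : IsIso (T.braid X Y) := by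
  have h2 := PaB.isIso_hom PaB.σ
  have h3 := isIso_map_of (T.F (Fin 2)) PaB.σ h2
  exact isIso_comp_of _ _ (NatIso.isIso_app_of_isIso _ _) (isIso_comp_of _ _ (Iso.isIso_inv _)
    (Iso.isIso_inv _))

variable {T}

/-- The left unit isomorphism corresponds to erasing the empty word. -/
theorem IsNormalized.leftUnitorHom_ev (hN : T.IsNormalized) (hT : T.IsStrong) (w : Word C) :
    T.leftUnitorHom (T.ev w) = T.m Word.one w ≫ T.evMap (Word.oneMul w) := by
  have h1 : (T.unitIso fun _ => T.ev w).hom =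
      T.sub PaB.unary (fun _ => w) ≫ T.evMap (Word.substUnary w) := (hN.unitMap_eq hT w).symm
  have h2 := T.graft_sub (PaB.empty Empty) PaB.unary PaB.sigmaEmptyL PaB.relabel_sigmaEmptyL
    (fun _ => w) (Word.graftEmptyL w) _ _ (Word.graftEmptyL_comp w)
  have h3 := T.η_sub fun _ => w
  have h4 : (T.unitIso fun _ => T.ev w).inv ≫ T.sub PaB.unary (fun _ => w) ≫
      T.evMap (Word.substUnary w) = 𝟙 _ := by
    rw [← h1, Iso.inv_hom_id]
  exact (unitor_paste h1 h2 ((T.tenHom_comp _ _ _ _).trans ((congrArg₂ (fun s t => T.tenHom s t)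
    h3 h4).trans (T.tenHom_id _ _)))).trans (Category.id_comp _)

/-- The right unit isomorphism corresponds to erasing the empty word. -/
theorem IsNormalized.rightUnitorHom_ev (hN : T.IsNormalized) (hT : T.IsStrong) (w : Word C) :
    T.rightUnitorHom (T.ev w) = T.m w Word.one ≫ T.evMap (Word.mulOne w) := by
  have h1 : (T.unitIso fun _ => T.ev w).hom =
      T.sub PaB.unary (fun _ => w) ≫ T.evMap (Word.substUnary w) := (hN.unitMap_eq hT w).symm
  have h2 := T.graft_sub PaB.unary (PaB.empty Empty) PaB.sigmaEmptyR PaB.relabel_sigmaEmptyR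
    (fun _ => w) (Word.graftEmptyR w) _ _ (Word.graftEmptyR_comp w)
  have h3 := T.η_sub fun _ => w
  have h4 : (T.unitIso fun _ => T.ev w).inv ≫ T.sub PaB.unary (fun _ => w) ≫
      T.evMap (Word.substUnary w) = 𝟙 _ := by
    rw [← h1, Iso.inv_hom_id]
  exact (unitor_paste h1 h2 ((T.tenHom_comp _ _ _ _).trans ((congrArg₂ (fun s t => T.tenHom s t)
    h4 h3).trans (T.tenHom_id _ _)))).trans (Category.id_comp _)

theorem IsStrong.isIso_leftUnitorHom (hT : T.IsStrong) (X : C) : IsIso (T.leftUnitorHom X) :=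
  isIso_comp_of _ _ (T.isIso_tenHom (T.η _) (T.unitIso _).symm)
    (isIso_comp_of _ _ (hT.isIso_graft _ _ _ _ _) (Iso.isIso_hom _))

theorem IsStrong.isIso_rightUnitorHom (hT : T.IsStrong) (X : C) : IsIso (T.rightUnitorHom X) :=
  isIso_comp_of _ _ (T.isIso_tenHom (T.unitIso _).symm (T.η _))
    (isIso_comp_of _ _ (hT.isIso_graft _ _ _ _ _) (Iso.isIso_hom _))

variable (T)

theorem tenHom_comp_assoc {X Y X' Y' X'' Y'' Z : C} (f : X ⟶ X') (g : Y ⟶ Y') (f' : X' ⟶ X'')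
    (g' : Y' ⟶ Y'') (h : T.ten X'' Y'' ⟶ Z) :
    T.tenHom f g ≫ T.tenHom f' g' ≫ h = T.tenHom (f ≫ f') (g ≫ g') ≫ h := by
  rw [← T.tenHom_comp, Category.assoc]

theorem m_naturality_left {v v' : Word C} (f : v ⟶ v') (w : Word C) :
    T.tenHom (T.evMap f) (𝟙 _) ≫ T.m v' w = T.m v w ≫ T.evMap (Word.mulMap f (𝟙 w)) := by
  rw [← T.m_naturality, T.evMap_id]

theorem m_naturality_right (v : Word C) {w w' : Word C} (f : w ⟶ w') :
    T.tenHom (𝟙 _) (T.evMap f) ≫ T.m v w' = T.m v w ≫ T.evMap (Word.mulMap (𝟙 v) f) := by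
  rw [← T.m_naturality, T.evMap_id]

/-- Every object of `C` is isomorphic to the value of a word with one letter. -/
def evSingle (X : C) : T.ev (Word.single X) ≅ X := T.unitIso fun _ => X

end LaxEndMorphism
end
end PaBOp

namespace PaBOp

universe u

/-! ### Coherence -/

section
variable {C : Type u} [SmallCategory C] [Preadditive C] [Linear ℂ C]

namespace LaxEndMorphism

variable {T : LaxEndMorphism C} (hT : T.IsStrong) (hN : T.IsNormalized)

include hT in
theorem IsStrong.cancel_m {X : C} {v w : Word C} {f g : X ⟶ T.ten (T.ev v) (T.ev w)}
    (h : f ≫ T.m v w = g ≫ T.m v w) : f = g := by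
  have := hT.isIso_m v w
  exact (cancel_mono _).1 h

include hT in
/-- Morphisms into an iterated tensor product of values of words are equal if they agree after
concatenation of the words. -/
theorem IsStrong.cancel_m₃ {X : C} {u v w : Word C}
    {f g : X ⟶ T.ten (T.ev u) (T.ten (T.ev v) (T.ev w))}
    (h : f ≫ T.tenHom (𝟙 _) (T.m v w) ≫ T.m u (v.mul w) =
      g ≫ T.tenHom (𝟙 _) (T.m v w) ≫ T.m u (v.mul w)) : f = g := by
  have h1 := hT.isIso_m v w
  have h2 := hT.isIso_m u (v.mul w)
  have h3 : IsIso (T.tenHom (𝟙 (T.ev u)) (T.m v w)) :=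
    T.isIso_tenHom (Iso.refl _) (asIso (T.m v w))
  have h4 := isIso_comp_of _ _ h3 h2
  exact (cancel_mono _).1 h

include hT in
theorem IsStrong.cancel_m₄ {X : C} {t u v w : Word C}
    {f g : X ⟶ T.ten (T.ev t) (T.ten (T.ev u) (T.ten (T.ev v) (T.ev w)))}
    (h : f ≫ T.tenHom (𝟙 _) (T.tenHom (𝟙 _) (T.m v w) ≫ T.m u (v.mul w)) ≫
        T.m t (u.mul (v.mul w)) =
      g ≫ T.tenHom (𝟙 _) (T.tenHom (𝟙 _) (T.m v w) ≫ T.m u (v.mul w)) ≫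
        T.m t (u.mul (v.mul w))) : f = g := by
  have h1 := hT.isIso_m v w
  have h2 := hT.isIso_m u (v.mul w)
  have h3 : IsIso (T.tenHom (𝟙 (T.ev u)) (T.m v w)) :=
    T.isIso_tenHom (Iso.refl _) (asIso (T.m v w))
  have h4 := isIso_comp_of _ _ h3 h2
  have h5 : IsIso (T.tenHom (𝟙 (T.ev t)) (T.tenHom (𝟙 _) (T.m v w) ≫ T.m u (v.mul w))) :=
    T.isIso_tenHom (Iso.refl _) (asIso (T.tenHom (𝟙 _) (T.m v w) ≫ T.m u (v.mul w)))
  have h6 := isIso_comp_of _ _ h5 (hT.isIso_m t (u.mul (v.mul w)))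
  exact (cancel_mono _).1 h

include hN in
/-- The pentagon for values of words. Each edge is transported by `m` to the corresponding morphism
of words, so that the pentagon for words applies. -/
theorem IsStrong.pentagon_ev (t u v w : Word C) :
    T.tenHom (hT.assoc (T.ev t) (T.ev u) (T.ev v)).hom (𝟙 (T.ev w)) ≫
        (hT.assoc (T.ev t) (T.ten (T.ev u) (T.ev v)) (T.ev w)).hom ≫
          T.tenHom (𝟙 (T.ev t)) (hT.assoc (T.ev u) (T.ev v) (T.ev w)).hom =
      (hT.assoc (T.ten (T.ev t) (T.ev u)) (T.ev v) (T.ev w)).hom ≫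
        (hT.assoc (T.ev t) (T.ev u) (T.ten (T.ev v) (T.ev w))).hom := by
  refine hT.cancel_m₄ ?_
  have e1 : T.tenHom (𝟙 (T.ev t)) (hT.assoc (T.ev u) (T.ev v) (T.ev w)).hom ≫
      T.tenHom (𝟙 _) (T.tenHom (𝟙 _) (T.m v w) ≫ T.m u (v.mul w)) ≫ T.m t (u.mul (v.mul w)) =
      T.tenHom (𝟙 _) (T.tenHom (T.m u v) (𝟙 _)) ≫ T.tenHom (𝟙 _) (T.m (u.mul v) w) ≫
        T.m t ((u.mul v).mul w) ≫ T.evMap (Word.mulMap (𝟙 t) (Word.assoc u v w)) := by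
    rw [T.tenHom_comp_assoc, hT.assoc_ev hN, ← m_naturality_right]
    simp only [T.tenHom_comp_assoc, Category.comp_id]
  have e2 : T.tenHom (hT.assoc (T.ev t) (T.ev u) (T.ev v)).hom (𝟙 (T.ev w)) ≫
      T.tenHom (T.tenHom (𝟙 _) (T.m u v)) (𝟙 (T.ev w)) ≫ T.tenHom (T.m t (u.mul v)) (𝟙 (T.ev w)) ≫
        T.m (t.mul (u.mul v)) w =
      T.tenHom (T.tenHom (T.m t u) (𝟙 _)) (𝟙 _) ≫ T.tenHom (T.m (t.mul u) v) (𝟙 _) ≫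
        T.m ((t.mul u).mul v) w ≫ T.evMap (Word.mulMap (Word.assoc t u v) (𝟙 w)) := by
    rw [← m_naturality_left]
    simp only [T.tenHom_comp_assoc, Category.comp_id, hT.assoc_ev hN]
  have e3 : (hT.assoc (T.ten (T.ev t) (T.ev u)) (T.ev v) (T.ev w)).hom ≫
      T.tenHom (T.m t u) (T.m v w) ≫ T.m (t.mul u) (v.mul w) =
      T.tenHom (T.tenHom (T.m t u) (𝟙 _)) (𝟙 _) ≫ T.tenHom (T.m (t.mul u) v) (𝟙 _) ≫
        T.m ((t.mul u).mul v) w ≫ T.evMap (Word.assoc (t.mul u) v w) := by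
    rw [← hT.assoc_ev hN, reassoc_of% hT.assoc_naturality, T.tenHom_comp_assoc]
    simp only [T.tenHom_id, Category.comp_id, Category.id_comp]
  have e4 : (hT.assoc (T.ev t) (T.ev u) (T.ten (T.ev v) (T.ev w))).hom ≫
      T.tenHom (𝟙 _) (T.tenHom (𝟙 _) (T.m v w) ≫ T.m u (v.mul w)) ≫ T.m t (u.mul (v.mul w)) =
      T.tenHom (T.m t u) (T.m v w) ≫ T.m (t.mul u) (v.mul w) ≫
        T.evMap (Word.assoc t u (v.mul w)) := by
    have h := hT.assoc_naturality (𝟙 (T.ev t)) (𝟙 (T.ev u)) (T.m v w)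
    rw [← Category.id_comp (𝟙 (T.ev t)), ← T.tenHom_comp, Category.assoc, ← reassoc_of% h,
      hT.assoc_ev hN, T.tenHom_comp_assoc]
    simp only [T.tenHom_id, Category.comp_id, Category.id_comp]
  have e5 := congrArg T.evMap (Word.pentagon t u v w)
  rw [T.evMap_comp, T.evMap_comp, T.evMap_comp] at e5
  have h := hT.assoc_naturality (𝟙 (T.ev t)) (T.m u v) (𝟙 (T.ev w))
  simp only [Category.assoc]
  rw [e1, ← reassoc_of% h, e4, reassoc_of% e3, reassoc_of% hT.assoc_ev hN, reassoc_of% e2, e5]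

include hN in
theorem IsStrong.triangle_ev (v w : Word C) :
    (hT.assoc (T.ev v) T.unitObj (T.ev w)).hom ≫ T.tenHom (𝟙 _) (T.leftUnitorHom (T.ev w)) =
      T.tenHom (T.rightUnitorHom (T.ev v)) (𝟙 _) := by
  refine hT.cancel_m ?_
  have e5 := congrArg T.evMap (Word.triangle v w)
  rw [T.evMap_comp] at e5
  rw [hN.leftUnitorHom_ev hT, hN.rightUnitorHom_ev hT, ← Category.id_comp (𝟙 (T.ev v)),
    ← T.tenHom_comp, Category.assoc, Category.assoc, m_naturality_right]
  rw [reassoc_of% hT.assoc_ev hN, e5, ← m_naturality_left, T.tenHom_comp_assoc, Category.id_comp]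

include hT hN in
theorem IsStrong.hexagon_ev (u v w : Word C) :
    (hT.assoc (T.ev u) (T.ev v) (T.ev w)).hom ≫ T.braid (T.ev u) (T.ten (T.ev v) (T.ev w)) ≫
        (hT.assoc (T.ev v) (T.ev w) (T.ev u)).hom =
      T.tenHom (T.braid (T.ev u) (T.ev v)) (𝟙 _) ≫ (hT.assoc (T.ev v) (T.ev u) (T.ev w)).hom ≫
        T.tenHom (𝟙 _) (T.braid (T.ev u) (T.ev w)) := by
  refine hT.cancel_m₃ ?_
  have e5 := congrArg T.evMap (Word.hexagon u v w)
  simp only [T.evMap_comp] at e5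
  have e1 : T.tenHom (𝟙 (T.ev v)) (T.braid (T.ev u) (T.ev w)) ≫ T.tenHom (𝟙 _) (T.m w u) ≫
      T.m v (w.mul u) = T.tenHom (𝟙 _) (T.m u w) ≫ T.m v (u.mul w) ≫
        T.evMap (Word.mulMap (𝟙 v) (Word.crossHom u w)) := by
    rw [T.tenHom_comp_assoc, T.braid_ev, ← m_naturality_right, T.tenHom_comp_assoc]
  have e2 : T.tenHom (T.braid (T.ev u) (T.ev v)) (𝟙 (T.ev w)) ≫ T.tenHom (T.m v u) (𝟙 _) ≫
      T.m (v.mul u) w = T.tenHom (T.m u v) (𝟙 _) ≫ T.m (u.mul v) w ≫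
        T.evMap (Word.mulMap (Word.crossHom u v) (𝟙 w)) := by
    rw [T.tenHom_comp_assoc, T.braid_ev, ← m_naturality_left, T.tenHom_comp_assoc]
  have h := T.braid_naturality (𝟙 (T.ev u)) (T.m v w)
  simp only [Category.assoc]
  rw [e1, reassoc_of% hT.assoc_ev hN, reassoc_of% e2, ← e5, hT.assoc_ev hN, ← reassoc_of% h,
    reassoc_of% T.braid_ev, reassoc_of% hT.assoc_ev hN]

include hT hN in
theorem IsStrong.hexagon_ev' (u v w : Word C) :
    T.braid (T.ten (T.ev u) (T.ev v)) (T.ev w) =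
      (hT.assoc (T.ev u) (T.ev v) (T.ev w)).hom ≫ T.tenHom (𝟙 _) (T.braid (T.ev v) (T.ev w)) ≫
        (hT.assoc (T.ev u) (T.ev w) (T.ev v)).inv ≫ T.tenHom (T.braid (T.ev u) (T.ev w)) (𝟙 _) ≫
          (hT.assoc (T.ev w) (T.ev u) (T.ev v)).hom := by
  refine hT.cancel_m₃ ?_
  have e5 := congrArg T.evMap (Word.hexagon' u v w)
  simp only [T.evMap_comp] at e5
  have e1 : T.tenHom (𝟙 (T.ev u)) (T.braid (T.ev v) (T.ev w)) ≫ T.tenHom (𝟙 _) (T.m w v) ≫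
      T.m u (w.mul v) = T.tenHom (𝟙 _) (T.m v w) ≫ T.m u (v.mul w) ≫
        T.evMap (Word.mulMap (𝟙 u) (Word.crossHom v w)) := by
    rw [T.tenHom_comp_assoc, T.braid_ev, ← m_naturality_right, T.tenHom_comp_assoc]
  have e2 : T.tenHom (T.braid (T.ev u) (T.ev w)) (𝟙 (T.ev v)) ≫ T.tenHom (T.m w u) (𝟙 _) ≫
      T.m (w.mul u) v = T.tenHom (T.m u w) (𝟙 _) ≫ T.m (u.mul w) v ≫
        T.evMap (Word.mulMap (Word.crossHom u w) (𝟙 v)) := by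
    rw [T.tenHom_comp_assoc, T.braid_ev, ← m_naturality_left, T.tenHom_comp_assoc]
  have e3 : (hT.assoc (T.ev u) (T.ev w) (T.ev v)).inv ≫ T.tenHom (T.m u w) (𝟙 _) ≫
      T.m (u.mul w) v = T.tenHom (𝟙 _) (T.m w v) ≫ T.m u (w.mul v) ≫
        T.evMap (Word.assocInv u w v) := by
    rw [Iso.inv_comp_eq, reassoc_of% hT.assoc_ev hN, ← T.evMap_comp, Word.assoc_assocInv,
      T.evMap_id, Category.comp_id]
  have h := T.braid_naturality (T.m u v) (𝟙 (T.ev w))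
  simp only [Category.assoc]
  rw [hT.assoc_ev hN, reassoc_of% e2, reassoc_of% e3, reassoc_of% e1, reassoc_of% hT.assoc_ev hN,
    ← e5, ← reassoc_of% h, T.braid_ev]

end LaxEndMorphism
end
end PaBOp

namespace PaBOp

universe u

/-! ### The braided tensor category -/

section
variable {C : Type u} [SmallCategory C] [Preadditive C] [Linear ℂ C]

namespace LaxEndMorphism

variable {T : LaxEndMorphism C} (hT : T.IsStrong) (hN : T.IsNormalized)

include hN in
/-- The pentagon; by naturality, it suffices to treat values of words with one letter. -/
theorem IsStrong.pentagon (W X Y Z : C) :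
    T.tenHom (hT.assoc W X Y).hom (𝟙 Z) ≫ (hT.assoc W (T.ten X Y) Z).hom ≫
        T.tenHom (𝟙 W) (hT.assoc X Y Z).hom =
      (hT.assoc (T.ten W X) Y Z).hom ≫ (hT.assoc W X (T.ten Y Z)).hom := by
  have h := hT.pentagon_ev hN (Word.single W) (Word.single X) (Word.single Y) (Word.single Z)
  let w := T.evSingle W
  let x := T.evSingle X
  let y := T.evSingle Y
  let z := T.evSingle Z
  have h0 := T.isIso_tenHom (T.tenIso (T.tenIso w x) y) z
  change IsIso (T.tenHom (T.tenHom (T.tenHom w.hom x.hom) y.hom) z.hom) at h0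
  rw [← cancel_epi (T.tenHom (T.tenHom (T.tenHom w.hom x.hom) y.hom) z.hom)]
  rw [T.tenHom_comp_assoc, hT.assoc_naturality, Category.comp_id, ← Category.id_comp z.hom,
    ← T.tenHom_comp, Category.assoc, reassoc_of% hT.assoc_naturality, T.tenHom_comp,
    hT.assoc_naturality, Category.comp_id, ← Category.id_comp w.hom, ← T.tenHom_comp, reassoc_of% h,
    Category.id_comp, Category.id_comp, reassoc_of% hT.assoc_naturality, hT.assoc_naturality]

include hN in
theorem IsStrong.triangle (X Y : C) :
    (hT.assoc X T.unitObj Y).hom ≫ T.tenHom (𝟙 X) (T.leftUnitorHom Y) =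
      T.tenHom (T.rightUnitorHom X) (𝟙 Y) := by
  have h := hT.triangle_ev hN (Word.single X) (Word.single Y)
  let x := T.evSingle X
  let y := T.evSingle Y
  have h0 := T.isIso_tenHom (T.tenIso x (Iso.refl T.unitObj)) y
  change IsIso (T.tenHom (T.tenHom x.hom (𝟙 _)) y.hom) at h0
  rw [← cancel_epi (T.tenHom (T.tenHom x.hom (𝟙 _)) y.hom), reassoc_of% hT.assoc_naturality,
    T.tenHom_comp, T.tenHom_comp, T.leftUnitorHom_naturality, T.rightUnitorHom_naturality,
    Category.comp_id, Category.comp_id, ← Category.id_comp x.hom, ← T.tenHom_comp, reassoc_of% h,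
    T.tenHom_comp, Category.id_comp, Category.id_comp]

include hT hN in
theorem IsStrong.hexagon (X Y Z : C) :
    (hT.assoc X Y Z).hom ≫ T.braid X (T.ten Y Z) ≫ (hT.assoc Y Z X).hom =
      T.tenHom (T.braid X Y) (𝟙 _) ≫ (hT.assoc Y X Z).hom ≫ T.tenHom (𝟙 _) (T.braid X Z) := by
  have h := hT.hexagon_ev hN (Word.single X) (Word.single Y) (Word.single Z)
  let x := T.evSingle X
  let y := T.evSingle Y
  let z := T.evSingle Z
  have h0 := T.isIso_tenHom (T.tenIso x y) z
  change IsIso (T.tenHom (T.tenHom x.hom y.hom) z.hom) at h0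
  rw [← cancel_epi (T.tenHom (T.tenHom x.hom y.hom) z.hom), reassoc_of% hT.assoc_naturality,
    reassoc_of% T.braid_naturality, hT.assoc_naturality, reassoc_of% h, T.tenHom_comp_assoc,
    T.braid_naturality, Category.comp_id, ← Category.id_comp z.hom, ← T.tenHom_comp,
    Category.assoc, reassoc_of% hT.assoc_naturality, T.tenHom_comp, T.tenHom_comp,
    T.braid_naturality, Category.comp_id, Category.id_comp, Category.id_comp]

theorem IsStrong.assoc_inv_naturality {X Y Z X' Y' Z' : C} (f : X ⟶ X') (g : Y ⟶ Y')
    (h : Z ⟶ Z') : T.tenHom f (T.tenHom g h) ≫ (hT.assoc X' Y' Z').inv =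
      (hT.assoc X Y Z).inv ≫ T.tenHom (T.tenHom f g) h :=
  iso_inv_square (hT.assoc_naturality f g h)

include hT hN in
theorem IsStrong.hexagon' (X Y Z : C) :
    T.braid (T.ten X Y) Z = (hT.assoc X Y Z).hom ≫ T.tenHom (𝟙 _) (T.braid Y Z) ≫
      (hT.assoc X Z Y).inv ≫ T.tenHom (T.braid X Z) (𝟙 _) ≫ (hT.assoc Z X Y).hom := by
  have h := hT.hexagon_ev' hN (Word.single X) (Word.single Y) (Word.single Z)
  let x := T.evSingle X
  let y := T.evSingle Y
  let z := T.evSingle Z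
  have h0 := T.isIso_tenHom (T.tenIso x y) z
  change IsIso (T.tenHom (T.tenHom x.hom y.hom) z.hom) at h0
  rw [← cancel_epi (T.tenHom (T.tenHom x.hom y.hom) z.hom), T.braid_naturality, h]
  simp only [Category.assoc]
  rw [reassoc_of% hT.assoc_naturality, T.tenHom_comp_assoc, T.braid_naturality, Category.comp_id,
    ← Category.id_comp x.hom, ← T.tenHom_comp, Category.assoc,
    reassoc_of% hT.assoc_inv_naturality, T.tenHom_comp_assoc, Category.id_comp, Category.comp_id,
    T.braid_naturality, ← Category.id_comp y.hom, ← T.tenHom_comp, Category.assoc,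
    hT.assoc_naturality, Category.id_comp]

/-- The monoidal structure with tensor product `T(12)` and unit object `T(∅)`. -/
@[reducible] noncomputable def IsStrong.monoidalCategoryStruct : MonoidalCategoryStruct C where
  tensorObj X Y := T.ten X Y
  tensorHom f g := T.tenHom f g
  whiskerLeft X _ _ f := T.tenHom (𝟙 X) f
  whiskerRight f Y := T.tenHom f (𝟙 Y)
  tensorUnit := T.unitObj
  associator X Y Z := hT.assoc X Y Z
  leftUnitor X := @asIso _ _ _ _ _ (hT.isIso_leftUnitorHom X)
  rightUnitor X := @asIso _ _ _ _ _ (hT.isIso_rightUnitorHom X)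

/-- The monoidal category with tensor product `T(12)` and unit object `T(∅)`. -/
@[reducible] noncomputable def IsStrong.monoidalCategory : MonoidalCategory C :=
  letI := hT.monoidalCategoryStruct
  MonoidalCategory.ofTensorHom
    (id_tensorHom_id := T.tenHom_id)
    (id_tensorHom := fun _ _ _ _ => rfl)
    (tensorHom_id := fun _ _ => rfl)
    (tensorHom_comp_tensorHom := T.tenHom_comp)
    (associator_naturality := hT.assoc_naturality)
    (leftUnitor_naturality := T.leftUnitorHom_naturality)
    (rightUnitor_naturality := T.rightUnitorHom_naturality)
    (pentagon := hT.pentagon hN)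
    (triangle := hT.triangle hN)

/-- The braided monoidal category with braiding `T(σ)`. -/
@[reducible] noncomputable def IsStrong.braidedCategory :
    letI := hT.monoidalCategory hN
    BraidedCategory C :=
  letI := hT.monoidalCategory hN
  { braiding := fun X Y => @asIso _ _ _ _ _ (T.isIso_braid X Y)
    braiding_naturality_right := fun X _ _ f => T.braid_naturality (𝟙 X) f
    braiding_naturality_left := fun f Z => T.braid_naturality f (𝟙 Z)
    hexagon_forward := hT.hexagon hN
    hexagon_reverse := fun X Y Z => by
      have h := hT.hexagon' hN X Y Z
      change (hT.assoc X Y Z).inv ≫ T.braid (T.ten X Y) Z ≫ (hT.assoc Z X Y).inv =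
        T.tenHom (𝟙 X) (T.braid Y Z) ≫ (hT.assoc X Z Y).inv ≫ T.tenHom (T.braid X Z) (𝟙 Y)
      rw [h]
      simp }

theorem tenHom_add_left {X X' : C} (f g : X ⟶ X') (Y : C) :
    T.tenHom (f + g) (𝟙 Y) = T.tenHom f (𝟙 Y) + T.tenHom g (𝟙 Y) :=
  (T.multilinear PaB.two).map_add (M := cons X Y) (N := cons X' Y) 0 _ _ _
    (fun j hj => by
      match j with
      | 0 => exact absurd rfl hj
      | 1 => exact ⟨rfl, rfl⟩) rfl

theorem tenHom_add_right (X : C) {Y Y' : C} (f g : Y ⟶ Y') :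
    T.tenHom (𝟙 X) (f + g) = T.tenHom (𝟙 X) f + T.tenHom (𝟙 X) g :=
  (T.multilinear PaB.two).map_add (M := cons X Y) (N := cons X Y') 1 _ _ _
    (fun j hj => by
      match j with
      | 0 => exact ⟨rfl, rfl⟩
      | 1 => exact absurd rfl hj) rfl

theorem tenHom_smul_left (c : ℂ) {X X' : C} (f : X ⟶ X') (Y : C) :
    T.tenHom (c • f) (𝟙 Y) = c • T.tenHom f (𝟙 Y) :=
  (T.multilinear PaB.two).map_smul (M := cons X Y) (N := cons X' Y) 0 _ _ _
    (fun j hj => by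
      match j with
      | 0 => exact absurd rfl hj
      | 1 => rfl) rfl

theorem tenHom_smul_right (c : ℂ) (X : C) {Y Y' : C} (f : Y ⟶ Y') :
    T.tenHom (𝟙 X) (c • f) = c • T.tenHom (𝟙 X) f :=
  (T.multilinear PaB.two).map_smul (M := cons X Y) (N := cons X Y') 1 _ _ _
    (fun j hj => by
      match j with
      | 0 => rfl
      | 1 => exact absurd rfl hj) rfl

theorem IsStrong.monoidalPreadditive :
    letI := hT.monoidalCategory hN
    MonoidalPreadditive C :=
  letI := hT.monoidalCategory hN
  { whiskerLeft_zero := fun {X Y Z} => by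
      have h := tenHom_smul_right (T := T) 0 X (0 : Y ⟶ Z)
      rwa [zero_smul, zero_smul] at h
    zero_whiskerRight := fun {X Y Z} => by
      have h := tenHom_smul_left (T := T) 0 (0 : Y ⟶ Z) X
      rwa [zero_smul, zero_smul] at h
    whiskerLeft_add := fun f g => tenHom_add_right _ f g
    add_whiskerRight := fun f g => tenHom_add_left f g _ }

theorem IsStrong.monoidalLinear :
    letI := hT.monoidalCategory hN
    haveI := hT.monoidalPreadditive hN
    MonoidalLinear ℂ C :=
  letI := hT.monoidalCategory hN
  haveI := hT.monoidalPreadditive hN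
  { whiskerLeft_smul := fun X _ _ c f => tenHom_smul_right c X f
    smul_whiskerRight := fun c _ _ f X => tenHom_smul_left c f X }

/-- The braided monoidal structure comes from `T`. -/
noncomputable def IsStrong.inducedBraiding :
    letI := hT.monoidalCategory hN
    letI := hT.braidedCategory hN
    InducedBraiding T :=
  letI := hT.monoidalCategory hN
  letI := hT.braidedCategory hN
  { τ := T.τ
    τ_natural := T.τ_naturality
    η := T.η
    braiding := T.braid_spec
    associator := fun _ X => by
      have h := hT.assoc_spec X
      refine Eq.trans ?_ (h.trans ?_)
      · rfl
      · exact (Category.assoc _ _ _).trans (congrArg (fun t => _ ≫ t) ((Category.assoc _ _ _).trans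
          (congrArg (fun t => _ ≫ t) (Category.assoc _ _ _))))
    leftUnitor := fun _ X => by
      exact congrArg (fun t => _ ≫ t) ((Category.assoc _ _ _).trans
          (congrArg (fun t => _ ≫ t) (Category.assoc _ _ _)))
    rightUnitor := fun _ X => by
      exact congrArg (fun t => _ ≫ t) ((Category.assoc _ _ _).trans
          (congrArg (fun t => _ ≫ t) (Category.assoc _ _ _))) }

/-- The tensor product, the unit object and the braiding do not involve `μ`, and nothing is required
of the associator and the unit isomorphisms if `T` is not normalized. -/
def _root_.PaBOp.InducedBraiding.ofNotNormalized [MonoidalCategory C] [BraidedCategory C]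
    {T T' : LaxEndMorphism C} (h : T'.toPreEndMorphism = T.toPreEndMorphism)
    (B : InducedBraiding T') (hN : ¬ T.IsNormalized) : InducedBraiding T := by
  obtain ⟨P, μ, h1, h2, h3, h4⟩ := T
  obtain ⟨P', μ', h1', h2', h3', h4'⟩ := T'
  dsimp only at h
  subst h
  exact
    { τ := B.τ
      τ_natural := B.τ_natural
      η := B.η
      braiding := B.braiding
      associator := fun h => absurd h hN
      leftUnitor := fun h => absurd h hN
      rightUnitor := fun h => absurd h hN }

/-- A strong 2-morphism makes `C` a braided tensor category. If `μ_{1; 1}` is not the identity, the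
associator and the unit isomorphisms are those of a normalized `T'` with the same underlying
functors. -/
theorem IsStrong.exists_inducedBraiding (hT : T.IsStrong) :
    ∃ (_ : MonoidalCategory C) (_ : BraidedCategory C) (_ : MonoidalPreadditive C),
      MonoidalLinear ℂ C ∧ Nonempty (InducedBraiding T) := by
  by_cases hN : T.IsNormalized
  · exact ⟨hT.monoidalCategory hN, hT.braidedCategory hN, hT.monoidalPreadditive hN,
      hT.monoidalLinear hN, ⟨hT.inducedBraiding hN⟩⟩
  · obtain ⟨T', h, hT', hN'⟩ := T.exists_normalized hT
    let _ := hT'.monoidalCategory hN'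
    let _ := hT'.braidedCategory hN'
    exact ⟨hT'.monoidalCategory hN', hT'.braidedCategory hN', hT'.monoidalPreadditive hN',
      hT'.monoidalLinear hN', ⟨(hT'.inducedBraiding hN').ofNotNormalized h hN⟩⟩

end LaxEndMorphism
end
end PaBOp

open CategoryTheory Opposite PaBOp

theorem mainTheorem5 {C : Type*} [SmallCategory C] [Preadditive C] [Linear ℂ C]
    (ρ : LaxAction C)
    (h₁ : IsRepresentable ((ρ.V (PaB.empty Empty)).obj (op Empty.elim)))
    (h₂ : ∀ M : Fin 2 → C, IsRepresentable ((ρ.V PaB.two).obj (op M)))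
    (h₃ : ∀ n : ℕ, IsIso (ρ.stdMap (n + 1)))
    (h₄ : ∀ (r : ℕ) (p : PaB.stdIdx r), 1 ≤ r → IsIso (ρ.μ (PaB.std r) (PaB.erase p))) :
    ρ.IsRepresentative ∧ ρ.IsStrong ∧
      ∃ T : LaxEndMorphism C, T.IsStrong ∧ Nonempty (Represents C ρ T) ∧
        ∃ (_ : MonoidalCategory C) (_ : BraidedCategory C) (_ : MonoidalPreadditive C),
          MonoidalLinear ℂ C ∧ Nonempty (InducedBraiding T) := by
  have hρ : ρ.IsRepresentative := ρ.isRepresentative_of_std h₁ h₂ h₃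
  have hP : ∀ {I : Type} (J : I → Type), (LaxAction.inducedPreRepresents hρ).Strong J :=
    fun J => PreRepresents.strong_of_std _ h₃ h₄ J
  exact ⟨hρ, PreRepresents.action_isStrong _ hP, PreRepresents.endMorphism hP,
    PreRepresents.endMorphism_isStrong hP, ⟨PreRepresents.represents hP⟩,
    LaxEndMorphism.IsStrong.exists_inducedBraiding (PreRepresents.endMorphism_isStrong hP)⟩
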